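/- All function spaces are over $\mathbb R^3$ and complex valued, with the convention $1/\infty=0$. A pair $(q,r)$ of exponents in $[1,\infty]$ is called admissible if $$\frac2q+\frac3r=\frac32,\qquad r\in[2,6].$$ For $\varepsilon>0$ and $t\ge 0$ let $e^{(i+\varepsilon)t\Delta}$ be the heat-Schrödinger propagator, i.e. the Fourier multiplier (acting on tempered distributions) that multiplies the Fourier transform $\int e^{-ix\cdot\xi}f(x)\,dx$ by $e^{-(i+\varepsilon)t|\xi|^2}$. The integrals in (ii) and (iii) are weak integrals of tempered distributions, $\nabla$ is the distributional gradient in $x$, and each estimate includes the assertion that its left-hand side belongs to the indicated space $L^q([0,T],L^r(\mathbb R^3))$. (i) (Homogeneous estimate.) There is an absolute constant $C$ such that for all $\varepsilon>0$, $T>0$, all admissible pairs $(q,r)$ and all $f\in L^2(\mathbb R^3)$, $$\|e^{(i+\varepsilon)t\Delta}f\|_{L^q([0,T],L^r(\mathbb R^3))}\le C\,\|f\|_{L^2(\mathbb R^3)}.$$ (ii) (Inhomogeneous retarded estimate.) Let $\varepsilon>0$, let $(q,r)$ be admissible, and let $(s,p)\in[1,\infty]^2$ satisfy $$\frac2s+\frac3p=\frac72,\qquad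 \begin{cases}\frac12\le\frac1p\le 1 & \text{if } 2\le r<3,\\[2pt] \frac12\le\frac1p<\frac1r+\frac23 & \text{if } 3\le r\le 6,\end{cases}$$ and, in the case $(q,r)=(\infty,2)$, also $s\le 2$ (equivalently $p\ge\frac65$). Then there is a constant $C=C(\varepsilon,q,r,s,p)$, independent of $T$, such that for all $T>0$ and all $F\in L^s([0,T],L^p(\mathbb R^3))$, $$\Big\|\int_0^t e^{(i+\varepsilon)(t-\tau)\Delta}F(\tau)\,d\tau\Big\|_{L^q([0,T],L^r(\mathbb R^3))}\le C\,\|F\|_{L^s([0,T],L^p(\mathbb R^3))}.$$ (iii) (Inhomogeneous retarded estimate with a gain of one derivative.) Let $\varepsilon>0$, let $(q,r)\ne(2,6)$ be admissible, and let $(s,p)\in[1,\infty]^2$ satisfy $$\frac2s+\frac3p=\frac52,\qquad \frac12\le\frac1p<\frac1r+\frac13,$$ and, in the case $(q,r)=(\infty,2)$, also $s\le2$ (equivalently $s=p=2$). Then there is a constant $C=C(\varepsilon,q,r,s,p)$, independent of $T$, such that for all $T>0$ and all $F\in L^s([0,T],L^p(\mathbb R^3))$, $$\Big\|\nabla\int_0^t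 e^{(i+\varepsilon)(t-\tau)\Delta}F(\tau)\,d\tau\Big\|_{L^q([0,T],L^r(\mathbb R^3))}\le C\,\|F\|_{L^s([0,T],L^p(\mathbb R^3))}.$$ -/

import Mathlib

open MeasureTheory
open scoped ENNReal NNReal SchwartzMap LineDeriv

/-- Three-dimensional Euclidean space. -/
abbrev R3 : Type := EuclideanSpace ℝ (Fin 3)

/-- Admissible pairs for the Schrödinger flow in dimension three:
`2 / q + 3 / r = 3 / 2` and `r ∈ [2, 6]` (with `2 / ∞ = 0`). -/
def Admissible (q r : ℝ≥0∞) : Prop :=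
  2 / q + 3 / r = 3 / 2 ∧ 2 ≤ r ∧ r ≤ 6

/-- The range of pairs `(s, p)` in the inhomogeneous estimate with target exponent `r`. -/
def DualRange (r s p : ℝ≥0∞) : Prop :=
  2 / s + 3 / p = 7 / 2 ∧ 1 / 2 ≤ 1 / p ∧
    (r < 3 → 1 / p ≤ 1) ∧ (3 ≤ r → 1 / p < 1 / r + 2 / 3)

/-- The range of pairs `(s, p)` in the inhomogeneous gradient estimate with target exponent `r`. -/
def GradDualRange (r s p : ℝ≥0∞) : Prop :=
  2 / s + 3 / p = 5 / 2 ∧ 1 / 2 ≤ 1 / p ∧ 1 / p < 1 / r + 1 / 3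

/-- The heat-Schrödinger propagator `exp ((i + ε) t Δ)` on tempered distributions, for `t ≥ 0`:
the Fourier multiplier with symbol `exp (-(i + ε) t |2πξ|²)`, since `Δ` is the Fourier multiplier
with symbol `-|2πξ|²` in Mathlib's normalisation of the Fourier transform. -/
noncomputable def heatSchrodinger (ε t : ℝ) : 𝓢'(R3, ℂ) →L[ℂ] 𝓢'(R3, ℂ) :=
  TemperedDistribution.fourierMultiplierCLM ℂ fun ξ : R3 ↦
    Complex.exp (-((Complex.I + (ε : ℂ)) * (t : ℂ) * (((2 * Real.pi * ‖ξ‖) ^ 2 : ℝ) : ℂ)))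

/-- `w = ∫₀ᵗ exp ((i + ε) (t - τ) Δ) F(τ) dτ`, as a weak integral of tempered distributions: all
pairings with test functions are integrable on `(0, t)`, and they integrate to those of `w`. -/
def IsDuhamel (ε t : ℝ) (F : ℝ → 𝓢'(R3, ℂ)) (w : 𝓢'(R3, ℂ)) : Prop :=
  ∀ φ : 𝓢(R3, ℂ),
    IntervalIntegrable (fun τ : ℝ ↦ heatSchrodinger ε (t - τ) (F τ) φ) volume 0 t ∧
      w φ = ∫ τ in (0 : ℝ)..t, heatSchrodinger ε (t - τ) (F τ) φ

/-- The vector-valued tempered distribution `g` is the distributional gradient of `w`. -/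
def IsGradient (g : 𝓢'(R3, EuclideanSpace ℂ (Fin 3))) (w : 𝓢'(R3, ℂ)) : Prop :=
  ∀ (φ : 𝓢(R3, ℂ)) (j : Fin 3),
    (g φ) j = (∂_{(EuclideanSpace.single j (1 : ℝ) : R3)} w : 𝓢'(R3, ℂ)) φ

/-- Lebesgue measure on the time interval `[0, T]`. -/
noncomputable abbrev timeMeasure (T : ℝ) : Measure ℝ := volume.restrict (Set.Icc 0 T)

/-! Put ω = ε + i. For t > 0 the propagator is convolution with the complex Gaussian `heatKernel (t
* ω)`. Two facts about it hold uniformly in ε. It contracts L², because composing it with its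
adjoint gives a real heat kernel, of mass one. And the composition of the flow for time s with the
adjoint flow for time t has a kernel bounded by |sω + tω̄|^(-3/2) ≤ |s - t|^(-3/2), since Im ω = 1.
A third fact depends on ε: the kernel and its gradient are dominated by real Gaussians, so they map
L^p to L^r with norm of order t^(-α), where α = (3/2)(1/p - 1/r), increased by 1/2 for the gradient.

The heart of the homogeneous estimate is the endpoint L²L⁶. Let A(t) be the L⁶ norm of the
evolution, restricted to a compact time window, and v(t) the evolution divided by A(t). Cut v(t) by
the size of its values into shells around 4^k, and let X_k(t) be the adjoint flow applied to A(t)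
4^(4k) times the k-th shell. The pairing of f with ∑ ∫ X_k is a sum of nonnegative terms and
dominates ∫ A². On the other hand, the energy bound and the dispersive bound make the vectors ∫ X_k
almost orthogonal, with gain 2^(-|k-l|) between scales (`enorm_inner_integral_integral_le_ratio`,
`exists_enorm_sum_integral_sq_le`), so that ‖∑ ∫ X_k‖² ≲ ∫ A². Hence ∫ A² ≲ (∫ A²)^(1/2) ‖f‖; as ∫
A² is finite on the window, it cancels. Interpolation with the L² contraction gives every admissible
pair.

For the retarded estimates, heat smoothing bounds the integrand by |t - τ|^(-α) ‖F(τ)‖. The scaling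
relations say precisely that 1/s + α = 1 + 1/q, and the strict upper bound on 1/p says that α < 1,
so the Hardy–Littlewood–Sobolev inequality in time applies (`HeatFamily.exists_eLpNorm_duhamel_le`).
The cases outside its range use duality or Minkowski: s = 1 follows from the homogeneous estimate by
Minkowski; q = ∞ is dual to the homogeneous estimate for the pair (s', p'), which is admissible
because s ≤ 2; and q = ∞ with a gradient is dual to the parabolic bound of ∇e^{tωΔ}φ in L²L². -/

/-! ### The complex heat kernel: Fourier transform, semigroup law, derivative -/

/-- The complex heat kernel `(4πz)^(-3/2) exp (-|x|² / (4z))`. -/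
noncomputable def heatKernel (z : ℂ) (x : R3) : ℂ :=
  (1 / (4 * Real.pi * z)) ^ (3 / 2 : ℂ) * Complex.exp (-(‖x‖ ^ 2 : ℝ) / (4 * z))

/-- The Gaussian `exp (-z |2πξ|² + 2πi ⟨x, ξ⟩)`. -/
noncomputable def modGauss (z : ℂ) (x ξ : R3) : ℂ :=
  Complex.exp (-(4 * Real.pi ^ 2 * z) * ‖ξ‖ ^ 2 + 2 * Real.pi * Complex.I * (inner ℝ x ξ : ℝ))

theorem re_four_pi_sq_mul {z : ℂ} (hz : 0 < z.re) : 0 < (4 * (Real.pi : ℂ) ^ 2 * z).re := by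
  have : (4 * (Real.pi : ℂ) ^ 2 * z).re = 4 * Real.pi ^ 2 * z.re := by
    rw [show (4 * (Real.pi : ℂ) ^ 2 * z) = ((4 * Real.pi ^ 2 : ℝ) : ℂ) * z by push_cast; ring,
      Complex.re_ofReal_mul]
  rw [this]; positivity

theorem fourier_modGauss {z : ℂ} (hz : 0 < z.re) (x w : R3) :
    FourierTransform.fourier (modGauss z x) w = heatKernel z (x - w) := by
  have hz0 : z ≠ 0 := by rintro rfl; simp at hz
  have hpi : (Real.pi : ℂ) ≠ 0 := by exact_mod_cast Real.pi_ne_zero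
  have := fourier_gaussian_innerProductSpace' (re_four_pi_sq_mul hz) x w
  unfold modGauss heatKernel
  rw [this]
  congr 1
  · congr 1
    · field_simp
    · simp
  · congr 1
    push_cast
    field_simp

theorem heatKernel_neg (z : ℂ) (x : R3) : heatKernel z (-x) = heatKernel z x := by
  simp [heatKernel]

theorem heatKernel_sub_comm (z : ℂ) (x y : R3) : heatKernel z (x - y) = heatKernel z (y - x) := by
  rw [← heatKernel_neg, neg_sub]

theorem re_inv_four_mul {z : ℂ} : (1 / (4 * z)).re = z.re / (4 * ‖z‖ ^ 2) := by
  rw [one_div, Complex.inv_re, Complex.normSq_mul, Complex.normSq_eq_norm_sq,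
    Complex.normSq_eq_norm_sq]
  simp only [Complex.mul_re, Complex.re_ofNat, Complex.im_ofNat, zero_mul, sub_zero,
    Complex.norm_ofNat]
  by_cases h : ‖z‖ = 0
  · simp [h]
  · field_simp

theorem re_inv_four_mul_pos {z : ℂ} (hz : 0 < z.re) : 0 < (1 / (4 * z)).re := by
  rw [re_inv_four_mul]
  have : z ≠ 0 := by rintro rfl; simp at hz
  positivity

theorem norm_heatKernel (z : ℂ) (x : R3) :
    ‖heatKernel z x‖ = ‖1 / (4 * Real.pi * z)‖ ^ (3 / 2 : ℝ) *
      Real.exp (-(1 / (4 * z)).re * ‖x‖ ^ 2) := by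
  rw [heatKernel, norm_mul, Complex.norm_exp]
  congr 1
  · rw [← Complex.norm_cpow_real]; norm_num
  · congr 1
    rw [show -((‖x‖ ^ 2 : ℝ) : ℂ) / (4 * z) = ((-‖x‖ ^ 2 : ℝ) : ℂ) * (1 / (4 * z)) by
      push_cast; ring, Complex.re_ofReal_mul]
    ring

theorem norm_heatKernel_le {z : ℂ} (hz : 0 < z.re) (x : R3) :
    ‖heatKernel z x‖ ≤ ‖z‖ ^ (-(3 / 2) : ℝ) * Real.exp (-(1 / (4 * z)).re * ‖x‖ ^ 2) := by
  have hz0 : 0 < ‖z‖ := norm_pos_iff.2 (by rintro rfl; simp at hz)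
  rw [norm_heatKernel]
  gcongr
  rw [Real.rpow_neg hz0.le, ← Real.inv_rpow hz0.le, norm_div, norm_mul]
  gcongr
  simp only [norm_one, norm_mul, Complex.norm_ofNat, Complex.norm_real, Real.norm_eq_abs,
    one_div]
  gcongr
  rw [abs_of_pos Real.pi_pos]
  nlinarith [Real.pi_gt_three]

theorem norm_heatKernel_le_rpow {z : ℂ} (hz : 0 < z.re) (x : R3) :
    ‖heatKernel z x‖ ≤ ‖z‖ ^ (-(3 / 2) : ℝ) := by
  refine (norm_heatKernel_le hz x).trans (mul_le_of_le_one_right (by positivity) ?_)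
  rw [Real.exp_le_one_iff]
  have := re_inv_four_mul_pos hz
  nlinarith [sq_nonneg ‖x‖, mul_nonneg this.le (sq_nonneg ‖x‖)]

theorem continuous_heatKernel (z : ℂ) : Continuous (heatKernel z) := by
  unfold heatKernel
  fun_prop

theorem integrable_exp_neg_mul_sq_norm {c : ℝ} (hc : 0 < c) :
    Integrable (fun x : R3 ↦ Real.exp (-c * ‖x‖ ^ 2)) := by
  have := GaussianFourier.integrable_cexp_neg_mul_sq_norm_add (V := R3) (b := (c : ℂ))
    (by simpa using hc) 0 0
  convert this.norm using 2 with x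
  rw [Complex.norm_exp]
  simp [← Complex.ofReal_pow]

theorem integrable_heatKernel {z : ℂ} (hz : 0 < z.re) : Integrable (heatKernel z) :=
  Integrable.mono' ((integrable_exp_neg_mul_sq_norm (re_inv_four_mul_pos hz)).const_mul _)
    (continuous_heatKernel z).aestronglyMeasurable (.of_forall fun x ↦ norm_heatKernel_le hz x)

theorem continuous_modGauss (z : ℂ) (x : R3) : Continuous (modGauss z x) := by
  unfold modGauss
  fun_prop

theorem integrable_modGauss {z : ℂ} (hz : 0 < z.re) (x : R3) : Integrable (modGauss z x) :=
  GaussianFourier.integrable_cexp_neg_mul_sq_norm_add (re_four_pi_sq_mul hz) _ _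

open FourierTransform in
-- Fourier inversion, legitimate because the modulated Gaussian is continuous and both it and its
-- transform are integrable.
theorem fourier_heatKernel_sub {z : ℂ} (hz : 0 < z.re) (y ξ : R3) :
    𝓕 (fun w ↦ heatKernel z (w - y)) ξ = modGauss z y (-ξ) := by
  have h : (fun w ↦ heatKernel z (w - y)) = 𝓕 (modGauss z y) := by
    ext w; rw [fourier_modGauss hz, heatKernel_sub_comm]
  have hi : Integrable (𝓕 (modGauss z y)) := by
    rw [← h]; exact (integrable_heatKernel hz).comp_sub_right y
  have := (continuous_modGauss z y).fourierInv_fourier_eq (integrable_modGauss hz y) hi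
  rw [h, ← this, Real.fourierInv_eq_fourier_neg, neg_neg, this]

open FourierTransform in
theorem integral_fourier_mul_eq_integral_mul_fourier {f g : R3 → ℂ} (hf : Integrable f)
    (hg : Integrable g) : ∫ w, 𝓕 f w * g w = ∫ ξ, f ξ * 𝓕 g ξ := by
  simpa using! (VectorFourier.integral_fourierIntegral_smul_eq_flip (L := innerₗ R3)
    Real.continuous_fourierChar continuous_inner hf hg)

theorem modGauss_mul (a b : ℂ) (x y ξ : R3) :
    modGauss a x ξ * modGauss b y (-ξ) = modGauss (a + b) (x - y) ξ := by
  unfold modGauss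
  rw [← Complex.exp_add, inner_sub_left, inner_neg_right, norm_neg]
  congr 1
  push_cast
  ring

/-- The semigroup law for the complex heat kernel. -/
theorem integral_heatKernel_mul_heatKernel {a b : ℂ} (ha : 0 < a.re) (hb : 0 < b.re) (x y : R3) :
    ∫ w, heatKernel a (x - w) * heatKernel b (w - y) = heatKernel (a + b) (x - y) := by
  have h1 : ∀ w, heatKernel a (x - w) = FourierTransform.fourier (modGauss a x) w :=
    fun w ↦ (fourier_modGauss ha x w).symm
  simp_rw [h1]
  rw [integral_fourier_mul_eq_integral_mul_fourier (integrable_modGauss ha x)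
    ((integrable_heatKernel hb).comp_sub_right y)]
  simp_rw [fourier_heatKernel_sub hb, modGauss_mul]
  have := fourier_modGauss (z := a + b) (by simp; positivity) (x - y) 0
  rw [sub_zero] at this
  rw [← this, Real.fourier_eq']
  simp

theorem integral_heatKernel {z : ℂ} (hz : 0 < z.re) : ∫ x, heatKernel z x = 1 := by
  have := fourier_heatKernel_sub hz 0 0
  rw [Real.fourier_eq'] at this
  simpa [modGauss] using this

theorem conj_heatKernel {z : ℂ} (hz : 0 < z.re) (x : R3) :
    star (heatKernel z x) = heatKernel (star z) x := by
  have hz0 : z ≠ 0 := by rintro rfl; simp at hz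
  have h4 : (starRingEnd ℂ) 4 = 4 := map_ofNat _ 4
  unfold heatKernel
  rw [star_mul', Complex.star_def, ← Complex.exp_conj]
  congr 1
  · have h3 : 1 / (4 * (Real.pi : ℂ) * (starRingEnd ℂ) z) =
        (starRingEnd ℂ) (1 / (4 * Real.pi * z)) := by simp [h4]
    rw [h3, Complex.conj_cpow]
    · congr 2
      rw [map_div₀, map_ofNat, map_ofNat]
    -- The base of the complex power lies in the right half-plane, hence off the branch cut, and the
    -- power commutes with conjugation.
    · have : 0 < (1 / (4 * Real.pi * z)).re := by
        rw [show 1 / (4 * Real.pi * z) = ((Real.pi⁻¹ : ℝ) : ℂ) * (1 / (4 * z)) by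
          push_cast; field_simp, Complex.re_ofReal_mul]
        have := re_inv_four_mul_pos hz
        positivity
      intro h
      rw [Complex.arg_eq_pi_iff] at h
      linarith [h.1]
  · simp [h4]

/-- At real times the kernel is positive, so its L¹ norm is its integral. The absolute integral of
the complex kernel is not one in general; the L² contraction is therefore reduced to real times. -/
theorem integral_norm_heatKernel_ofReal {c : ℝ} (hc : 0 < c) :
    ∫ x, ‖heatKernel (c : ℂ) x‖ = 1 := by
  have h0 : ∀ x, heatKernel (c : ℂ) x = (‖heatKernel (c : ℂ) x‖ : ℂ) := by
    intro x
    have : heatKernel (c : ℂ) x = (((1 / (4 * Real.pi * c)) ^ (3 / 2 : ℝ) *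
        Real.exp (-(‖x‖ ^ 2) / (4 * c)) : ℝ) : ℂ) := by
      rw [heatKernel, Complex.ofReal_mul, Complex.ofReal_cpow (by positivity)]
      push_cast; rfl
    rw [this, Complex.norm_real, Real.norm_of_nonneg (by positivity)]
  have := integral_heatKernel (z := (c : ℂ)) (by simpa using hc)
  rw [integral_congr_ae (.of_forall h0), integral_complex_ofReal] at this
  exact_mod_cast this

/-- The derivative of the complex heat kernel in the `j`-th coordinate direction. -/
noncomputable def heatKernelDeriv (j : Fin 3) (z : ℂ) (x : R3) : ℂ :=
  -((x j : ℝ) : ℂ) / (2 * z) * heatKernel z x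

theorem hasLineDerivAt_heatKernel (j : Fin 3) {z : ℂ} (x : R3) :
    HasLineDerivAt ℝ (heatKernel z) (heatKernelDeriv j z x) x (EuclideanSpace.single j (1 : ℝ)) := by
  unfold HasLineDerivAt heatKernelDeriv heatKernel
  have h1 : HasDerivAt (fun t : ℝ ↦ ‖x + t • (EuclideanSpace.single j (1 : ℝ) : R3)‖ ^ 2)
      (2 * x j) 0 := by
    have : ∀ t : ℝ, ‖x + t • (EuclideanSpace.single j (1 : ℝ) : R3)‖ ^ 2 =
        ‖x‖ ^ 2 + 2 * (t * x j) + t ^ 2 := by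
      intro t
      rw [norm_add_sq_real, norm_smul, real_inner_smul_right]
      simp [EuclideanSpace.inner_single_right]
    simp_rw [this]
    have := ((((hasDerivAt_id (0 : ℝ)).mul_const (x j)).const_mul 2).const_add (‖x‖ ^ 2)).add
      (hasDerivAt_pow 2 (0 : ℝ))
    exact this.congr_deriv (by simp)
  have h2 := ((((h1.ofReal_comp.neg).div_const (4 * z)).cexp).const_mul
    ((1 / (4 * Real.pi * z)) ^ (3 / 2 : ℂ)))
  refine h2.congr_deriv ?_
  simp only [Pi.neg_apply, zero_smul, add_zero, Complex.ofReal_mul, Complex.ofReal_ofNat]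
  by_cases hz : z = 0
  · simp [hz]
  · field_simp
    ring

theorem continuous_heatKernelDeriv (j : Fin 3) (z : ℂ) : Continuous (heatKernelDeriv j z) := by
  unfold heatKernelDeriv
  have := continuous_heatKernel z
  fun_prop

open Function in
-- The symbol factors through |ξ|². The outer exponential has bounded derivatives only on the
-- half-line τ ≥ 0, so the composition rule is used relative to that set.
theorem hasTemperateGrowth_cexp_neg_mul_sq {z : ℂ} (hz : 0 ≤ z.re) :
    HasTemperateGrowth (fun ξ : R3 ↦ Complex.exp (-z * (‖ξ‖ ^ 2 : ℝ))) := by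
  have hsm : ContDiff ℝ ⊤ (fun τ : ℝ ↦ Complex.exp (-z * (τ : ℂ))) := by
    have : ContDiff ℝ ⊤ (fun τ : ℝ ↦ (τ : ℂ)) := Complex.ofRealCLM.contDiff
    fun_prop
  refine HasTemperateGrowth.comp' (g := fun τ : ℝ ↦ Complex.exp (-z * (τ : ℂ)))
    (f := fun ξ : R3 ↦ ‖ξ‖ ^ 2) (t := Set.Ici 0) ?_ (uniqueDiffOn_Ici 0)
    (hsm.of_le le_top).contDiffOn ?_ (hasTemperateGrowth_norm_sq R3)
  · rintro _ ⟨x, rfl⟩; exact sq_nonneg ‖x‖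
  · intro N
    refine ⟨0, (1 + ‖z‖) ^ N, by positivity, fun n hn τ hτ ↦ ?_⟩
    rw [iteratedFDerivWithin_eq_iteratedFDeriv (uniqueDiffOn_Ici 0)
      ((hsm.of_le le_top).contDiffAt) hτ, norm_iteratedFDeriv_eq_norm_iteratedDeriv]
    have : ∀ n : ℕ, iteratedDeriv n (fun τ : ℝ ↦ Complex.exp (-z * (τ : ℂ))) =
        fun τ : ℝ ↦ (-z) ^ n * Complex.exp (-z * (τ : ℂ)) := by
      intro n
      induction n with
      | zero => simp
      | succ n ih =>
        rw [iteratedDeriv_succ, ih]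
        ext τ
        have h1 : HasDerivAt (fun τ : ℝ ↦ -z * (τ : ℂ)) (-z) τ := by
          simpa using (Complex.ofRealCLM.hasDerivAt (x := τ)).const_mul (-z)
        rw [((h1.cexp).const_mul ((-z) ^ n)).deriv]
        ring
    rw [this, norm_mul, norm_pow, norm_neg, Complex.norm_exp]
    have h2 : Real.exp (-z * (τ : ℂ)).re ≤ 1 := by
      rw [Real.exp_le_one_iff]
      simp only [Complex.mul_re, Complex.neg_re, Complex.ofReal_re, Complex.neg_im,
        Complex.ofReal_im, mul_zero, sub_zero]
      have : 0 ≤ τ := hτ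
      nlinarith [mul_nonneg hz this]
    calc ‖z‖ ^ n * Real.exp (-z * (τ : ℂ)).re ≤ ‖z‖ ^ n * 1 := by gcongr
      _ ≤ (1 + ‖z‖) ^ n * 1 := by gcongr; linarith
      _ ≤ (1 + ‖z‖) ^ N * 1 := by gcongr; linarith [norm_nonneg z]
      _ = _ := by simp

/-! ### Convolution operators from L^p to L^r and Young's inequality -/

/-- Continuous, integrable and bounded convolution kernels. -/
structure GoodKernel (k : R3 → ℂ) : Prop where
  cont : Continuous k
  integrable : Integrable k
  bdd : ∃ B : ℝ≥0, ∀ x, ‖k x‖ₑ ≤ B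

/-- The convolution of `k` and `f`. -/
noncomputable def convFun (k f : R3 → ℂ) (x : R3) : ℂ := ∫ y, f y * k (x - y)

/-- The convolution of `|k|` and `|f|`. -/
noncomputable def absConv (k f : R3 → ℂ) (x : R3) : ℝ≥0∞ := ∫⁻ y, ‖f y‖ₑ * ‖k (x - y)‖ₑ

theorem enorm_convFun_le (k f : R3 → ℂ) (x : R3) : ‖convFun k f x‖ₑ ≤ absConv k f x := by
  refine (enorm_integral_le_lintegral_enorm _).trans (le_of_eq ?_)
  simp [absConv, enorm_mul]

section Young

variable {k f : R3 → ℂ}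

theorem measurable_conv_integrand (hk : Continuous k) (hf : Measurable f) :
    Measurable (fun z : R3 × R3 ↦ f z.2 * k (z.1 - z.2)) := by
  have := hk.measurable
  fun_prop

theorem measurable_absConv (hk : Continuous k) (hf : Measurable f) : Measurable (absConv k f) := by
  have := (measurable_conv_integrand hk hf).enorm
  simp only [enorm_mul] at this
  exact this.lintegral_prod_right'

theorem stronglyMeasurable_convFun (hk : Continuous k) (hf : Measurable f) :
    StronglyMeasurable (convFun k f) :=
  (measurable_conv_integrand hk hf).stronglyMeasurable.integral_prod_right'

/-- Hölder for the weight |k(x - y)| dy, with the kernel distributed as |k| = |k|^(1 - 1/p)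
|k|^(1/p). -/
theorem absConv_rpow_le (hk : Continuous k) (hf : Measurable f) {p : ℝ} (hp : 1 ≤ p) (x : R3) :
    absConv k f x ^ p ≤ (∫⁻ y, ‖k y‖ₑ) ^ (p - 1) * ∫⁻ y, ‖k (x - y)‖ₑ * ‖f y‖ₑ ^ p := by
  have hp0 : 0 < p := by linarith
  have hkm := hk.measurable
  have h := ENNReal.lintegral_mul_norm_pow_le (μ := (volume : Measure R3))
    (f := fun y ↦ ‖k (x - y)‖ₑ) (g := fun y ↦ ‖k (x - y)‖ₑ * ‖f y‖ₑ ^ p)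
    (p := 1 - 1 / p) (q := 1 / p) (by fun_prop) (by fun_prop)
    (by rw [sub_nonneg, div_le_one hp0]; exact hp) (by positivity) (by ring)
  have h1 : absConv k f x =
      ∫⁻ y, ‖k (x - y)‖ₑ ^ (1 - 1 / p) * (‖k (x - y)‖ₑ * ‖f y‖ₑ ^ p) ^ (1 / p) := by
    refine lintegral_congr fun y ↦ ?_
    rw [ENNReal.mul_rpow_of_nonneg _ _ (by positivity), ← mul_assoc,
      ← ENNReal.rpow_add_of_nonneg _ _ (by rw [sub_nonneg, div_le_one hp0]; exact hp)
        (by positivity), ← ENNReal.rpow_mul, mul_one_div_cancel hp0.ne']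
    simp [mul_comm]
  rw [← h1, lintegral_sub_left_eq_self (fun y ↦ ‖k y‖ₑ) x] at h
  refine (ENNReal.rpow_le_rpow h hp0.le).trans (le_of_eq ?_)
  rw [ENNReal.mul_rpow_of_nonneg _ _ hp0.le, ← ENNReal.rpow_mul, ← ENNReal.rpow_mul,
    one_div_mul_cancel hp0.ne', ENNReal.rpow_one]
  congr 2
  field_simp

theorem absConv_rpow_le_bdd (hk : Continuous k) (hf : Measurable f) {p : ℝ} (hp : 1 ≤ p)
    {B : ℝ≥0∞} (hB : ∀ x, ‖k x‖ₑ ≤ B) (x : R3) :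
    absConv k f x ^ p ≤ (∫⁻ y, ‖k y‖ₑ) ^ (p - 1) * (B * ∫⁻ y, ‖f y‖ₑ ^ p) := by
  refine (absConv_rpow_le hk hf hp x).trans ?_
  gcongr
  rw [← lintegral_const_mul _ (by fun_prop)]
  gcongr
  exact hB _

theorem lintegral_absConv_rpow_le (hk : Continuous k) (hf : Measurable f) {p : ℝ} (hp : 1 ≤ p) :
    ∫⁻ x, absConv k f x ^ p ≤ (∫⁻ y, ‖k y‖ₑ) ^ p * ∫⁻ y, ‖f y‖ₑ ^ p := by
  have hkm := hk.measurable
  refine (lintegral_mono fun x ↦ absConv_rpow_le hk hf hp x).trans ?_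
  rw [lintegral_const_mul, lintegral_lintegral_swap (by fun_prop)]
  · have : ∀ y, ∫⁻ x, ‖k (x - y)‖ₑ * ‖f y‖ₑ ^ p = (∫⁻ x, ‖k x‖ₑ) * ‖f y‖ₑ ^ p := fun y ↦ by
      rw [lintegral_mul_const _ (by fun_prop), lintegral_sub_right_eq_self (fun x ↦ ‖k x‖ₑ) y]
    simp_rw [this]
    rw [lintegral_const_mul _ (by fun_prop), ← mul_assoc]
    gcongr
    conv_lhs => rw [← ENNReal.rpow_one (∫⁻ y, ‖k y‖ₑ), ← ENNReal.rpow_mul]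
    rw [← ENNReal.rpow_add_of_nonneg _ _ (by linarith) (by norm_num)]
    simp
  · exact Measurable.lintegral_prod_right' (f := fun z : R3 × R3 ↦
      ‖k (z.1 - z.2)‖ₑ * ‖f z.2‖ₑ ^ p) (by fun_prop)

/-- Young's inequality for bounded integrable kernels. -/
theorem lintegral_absConv_rpow_le' (hk : Continuous k) (hf : Measurable f) {p r : ℝ} (hp : 1 ≤ p)
    (hpr : p ≤ r) {B : ℝ≥0∞} (hB : ∀ x, ‖k x‖ₑ ≤ B) :
    (∫⁻ x, absConv k f x ^ r) ^ (1 / r) ≤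
      (∫⁻ y, ‖k y‖ₑ) ^ (1 - (1 / p - 1 / r)) * B ^ (1 / p - 1 / r) *
        (∫⁻ y, ‖f y‖ₑ ^ p) ^ (1 / p) := by
  have hp0 : 0 < p := by linarith
  have hr0 : 0 < r := by linarith
  set A := ∫⁻ y, ‖k y‖ₑ
  set N := ∫⁻ y, ‖f y‖ₑ ^ p
  have hδ : 0 ≤ 1 / p - 1 / r := by
    rw [sub_nonneg]; exact one_div_le_one_div_of_le hp0 hpr
  have hrp : 0 ≤ (r - p) / p := div_nonneg (by linarith) hp0.le
  -- Write the r-th power as the p-th power times (absConv^p)^((r-p)/p); the extra factor is bounded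
  -- uniformly in x, and the remaining p-th power is integrated.
  have h1 : ∫⁻ x, absConv k f x ^ r ≤ (A ^ (p - 1) * (B * N)) ^ ((r - p) / p) * (A ^ p * N) := by
    have hm := measurable_absConv hk hf
    calc ∫⁻ x, absConv k f x ^ r
        = ∫⁻ x, (absConv k f x ^ p) ^ ((r - p) / p) * absConv k f x ^ p := by
          refine lintegral_congr fun x ↦ ?_
          rw [← ENNReal.rpow_mul, ← ENNReal.rpow_add_of_nonneg _ _ (by positivity) hp0.le]
          congr 1
          field_simp; ring
      _ ≤ ∫⁻ x, (A ^ (p - 1) * (B * N)) ^ ((r - p) / p) * absConv k f x ^ p := by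
          gcongr with x
          exact absConv_rpow_le_bdd hk hf hp hB x
      _ ≤ _ := by
          rw [lintegral_const_mul _ (by fun_prop)]
          gcongr
          exact lintegral_absConv_rpow_le hk hf hp
  refine (ENNReal.rpow_le_rpow h1 (by positivity : 0 ≤ 1 / r)).trans (le_of_eq ?_)
  have hr1 : 0 ≤ 1 / r := by positivity
  have e1 : 0 ≤ (p - 1) * ((r - p) / p) * (1 / r) := by
    have : 0 ≤ p - 1 := by linarith
    positivity
  simp only [ENNReal.mul_rpow_of_nonneg _ _ hrp, ENNReal.mul_rpow_of_nonneg _ _ hr1,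
    ← ENNReal.rpow_mul]
  rw [show A ^ ((p - 1) * ((r - p) / p) * (1 / r)) * (B ^ ((r - p) / p * (1 / r)) *
    N ^ ((r - p) / p * (1 / r))) * (A ^ (p * (1 / r)) * N ^ (1 / r)) =
    (A ^ ((p - 1) * ((r - p) / p) * (1 / r)) * A ^ (p * (1 / r))) * B ^ ((r - p) / p * (1 / r)) *
    (N ^ ((r - p) / p * (1 / r)) * N ^ (1 / r)) by ring,
    ← ENNReal.rpow_add_of_nonneg _ _ e1 (by positivity),
    ← ENNReal.rpow_add_of_nonneg _ _ (by positivity) (by positivity)]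
  congr 3
  · field_simp; ring
  · field_simp
  · field_simp; ring

end Young

theorem lintegral_enorm_rpow_eq {p : ℝ≥0∞} (hp1 : 1 ≤ p) (hp : p ≠ ∞) (f : R3 → ℂ) :
    (∫⁻ y, ‖f y‖ₑ ^ p.toReal) ^ (1 / p.toReal) = eLpNorm f p volume := by
  rw [eLpNorm_eq_lintegral_rpow_enorm_toReal (by rintro rfl; simp at hp1) hp]

/-- The exponent `1 / p - 1 / r`. -/
noncomputable def expGap (p r : ℝ≥0∞) : ℝ := 1 / p.toReal - 1 / r.toReal

section ConvOp

variable {k f : R3 → ℂ} {p r : ℝ≥0∞}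

theorem one_le_toReal (hp : 1 ≤ p) (hp' : p ≠ ∞) : 1 ≤ p.toReal := by
  have := ENNReal.toReal_mono hp' hp
  simpa using this

theorem eLpNorm_convFun_le (hk : Continuous k) (hf : Measurable f) (hp : 1 ≤ p) (hpr : p ≤ r)
    (hr : r ≠ ∞) {B : ℝ≥0∞} (hB : ∀ x, ‖k x‖ₑ ≤ B) :
    eLpNorm (convFun k f) r volume ≤
      (∫⁻ y, ‖k y‖ₑ) ^ (1 - expGap p r) * B ^ expGap p r * eLpNorm f p volume := by
  have hp' : p ≠ ∞ := ne_top_of_le_ne_top hr hpr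
  rw [← lintegral_enorm_rpow_eq (hp.trans hpr) hr, ← lintegral_enorm_rpow_eq hp hp']
  refine le_trans ?_ (lintegral_absConv_rpow_le' hk hf (one_le_toReal hp hp')
    (ENNReal.toReal_mono hr hpr) hB)
  gcongr with x
  exact enorm_convFun_le k f x

theorem expGap_nonneg (hp : 1 ≤ p) (hpr : p ≤ r) (hr : r ≠ ∞) : 0 ≤ expGap p r := by
  have hp' : p ≠ ∞ := ne_top_of_le_ne_top hr hpr
  have := one_le_toReal hp hp'
  rw [expGap, sub_nonneg]
  exact one_div_le_one_div_of_le (by linarith) (ENNReal.toReal_mono hr hpr)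

theorem expGap_lt_one (hp : 1 ≤ p) (hpr : p ≤ r) (hr : r ≠ ∞) : expGap p r < 1 := by
  have hp' : p ≠ ∞ := ne_top_of_le_ne_top hr hpr
  have h1 := one_le_toReal hp hp'
  have h2 := one_le_toReal (hp.trans hpr) hr
  have h3 : 1 / p.toReal ≤ 1 := by rw [div_le_one (by linarith)]; exact h1
  have h4 : 0 < 1 / r.toReal := by positivity
  rw [expGap]; linarith

theorem GoodKernel.const_lt_top (hk : GoodKernel k) (hp : 1 ≤ p) (hpr : p ≤ r) (hr : r ≠ ∞)
    (B : ℝ≥0) : (∫⁻ y, ‖k y‖ₑ) ^ (1 - expGap p r) * (B : ℝ≥0∞) ^ expGap p r < ∞ :=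
  ENNReal.mul_lt_top
    (ENNReal.rpow_lt_top_of_nonneg (by linarith [expGap_lt_one hp hpr hr])
      hk.integrable.hasFiniteIntegral.ne)
    (ENNReal.rpow_lt_top_of_nonneg (expGap_nonneg hp hpr hr) ENNReal.coe_ne_top)

theorem GoodKernel.memLp_convFun (hk : GoodKernel k) (hf : Measurable f) (hp : 1 ≤ p)
    (hpr : p ≤ r) (hr : r ≠ ∞) (hfp : MemLp f p volume) : MemLp (convFun k f) r volume := by
  obtain ⟨B, hB⟩ := hk.bdd
  refine ⟨(stronglyMeasurable_convFun hk.cont hf).aestronglyMeasurable, ?_⟩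
  exact (eLpNorm_convFun_le hk.cont hf hp hpr hr hB).trans_lt
    (ENNReal.mul_lt_top (hk.const_lt_top hp hpr hr B) hfp.2)

/-- Finiteness holds at every point and not only almost everywhere, so convolution is pointwise
linear in the function and in the kernel, and Fubini is available against any integrable weight. -/
theorem GoodKernel.absConv_lt_top (hk : GoodKernel k) (hf : Measurable f) (hp : 1 ≤ p)
    (hp' : p ≠ ∞) (hfp : MemLp f p volume) : ∃ M : ℝ≥0, ∀ x, absConv k f x ≤ M := by
  obtain ⟨B, hB⟩ := hk.bdd
  have h1 := one_le_toReal hp hp'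
  have hp0 : 0 < p.toReal := by linarith
  have hN : ∫⁻ y, ‖f y‖ₑ ^ p.toReal < ∞ :=
    lintegral_rpow_enorm_lt_top_of_eLpNorm_lt_top (by rintro rfl; simp at hp) hp' hfp.2
  set M := ((∫⁻ y, ‖k y‖ₑ) ^ (p.toReal - 1) * (B * ∫⁻ y, ‖f y‖ₑ ^ p.toReal)) ^ (1 / p.toReal)
    with hM
  have hMt : M < ∞ := by
    refine ENNReal.rpow_lt_top_of_nonneg (by positivity) (ENNReal.mul_lt_top ?_
      (ENNReal.mul_lt_top ENNReal.coe_lt_top hN)).ne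
    exact ENNReal.rpow_lt_top_of_nonneg (by linarith) hk.integrable.hasFiniteIntegral.ne
  refine ⟨M.toNNReal, fun x ↦ ?_⟩
  rw [ENNReal.coe_toNNReal hMt.ne, hM, one_div, ENNReal.le_rpow_inv_iff hp0]
  exact absConv_rpow_le_bdd hk.cont hf h1 hB x

theorem GoodKernel.integrable_conv (hk : GoodKernel k) (hf : Measurable f) (hp : 1 ≤ p)
    (hp' : p ≠ ∞) (hfp : MemLp f p volume) (x : R3) :
    Integrable (fun y ↦ f y * k (x - y)) := by
  obtain ⟨M, hM⟩ := hk.absConv_lt_top hf hp hp' hfp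
  have hkm := hk.cont.measurable
  refine ⟨by fun_prop, ?_⟩
  simp only [HasFiniteIntegral, enorm_mul]
  exact (hM x).trans_lt ENNReal.coe_lt_top

theorem convFun_congr_ae {f g : R3 → ℂ} (h : f =ᵐ[volume] g) : convFun k f = convFun k g := by
  ext x
  refine integral_congr_ae ?_
  filter_upwards [h] with y hy
  rw [hy]

open Classical in
/-- Convolution with `k` as an operator from `L^p` to `L^r`. -/
noncomputable def convOp (p r : ℝ≥0∞) [Fact (1 ≤ p)] [Fact (1 ≤ r)] (k : R3 → ℂ) :
    Lp ℂ p (volume : Measure R3) →L[ℂ] Lp ℂ r (volume : Measure R3) :=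
  -- The zero default keeps the operator total in the kernel and the exponents, which lets whole
  -- time families be treated at once.
  if h : GoodKernel k ∧ p ≤ r ∧ r ≠ ∞ then
    LinearMap.mkContinuous
      { toFun := fun f ↦ (h.1.memLp_convFun (Lp.stronglyMeasurable f).measurable Fact.out h.2.1 h.2.2
          (Lp.memLp f)).toLp _
        map_add' := fun f g ↦ by
          rw [← MemLp.toLp_add]
          refine MemLp.toLp_congr _ _ (.of_forall fun x ↦ ?_)
          rw [convFun_congr_ae (Lp.coeFn_add f g)]
          simp only [convFun, Pi.add_apply, add_mul]
          have hp' : p ≠ ∞ := ne_top_of_le_ne_top h.2.2 h.2.1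
          exact integral_add
            (h.1.integrable_conv (Lp.stronglyMeasurable f).measurable Fact.out hp' (Lp.memLp f) x)
            (h.1.integrable_conv (Lp.stronglyMeasurable g).measurable Fact.out hp' (Lp.memLp g) x)
        map_smul' := fun c f ↦ by
          rw [RingHom.id_apply, ← MemLp.toLp_const_smul]
          refine MemLp.toLp_congr _ _ (.of_forall fun x ↦ ?_)
          rw [convFun_congr_ae (Lp.coeFn_smul c f)]
          simp only [convFun, Pi.smul_apply, smul_eq_mul, mul_assoc]
          exact integral_const_mul _ _ }
      ((∫⁻ y, ‖k y‖ₑ) ^ (1 - expGap p r) * (h.1.bdd.choose : ℝ≥0∞) ^ expGap p r).toReal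
      (fun f ↦ by
        have h1 := eLpNorm_convFun_le h.1.cont (Lp.stronglyMeasurable f).measurable Fact.out h.2.1
          h.2.2 h.1.bdd.choose_spec
        have h2 := h.1.const_lt_top Fact.out h.2.1 h.2.2 h.1.bdd.choose
        simp only [LinearMap.coe_mk, AddHom.coe_mk, Lp.norm_toLp]
        rw [Lp.norm_def, ← ENNReal.toReal_mul]
        exact ENNReal.toReal_mono (ENNReal.mul_lt_top h2 (Lp.eLpNorm_lt_top f)).ne h1)
  else 0

variable [Fact (1 ≤ p)] [Fact (1 ≤ r)]

theorem GoodKernel.coeFn_convOp (hk : GoodKernel k) (hpr : p ≤ r) (hr : r ≠ ∞)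
    (f : Lp ℂ p (volume : Measure R3)) : convOp p r k f =ᵐ[volume] convFun k f := by
  rw [convOp, dif_pos ⟨hk, hpr, hr⟩]
  exact MemLp.coeFn_toLp (hk.memLp_convFun (Lp.stronglyMeasurable f).measurable Fact.out hpr hr
    (Lp.memLp f))

/-- The operator was built with an arbitrarily chosen sup bound. Here any bound B is allowed, which
is needed to follow the dependence on time. -/
theorem GoodKernel.enorm_convOp_le (hk : GoodKernel k) (hpr : p ≤ r) (hr : r ≠ ∞)
    (f : Lp ℂ p (volume : Measure R3)) {B : ℝ≥0∞} (hB : ∀ x, ‖k x‖ₑ ≤ B) :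
    ‖convOp p r k f‖ₑ ≤ (∫⁻ y, ‖k y‖ₑ) ^ (1 - expGap p r) * B ^ expGap p r * ‖f‖ₑ := by
  rw [Lp.enorm_def, Lp.enorm_def, eLpNorm_congr_ae (hk.coeFn_convOp hpr hr f)]
  exact eLpNorm_convFun_le hk.cont (Lp.stronglyMeasurable f).measurable Fact.out hpr hr hB

theorem GoodKernel.sub {k' : R3 → ℂ} (hk : GoodKernel k) (hk' : GoodKernel k') :
    GoodKernel (k - k') := by
  obtain ⟨B, hB⟩ := hk.bdd
  obtain ⟨B', hB'⟩ := hk'.bdd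
  refine ⟨hk.cont.sub hk'.cont, hk.integrable.sub hk'.integrable, B + B', fun x ↦ ?_⟩
  push_cast
  exact enorm_sub_le.trans (add_le_add (hB x) (hB' x))

/-- Reduces norm continuity of the operators in time to smallness of the difference of two kernels.
-/
theorem GoodKernel.convOp_sub {k' : R3 → ℂ} (hk : GoodKernel k) (hk' : GoodKernel k')
    (hpr : p ≤ r) (hr : r ≠ ∞) : convOp p r (k - k') = convOp p r k - convOp p r k' := by
  ext1 f
  apply Lp.ext
  rw [sub_apply]
  filter_upwards [(hk.sub hk').coeFn_convOp hpr hr f, hk.coeFn_convOp hpr hr f,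
    hk'.coeFn_convOp hpr hr f, Lp.coeFn_sub (convOp p r k f) (convOp p r k' f)] with x h1 h2 h3 h4
  rw [h4, Pi.sub_apply, h1, h2, h3]
  simp only [convFun, Pi.sub_apply, mul_sub]
  have hp' : p ≠ ∞ := ne_top_of_le_ne_top hr hpr
  exact integral_sub
    (hk.integrable_conv (Lp.stronglyMeasurable f).measurable Fact.out hp' (Lp.memLp f) x)
    (hk'.integrable_conv (Lp.stronglyMeasurable f).measurable Fact.out hp' (Lp.memLp f) x)

end ConvOp

/-! ### Convolutions as tempered distributions and as Fourier multipliers -/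

/-- Fubini for the pairing of a function with a convolution. -/
theorem integral_mul_convFun {k f φ : R3 → ℂ} (hk : Continuous k) (hf : Measurable f)
    (hφ : Measurable φ) (h : ∫⁻ x, ‖φ x‖ₑ * absConv k f x ≠ ∞) :
    ∫ x, φ x * convFun k f x = ∫ y, f y * ∫ x, φ x * k (x - y) := by
  have hkm := hk.measurable
  have hi : Integrable (Function.uncurry fun x y : R3 ↦ φ x * (f y * k (x - y)))
      (volume.prod volume) := by
    refine ⟨by unfold Function.uncurry; fun_prop, ?_⟩
    rw [hasFiniteIntegral_def, lintegral_prod _ (by unfold Function.uncurry; fun_prop)]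
    refine lt_of_le_of_lt (le_of_eq ?_) h.lt_top
    refine lintegral_congr fun x ↦ ?_
    simp only [Function.uncurry, enorm_mul]
    rw [lintegral_const_mul _ (by fun_prop)]
    rfl
  calc ∫ x, φ x * convFun k f x = ∫ x, ∫ y, φ x * (f y * k (x - y)) := by
        simp only [convFun, integral_const_mul]
    _ = ∫ y, ∫ x, φ x * (f y * k (x - y)) := integral_integral_swap hi
    _ = _ := by
        congr with y
        rw [← integral_const_mul]
        congr with x
        ring

theorem goodKernel_heatKernel {z : ℂ} (hz : 0 < z.re) : GoodKernel (heatKernel z) :=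
  ⟨continuous_heatKernel z, integrable_heatKernel hz, (‖z‖ ^ (-(3 / 2) : ℝ)).toNNReal, fun x ↦ by
    rw [← ofReal_norm]
    exact ENNReal.ofReal_le_ofReal (norm_heatKernel_le_rpow hz x)⟩

section Distribution

variable {p r : ℝ≥0∞} [Fact (1 ≤ p)] [Fact (1 ≤ r)] {k : R3 → ℂ}

theorem SchwartzMap.lintegral_enorm_lt_top (φ : 𝓢(R3, ℂ)) : ∫⁻ x, ‖φ x‖ₑ < ∞ :=
  (φ.integrable (μ := volume)).hasFiniteIntegral

/-- The distribution pairing of a convolution. -/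
theorem GoodKernel.convOp_toTemperedDistribution (hk : GoodKernel k) (hpr : p ≤ r) (hr : r ≠ ∞)
    (f : Lp ℂ p (volume : Measure R3)) (φ : 𝓢(R3, ℂ)) :
    ((convOp p r k f : Lp ℂ r (volume : Measure R3)) : 𝓢'(R3, ℂ)) φ =
      ∫ y, f y * ∫ x, φ x * k (x - y) := by
  rw [Lp.toTemperedDistribution_apply]
  have hfm := (Lp.stronglyMeasurable f).measurable
  rw [← integral_mul_convFun hk.cont hfm φ.continuous.measurable]
  · refine integral_congr_ae ?_
    filter_upwards [hk.coeFn_convOp hpr hr f] with x hx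
    rw [hx, smul_eq_mul]
  · obtain ⟨M, hM⟩ := hk.absConv_lt_top hfm Fact.out (ne_top_of_le_ne_top hr hpr) (Lp.memLp f)
    refine ne_top_of_le_ne_top ?_ (lintegral_mono fun x ↦ mul_le_mul_right (hM x) ‖φ x‖ₑ)
    rw [lintegral_mul_const _ (φ.continuous.measurable.enorm)]
    exact ENNReal.mul_ne_top φ.lintegral_enorm_lt_top.ne ENNReal.coe_ne_top

open FourierTransform in
/-- The complex Gaussian Fourier multiplier is convolution with the heat kernel. -/
theorem fourier_smulLeft_fourierInv {z : ℂ} (hz : 0 < z.re) (φ : 𝓢(R3, ℂ)) (y : R3) :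
    𝓕 (SchwartzMap.smulLeftCLM ℂ (fun ξ : R3 ↦ modGauss z 0 ξ) (𝓕⁻ φ)) y =
      ∫ x, φ x * heatKernel z (x - y) := by
  have htg : Function.HasTemperateGrowth (fun ξ : R3 ↦ modGauss z 0 ξ) := by
    have := hasTemperateGrowth_cexp_neg_mul_sq (re_four_pi_sq_mul hz).le
    convert this using 2 with ξ
    simp [modGauss]
  rw [SchwartzMap.fourier_coe, Real.fourier_eq']
  have h1 : ∀ ξ, Complex.exp (((-2 * Real.pi * inner ℝ ξ y : ℝ) : ℂ) * Complex.I) •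
      (SchwartzMap.smulLeftCLM ℂ (fun ξ : R3 ↦ modGauss z 0 ξ) (𝓕⁻ φ)) ξ =
      modGauss z y (-ξ) * 𝓕 φ (-ξ) := by
    intro ξ
    rw [SchwartzMap.smulLeftCLM_apply_apply htg, SchwartzMap.fourierInv_coe, SchwartzMap.fourier_coe,
      Real.fourierInv_eq_fourier_neg, smul_eq_mul, smul_eq_mul, ← mul_assoc]
    congr 1
    unfold modGauss
    rw [← Complex.exp_add, inner_neg_right, norm_neg, real_inner_comm]
    congr 1
    push_cast
    simp
    ring
  simp_rw [h1]
  -- Reflecting ξ undoes the sign that came from the inverse transform. The multiplication formula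
  -- then moves the remaining transform from φ to the Gaussian, where it produces the kernel.
  rw [integral_neg_eq_self (fun ξ ↦ modGauss z y ξ * 𝓕 φ ξ), SchwartzMap.fourier_coe,
    ← integral_fourier_mul_eq_integral_mul_fourier (integrable_modGauss hz y) φ.integrable]
  congr with x
  rw [fourier_modGauss hz, heatKernel_sub_comm, mul_comm]

/-- For positive times the heat-Schrödinger propagator is convolution with the heat kernel. -/
theorem convOp_heatKernel_eq_heatSchrodinger {ε t : ℝ} (hε : 0 < ε) (ht : 0 < t) (hpr : p ≤ r)
    (hr : r ≠ ∞) (f : Lp ℂ p (volume : Measure R3)) :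
    ((convOp p r (heatKernel (t * (ε + Complex.I))) f : Lp ℂ r (volume : Measure R3)) :
      𝓢'(R3, ℂ)) = heatSchrodinger ε t (f : 𝓢'(R3, ℂ)) := by
  have hz : 0 < ((t : ℂ) * (ε + Complex.I)).re := by simp; positivity
  ext φ
  rw [(goodKernel_heatKernel hz).convOp_toTemperedDistribution hpr hr, heatSchrodinger,
    TemperedDistribution.fourierMultiplierCLM_apply_apply, Lp.toTemperedDistribution_apply]
  congr with y
  rw [smul_eq_mul, mul_comm, ← fourier_smulLeft_fourierInv hz]
  congr 5
  ext ξ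
  unfold modGauss
  congr 1
  push_cast
  simp
  ring

end Distribution

/-! ### The flow on L²: adjoint, semigroup, contraction, dispersion -/

theorem enorm_inner_le {H : Type*} [NormedAddCommGroup H] [InnerProductSpace ℂ H] (x y : H) :
    ‖inner ℂ x y‖ₑ ≤ ‖x‖ₑ * ‖y‖ₑ := by
  rw [← ofReal_norm, ← ofReal_norm, ← ofReal_norm, ← ENNReal.ofReal_mul (norm_nonneg _)]
  exact ENNReal.ofReal_le_ofReal (norm_inner_le_norm _ _)

section LTwo

/-- The space `L²(ℝ³)`. -/
abbrev L2 : Type := Lp ℂ 2 (volume : Measure R3)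

theorem lintegral_enorm_mul_le_eLpNorm_two {f : R3 → ℂ} {g : R3 → ℝ≥0∞} (hf : Measurable f)
    (hg : Measurable g) :
    ∫⁻ x, ‖f x‖ₑ * g x ≤ eLpNorm f 2 volume * (∫⁻ x, g x ^ (2 : ℝ)) ^ (1 / 2 : ℝ) := by
  have h := ENNReal.lintegral_mul_le_Lp_mul_Lq (volume : Measure R3) Real.HolderConjugate.two_two
    hf.enorm.aemeasurable hg.aemeasurable
  rw [← lintegral_enorm_rpow_eq (p := 2) (by norm_num) (by norm_num)]
  exact h

theorem GoodKernel.lintegral_mul_absConv_ne_top {k : R3 → ℂ} (hk : GoodKernel k) (f h : L2) :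
    ∫⁻ x, ‖h x‖ₑ * absConv k f x ≠ ∞ := by
  have hfm := (Lp.stronglyMeasurable f).measurable
  refine ne_top_of_le_ne_top ?_ (lintegral_enorm_mul_le_eLpNorm_two
    (Lp.stronglyMeasurable h).measurable (measurable_absConv hk.cont hfm))
  refine ENNReal.mul_ne_top (Lp.eLpNorm_lt_top h).ne (ENNReal.rpow_ne_top_of_nonneg (by norm_num) ?_)
  refine ne_top_of_le_ne_top ?_ (lintegral_absConv_rpow_le hk.cont hfm one_le_two)
  refine ENNReal.mul_ne_top (ENNReal.rpow_ne_top_of_nonneg (by norm_num)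
    hk.integrable.hasFiniteIntegral.ne) ?_
  have := lintegral_rpow_enorm_lt_top_of_eLpNorm_lt_top (by norm_num) (by norm_num)
    (Lp.eLpNorm_lt_top f)
  simpa using this.ne

theorem star_re_pos {z : ℂ} (hz : 0 < z.re) : 0 < (star z).re := by simpa using hz

open ComplexInnerProductSpace in
/-- The adjoint of the heat semigroup. -/
theorem inner_convOp_heatKernel {z : ℂ} (hz : 0 < z.re) (f g : L2) :
    inner ℂ (convOp 2 2 (heatKernel z) f) g = inner ℂ f (convOp 2 2 (heatKernel (star z)) g) := by
  have hk := goodKernel_heatKernel hz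
  have hk' := goodKernel_heatKernel (star_re_pos hz)
  have hfm := (Lp.stronglyMeasurable f).measurable
  have hgm := (Lp.stronglyMeasurable g).measurable
  rw [← inner_conj_symm, L2.inner_def, L2.inner_def, ← integral_conj]
  have e2 : ∫ x, inner ℂ (f x) ((convOp 2 2 (heatKernel (star z)) g : L2) x) =
      ∫ x, star (f x) * convFun (heatKernel (star z)) g x := by
    refine integral_congr_ae ?_
    filter_upwards [hk'.coeFn_convOp le_rfl (by norm_num) g] with x hx
    rw [hx, RCLike.inner_apply]
    simp [mul_comm]
  have e1 : ∫ x, (starRingEnd ℂ) (inner ℂ (g x) ((convOp 2 2 (heatKernel z) f : L2) x)) =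
      star (∫ x, star (g x) * convFun (heatKernel z) f x) := by
    rw [Complex.star_def, ← integral_conj]
    refine integral_congr_ae ?_
    filter_upwards [hk.coeFn_convOp le_rfl (by norm_num) f] with x hx
    rw [hx, RCLike.inner_apply]
    simp [mul_comm]
  rw [e1, e2, integral_mul_convFun hk.cont hfm (by fun_prop)]
  · rw [Complex.star_def, ← integral_conj]
    congr with y
    rw [map_mul, ← integral_conj, convFun]
    congr 1
    congr with x
    rw [map_mul, ← Complex.star_def, conj_heatKernel hz, ← heatKernel_sub_comm]
    simp
  · simpa using hk.lintegral_mul_absConv_ne_top f g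

/-- The semigroup law on `L²`. -/
theorem convOp_heatKernel_comp {a b : ℂ} (ha : 0 < a.re) (hb : 0 < b.re) (f : L2) :
    convOp 2 2 (heatKernel a) (convOp 2 2 (heatKernel b) f) = convOp 2 2 (heatKernel (a + b)) f := by
  have hka := goodKernel_heatKernel ha
  have hkb := goodKernel_heatKernel hb
  have hkc := goodKernel_heatKernel (z := a + b) (by simp; positivity)
  have hfm := (Lp.stronglyMeasurable f).measurable
  obtain ⟨M, hM⟩ := hkb.absConv_lt_top hfm (by norm_num) (by norm_num) (Lp.memLp f)
  apply Lp.ext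
  filter_upwards [hka.coeFn_convOp le_rfl (by norm_num) (convOp 2 2 (heatKernel b) f),
    hkc.coeFn_convOp le_rfl (by norm_num) f] with x h1 h2
  rw [h1, h2, convFun_congr_ae (hkb.coeFn_convOp le_rfl (by norm_num) f)]
  have hm : Measurable fun w ↦ heatKernel a (x - w) :=
    ((continuous_heatKernel a).comp (by fun_prop)).measurable
  have := integral_mul_convFun (φ := fun w ↦ heatKernel a (x - w)) hkb.cont hfm hm ?_
  · unfold convFun at this ⊢
    simp_rw [mul_comm] at this ⊢
    rw [this]
    congr with y
    rw [← integral_heatKernel_mul_heatKernel ha hb]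
    simp_rw [mul_comm]
  · refine ne_top_of_le_ne_top ?_ (lintegral_mono fun w ↦ mul_le_mul_right (hM w) _)
    rw [lintegral_mul_const _ hm.enorm, lintegral_sub_left_eq_self (fun w ↦ ‖heatKernel a w‖ₑ) x]
    exact ENNReal.mul_ne_top hka.integrable.hasFiniteIntegral.ne ENNReal.coe_ne_top

theorem lintegral_enorm_heatKernel_ofReal {c : ℝ} (hc : 0 < c) :
    ∫⁻ x, ‖heatKernel (c : ℂ) x‖ₑ = 1 := by
  rw [← ofReal_integral_norm_eq_lintegral_enorm (integrable_heatKernel (by simpa using hc)),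
    integral_norm_heatKernel_ofReal hc, ENNReal.ofReal_one]

theorem norm_convOp_heatKernel_ofReal_le {c : ℝ} (hc : 0 < c) (f : L2) :
    ‖convOp 2 2 (heatKernel (c : ℂ)) f‖ ≤ ‖f‖ := by
  have hk := goodKernel_heatKernel (z := (c : ℂ)) (by simpa using hc)
  obtain ⟨B, hB⟩ := hk.bdd
  have := hk.enorm_convOp_le (p := 2) (r := 2) le_rfl (by norm_num) f hB
  rw [lintegral_enorm_heatKernel_ofReal hc] at this
  simp only [expGap, sub_self, sub_zero, ENNReal.rpow_one, ENNReal.rpow_zero, one_mul] at this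
  rw [← ofReal_norm, ← ofReal_norm] at this
  exact (ENNReal.ofReal_le_ofReal_iff (norm_nonneg _)).1 this

/-- The complex heat semigroup is contractive on `L²`. -/
theorem norm_convOp_heatKernel_le {z : ℂ} (hz : 0 < z.re) (f : L2) :
    ‖convOp 2 2 (heatKernel z) f‖ ≤ ‖f‖ := by
  have h1 : (‖convOp 2 2 (heatKernel z) f‖ ^ 2 : ℝ) ≤ ‖f‖ * ‖f‖ := by
    -- T*T argument: the adjoint has parameter z̄ and z̄ + z = 2 Re z is real, so Young's inequality
    -- applies with a kernel of mass one.
    have h2 := inner_convOp_heatKernel hz f (convOp 2 2 (heatKernel z) f)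
    rw [convOp_heatKernel_comp (star_re_pos hz) hz,
      show star z + z = ((2 * z.re : ℝ) : ℂ) by
        rw [Complex.star_def, add_comm, Complex.add_conj]] at h2
    have h3 := congrArg norm h2
    rw [inner_self_eq_norm_sq_to_K] at h3
    calc (‖convOp 2 2 (heatKernel z) f‖ ^ 2 : ℝ) = _ := by simpa using h3
      _ ≤ ‖f‖ * ‖convOp 2 2 (heatKernel ((2 * z.re : ℝ) : ℂ)) f‖ := norm_inner_le_norm _ _
      _ ≤ _ := by
        gcongr
        exact norm_convOp_heatKernel_ofReal_le (by positivity) f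
  nlinarith [norm_nonneg f, norm_nonneg (convOp 2 2 (heatKernel z) f)]

theorem enorm_convFun_le_of_bdd {k : R3 → ℂ} {B : ℝ≥0∞} (hB : ∀ x, ‖k x‖ₑ ≤ B)
    {f : R3 → ℂ} (hf : Measurable f) (x : R3) : ‖convFun k f x‖ₑ ≤ (∫⁻ y, ‖f y‖ₑ) * B := by
  refine (enorm_convFun_le k f x).trans ?_
  rw [absConv, ← lintegral_mul_const _ hf.enorm]
  gcongr
  exact hB _

/-- The dispersive estimate in bilinear form. -/
theorem enorm_inner_convOp_heatKernel_le {a b : ℂ} (ha : 0 < a.re) (hb : 0 < b.re) (f g : L2) :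
    ‖inner ℂ (convOp 2 2 (heatKernel a) f) (convOp 2 2 (heatKernel b) g)‖ₑ ≤
      ENNReal.ofReal (‖star a + b‖ ^ (-(3 / 2) : ℝ)) * ((∫⁻ x, ‖f x‖ₑ) * ∫⁻ x, ‖g x‖ₑ) := by
  have hfm := (Lp.stronglyMeasurable f).measurable
  have hgm := (Lp.stronglyMeasurable g).measurable
  have hc : 0 < (star a + b).re := by simp; positivity
  -- Both flows are moved onto g, where they combine to parameter ā + b. The kernel is then used
  -- only through its supremum.
  rw [inner_convOp_heatKernel ha, convOp_heatKernel_comp (star_re_pos ha) hb, L2.inner_def]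
  refine (enorm_integral_le_lintegral_enorm _).trans ?_
  have hB : ∀ x, ‖heatKernel (star a + b) x‖ₑ ≤ ENNReal.ofReal (‖star a + b‖ ^ (-(3 / 2) : ℝ)) :=
    fun x ↦ by
      rw [← ofReal_norm]
      exact ENNReal.ofReal_le_ofReal (norm_heatKernel_le_rpow hc x)
  calc _ ≤ ∫⁻ x, ‖f x‖ₑ * ((∫⁻ y, ‖g y‖ₑ) * ENNReal.ofReal (‖star a + b‖ ^ (-(3 / 2) : ℝ))) := by
        refine lintegral_mono_ae ?_
        filter_upwards [(goodKernel_heatKernel hc).coeFn_convOp le_rfl (by norm_num) g] with x hx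
        rw [hx]
        refine (enorm_inner_le _ _).trans ?_
        gcongr
        exact enorm_convFun_le_of_bdd hB hgm x
    _ = _ := by
        rw [lintegral_mul_const _ hfm.enorm]
        ring

end LTwo

/-! ### Integrals of the near and far kernels in time -/

section KernelIntegrals

theorem lintegral_abs_eq (f : ℝ → ℝ≥0∞) :
    ∫⁻ τ, f |τ| = 2 * ∫⁻ τ in Set.Ioi 0, f τ := by
  have h1 : ∫⁻ τ in Set.Ioi (0 : ℝ), f |τ| = ∫⁻ τ in Set.Ioi 0, f τ :=
    setLIntegral_congr_fun measurableSet_Ioi fun τ hτ ↦ by rw [abs_of_pos hτ]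
  have h2 : ∫⁻ τ in Set.Iic (0 : ℝ), f |τ| = ∫⁻ τ in Set.Ioi 0, f τ := by
    rw [← h1, setLIntegral_congr (Ioi_ae_eq_Ici (a := (0 : ℝ)))]
    have := (Measure.measurePreserving_neg (volume : Measure ℝ)).setLIntegral_comp_preimage_emb
      (MeasurableEquiv.neg ℝ).measurableEmbedding (fun τ ↦ f |τ|) (Set.Ici 0)
    simpa using this
  rw [← lintegral_add_compl _ (measurableSet_Ioi (a := (0 : ℝ))), Set.compl_Ioi, h1, h2, two_mul]

theorem setLIntegral_Ioi_rpow {R : ℝ} (hR : 0 < R) {a : ℝ} (ha : a < -1) :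
    ∫⁻ τ in Set.Ioi R, ENNReal.ofReal (τ ^ a) = ENNReal.ofReal (-R ^ (a + 1) / (a + 1)) := by
  rw [← integral_Ioi_rpow_of_lt ha hR, ofReal_integral_eq_lintegral_ofReal
    (integrableOn_Ioi_rpow_of_lt ha hR)]
  filter_upwards [ae_restrict_mem measurableSet_Ioi] with τ hτ
  have : 0 < τ := hR.trans hτ
  positivity

theorem setLIntegral_Ioc_rpow {R : ℝ} (hR : 0 ≤ R) {a : ℝ} (ha : -1 < a) :
    ∫⁻ τ in Set.Ioc 0 R, ENNReal.ofReal (τ ^ a) = ENNReal.ofReal (R ^ (a + 1) / (a + 1)) := by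
  have h := integral_rpow (a := 0) (b := R) (r := a) (Or.inl ha)
  rw [Real.zero_rpow (by linarith), sub_zero, intervalIntegral.integral_of_le hR] at h
  rw [← h, ofReal_integral_eq_lintegral_ofReal]
  · exact (intervalIntegrable_iff_integrableOn_Ioc_of_le hR).1
      (intervalIntegral.intervalIntegrable_rpow' ha)
  · filter_upwards [ae_restrict_mem measurableSet_Ioc] with τ hτ
    have : 0 < τ := hτ.1
    positivity

/-- The tail kernel `|τ|^(-3/2)` on `|τ| > R`. -/
noncomputable def tailKernel (R τ : ℝ) : ℝ≥0∞ :=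
  if R < |τ| then ENNReal.ofReal (|τ| ^ (-(3 / 2) : ℝ)) else 0

/-- The indicator of `|τ| ≤ R`. -/
noncomputable def boxKernel (R τ : ℝ) : ℝ≥0∞ := if |τ| ≤ R then 1 else 0

theorem measurable_tailKernel (R : ℝ) : Measurable (tailKernel R) := by
  unfold tailKernel
  refine Measurable.ite (measurableSet_lt (by fun_prop) (by fun_prop)) (by fun_prop) (by fun_prop)

theorem measurable_boxKernel (R : ℝ) : Measurable (boxKernel R) := by
  unfold boxKernel
  refine Measurable.ite (measurableSet_le (by fun_prop) (by fun_prop)) (by fun_prop) (by fun_prop)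

theorem lintegral_tailKernel {R : ℝ} (hR : 0 < R) :
    ∫⁻ τ, tailKernel R τ = ENNReal.ofReal (4 * R ^ (-(1 / 2) : ℝ)) := by
  have h := lintegral_abs_eq
    (fun τ ↦ if R < τ then ENNReal.ofReal (τ ^ (-(3 / 2) : ℝ)) else 0)
  have h2 : ∫⁻ τ in Set.Ioi 0, (if R < τ then ENNReal.ofReal (τ ^ (-(3 / 2) : ℝ)) else 0) =
      ∫⁻ τ in Set.Ioi R, ENNReal.ofReal (τ ^ (-(3 / 2) : ℝ)) := by
    rw [← lintegral_indicator measurableSet_Ioi, ← lintegral_indicator measurableSet_Ioi]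
    congr with τ
    simp only [Set.indicator, Set.mem_Ioi]
    split_ifs <;> first | rfl | linarith
  unfold tailKernel
  rw [h, h2, setLIntegral_Ioi_rpow hR (by norm_num), ← ENNReal.ofReal_ofNat,
    ← ENNReal.ofReal_mul (by norm_num)]
  congr 1
  norm_num
  ring

theorem lintegral_boxKernel {R : ℝ} (hR : 0 < R) : ∫⁻ τ, boxKernel R τ = ENNReal.ofReal (2 * R) := by
  have : boxKernel R = (Set.Icc (-R) R).indicator 1 := by
    ext τ; simp [boxKernel, Set.indicator, abs_le]
  rw [this, lintegral_indicator_one measurableSet_Icc, Real.volume_Icc]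
  congr 1; ring

end KernelIntegrals

/-! ### Schur's test and almost orthogonality across scales -/

section Bilinear

theorem ENNReal.mul_le_sq_add_sq (x y : ℝ≥0∞) : x * y ≤ x ^ 2 + y ^ 2 := by
  rcases le_total x y with h | h
  · exact (mul_le_mul_left h y).trans (by rw [← sq]; exact le_add_self)
  · exact (mul_le_mul_right h x).trans (by rw [← sq]; exact le_self_add)

/-- Schur's test for convolution kernels, in an additive form. -/
theorem lintegral_lintegral_kernel_le {κ c d : ℝ → ℝ≥0∞} (hκ : Measurable κ) (hc : Measurable c)
    (hd : Measurable d) (J : Set ℝ) :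
    ∫⁻ s in J, ∫⁻ t in J, κ (s - t) * (c s * d t) ≤
      (∫⁻ τ, κ τ) * (∫⁻ t in J, c t ^ 2) + (∫⁻ τ, κ τ) * ∫⁻ t in J, d t ^ 2 := by
  have h1 : ∫⁻ s in J, ∫⁻ t in J, κ (s - t) * c s ^ 2 ≤ (∫⁻ τ, κ τ) * ∫⁻ t in J, c t ^ 2 := by
    rw [← lintegral_const_mul _ (by fun_prop)]
    refine lintegral_mono fun s ↦ ?_
    rw [lintegral_mul_const _ (by fun_prop)]
    refine mul_le_mul_left ((setLIntegral_le_lintegral J _).trans ?_) _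
    rw [lintegral_sub_left_eq_self κ s]
  have h2 : ∫⁻ s in J, ∫⁻ t in J, κ (s - t) * d t ^ 2 ≤ (∫⁻ τ, κ τ) * ∫⁻ t in J, d t ^ 2 := by
    rw [lintegral_lintegral_swap (by fun_prop), ← lintegral_const_mul _ (by fun_prop)]
    refine lintegral_mono fun t ↦ ?_
    rw [lintegral_mul_const _ (by fun_prop)]
    refine mul_le_mul_left ((setLIntegral_le_lintegral J _).trans ?_) _
    rw [lintegral_sub_right_eq_self κ t]
  refine le_trans ?_ (add_le_add h1 h2)
  rw [← lintegral_add_left (by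
    exact Measurable.lintegral_prod_right' (f := fun z : ℝ × ℝ ↦ κ (z.1 - z.2) * c z.1 ^ 2)
      (by fun_prop))]
  refine lintegral_mono fun s ↦ ?_
  rw [← lintegral_add_left (by fun_prop)]
  refine lintegral_mono fun t ↦ ?_
  rw [← mul_add]
  gcongr
  exact ENNReal.mul_le_sq_add_sq _ _

variable {H : Type*} [NormedAddCommGroup H] [InnerProductSpace ℂ H] [CompleteSpace H]

theorem enorm_inner_comm (x y : H) : ‖inner ℂ x y‖ₑ = ‖inner ℂ y x‖ₑ := by
  rw [← inner_conj_symm, RCLike.enorm_conj]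

theorem enorm_inner_integral_le {α : Type*} [MeasurableSpace α] {μ : Measure α} {Y : α → H}
    (hY : Integrable Y μ) (x : H) :
    ‖inner ℂ x (∫ t, Y t ∂μ)‖ₑ ≤ ∫⁻ t, ‖inner ℂ x (Y t)‖ₑ ∂μ := by
  rw [← integral_inner hY x]
  exact enorm_integral_le_lintegral_enorm _

theorem enorm_inner_integral_integral_le {α : Type*} [MeasurableSpace α] {μ ν : Measure α}
    {X Y : α → H} (hX : Integrable X μ) (hY : Integrable Y ν) :
    ‖inner ℂ (∫ s, X s ∂μ) (∫ t, Y t ∂ν)‖ₑ ≤ ∫⁻ s, ∫⁻ t, ‖inner ℂ (X s) (Y t)‖ₑ ∂ν ∂μ := by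
  rw [enorm_inner_comm]
  refine (enorm_inner_integral_le hX _).trans (lintegral_mono fun s ↦ ?_)
  rw [enorm_inner_comm]
  exact enorm_inner_integral_le hY _

/-- A dispersive kernel bound, relating two families of vectors at scales `L` and `M`. -/
def DispersiveBound (L M : ℝ) (X Y : ℝ → H) (c d : ℝ → ℝ≥0∞) : Prop :=
  ∀ s t, s ≠ t → ‖inner ℂ (X s) (Y t)‖ₑ ≤
    ENNReal.ofReal (|s - t| ^ (-(3 / 2) : ℝ) * (L⁻¹ * M⁻¹)) * (c s * d t)

/-- Expand the square as a double integral. Near the diagonal the energy bound is used, away from it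
the dispersive bound; the resulting convolution kernel has integral 6 at every scale L, and the
additive form of Schur's test counts it twice. -/
theorem enorm_setIntegral_sq_le {L : ℝ} (hL : 0 < L) {X : ℝ → H} {c : ℝ → ℝ≥0∞}
    (hX : Integrable X) (hc : Measurable c) (h1 : ∀ t, ‖X t‖ₑ ≤ ENNReal.ofReal (L ^ 2) * c t)
    (h2 : DispersiveBound L L X X c c) (J : Set ℝ) :
    ‖∫ t in J, X t‖ₑ ^ 2 ≤ 12 * ∫⁻ t in J, c t ^ 2 := by
  -- At |s - t| = L⁻⁴ the energy bound L⁴ equals the dispersive bound |s - t|^(-3/2) L⁻². The two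
  -- parts of the kernel then integrate to 2 and 4.
  set R : ℝ := (L ^ 4)⁻¹ with hR
  have hR0 : 0 < R := by positivity
  set κ : ℝ → ℝ≥0∞ := fun τ ↦ ENNReal.ofReal (L ^ 4) * boxKernel R τ +
    ENNReal.ofReal (L⁻¹ * L⁻¹) * tailKernel R τ with hκ
  have hbm := measurable_boxKernel R
  have htm := measurable_tailKernel R
  have hκm : Measurable κ := by fun_prop
  have hκi : ∫⁻ τ, κ τ = 6 := by
    rw [hκ, lintegral_add_left (by fun_prop), lintegral_const_mul _ hbm,
      lintegral_const_mul _ htm, lintegral_tailKernel hR0, lintegral_boxKernel hR0,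
      ← ENNReal.ofReal_mul (by positivity), ← ENNReal.ofReal_mul (by positivity),
      ← ENNReal.ofReal_add (by positivity) (by positivity)]
    have : R ^ (-(1 / 2) : ℝ) = L ^ 2 := by
      rw [hR, Real.inv_rpow (by positivity), ← Real.rpow_neg (by positivity), neg_neg,
        ← Real.sqrt_eq_rpow, show L ^ 4 = (L ^ 2) ^ 2 by ring, Real.sqrt_sq (by positivity)]
    rw [this, hR]
    have : L ^ 4 * (2 * (L ^ 4)⁻¹) + L⁻¹ * L⁻¹ * (4 * L ^ 2) = 6 := by field_simp; norm_num
    rw [this]; norm_num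
  have h3 : ∀ s t, ‖inner ℂ (X s) (X t)‖ₑ ≤ κ (s - t) * (c s * c t) := by
    intro s t
    by_cases hst : |s - t| ≤ R
    · have : ENNReal.ofReal (L ^ 4) ≤ κ (s - t) := by
        simp [hκ, boxKernel, hst]
      refine (enorm_inner_le _ _).trans ((mul_le_mul' (h1 s) (h1 t)).trans ?_)
      refine le_trans (le_of_eq ?_) (mul_le_mul_left this _)
      rw [show L ^ 4 = L ^ 2 * L ^ 2 by ring, ENNReal.ofReal_mul (by positivity)]
      ring
    · push Not at hst
      have hne : s ≠ t := by rintro rfl; simp at hst; linarith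
      refine (h2 s t hne).trans (mul_le_mul_left ?_ _)
      have h0 : ¬ |s - t| ≤ R := not_le.2 hst
      simp only [hκ, boxKernel, tailKernel, hst, h0, if_true, if_false, mul_zero, zero_add]
      rw [mul_comm, ENNReal.ofReal_mul (by positivity)]
  have h4 : ‖∫ t in J, X t‖ₑ ^ 2 = ‖inner ℂ (∫ t in J, X t) (∫ t in J, X t)‖ₑ := by
    rw [inner_self_eq_norm_sq_to_K, enorm_pow]; simp [← ofReal_norm]
  rw [h4]
  refine (enorm_inner_integral_integral_le hX.integrableOn hX.integrableOn).trans ?_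
  refine (lintegral_mono fun s ↦ lintegral_mono fun t ↦ h3 s t).trans ?_
  refine (lintegral_lintegral_kernel_le hκm hc hc J).trans (le_of_eq ?_)
  rw [hκi]; ring

theorem ENNReal.mul_le_div_add_mul {a : ℝ} (ha : 0 < a) (x y : ℝ≥0∞) :
    x * y ≤ ENNReal.ofReal a⁻¹ * x ^ 2 + ENNReal.ofReal a * y ^ 2 := by
  have h := ENNReal.mul_le_sq_add_sq (ENNReal.ofReal (√a)⁻¹ * x) (ENNReal.ofReal √a * y)
  have hs : 0 < √a := Real.sqrt_pos.2 ha
  rw [mul_pow, mul_pow, ← ENNReal.ofReal_pow (by positivity), ← ENNReal.ofReal_pow (by positivity),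
    inv_pow, Real.sq_sqrt ha.le] at h
  refine le_trans (le_of_eq ?_) h
  rw [mul_mul_mul_comm, ← ENNReal.ofReal_mul (by positivity), inv_mul_cancel₀ hs.ne']
  simp

/-- Schur's test alone gives no decay in the ratio of the scales: splitting its kernel at |s - t| =
(LM)⁻² produces a constant. The gain comes from a window around t on which the X-integral is
estimated as one vector by the same-scale bound, so that only the other family pays its pointwise
norm. With L = M / ρ² the outcome is of size ρ. -/
theorem enorm_inner_integral_integral_le_ratio {M ρ : ℝ} (hM : 0 < M) (hρ : 0 < ρ)
    {X Y : ℝ → H} {c d : ℝ → ℝ≥0∞} (hX : Integrable X) (hY : Integrable Y) (hc : Measurable c)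
    (hd : Measurable d) (h1X : ∀ t, ‖X t‖ₑ ≤ ENNReal.ofReal ((M / ρ ^ 2) ^ 2) * c t)
    (h1Y : ∀ t, ‖Y t‖ₑ ≤ ENNReal.ofReal (M ^ 2) * d t)
    (h2X : DispersiveBound (M / ρ ^ 2) (M / ρ ^ 2) X X c c)
    (h2 : DispersiveBound (M / ρ ^ 2) M X Y c d) :
    ‖inner ℂ (∫ s, X s) (∫ t, Y t)‖ₑ ≤
      28 * ENNReal.ofReal ρ * ((∫⁻ t, c t ^ 2) + ∫⁻ t, d t ^ 2) := by
  set L := M / ρ ^ 2 with hL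
  have hL0 : 0 < L := by positivity
  -- The window has radius η². The near part costs M² η and the far part is of order L⁻¹ M⁻¹ η⁻¹;
  -- with this η both are multiples of ρ.
  set η : ℝ := ρ / M ^ 2 with hη
  have hη0 : 0 < η := by positivity
  set R : ℝ := η ^ 2 with hR
  have hR0 : 0 < R := by positivity
  have hbm := measurable_boxKernel R
  have htm := measurable_tailKernel R
  have key : ∀ t, ‖inner ℂ (∫ s, X s) (Y t)‖ₑ ≤
      ENNReal.ofReal (M ^ 2) * (ENNReal.ofReal η⁻¹ * (12 * ∫⁻ s, boxKernel R (s - t) * c s ^ 2) +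
        ENNReal.ofReal η * d t ^ 2) +
      ENNReal.ofReal (L⁻¹ * M⁻¹) * ∫⁻ s, tailKernel R (s - t) * (c s * d t) := by
    intro t
    set W : Set ℝ := {s | |s - t| ≤ R} with hW
    have hWm : MeasurableSet W := measurableSet_le (by fun_prop) (by fun_prop)
    rw [← integral_add_compl hWm hX, inner_add_left]
    refine (enorm_add_le _ _).trans (add_le_add ?_ ?_)
    -- On the window the norm is taken outside the s-integral; taking it inside would lose the gain.
    · have h3 := enorm_setIntegral_sq_le hL0 hX hc h1X h2X W
      have h4 : ∫⁻ s in W, c s ^ 2 = ∫⁻ s, boxKernel R (s - t) * c s ^ 2 := by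
        rw [← lintegral_indicator hWm]
        congr with s
        by_cases hs : |s - t| ≤ R <;> simp [boxKernel, W, hs]
      rw [h4] at h3
      calc _ ≤ ‖∫ s in W, X s‖ₑ * ‖Y t‖ₑ := enorm_inner_le _ _
        _ ≤ ‖∫ s in W, X s‖ₑ * (ENNReal.ofReal (M ^ 2) * d t) := by gcongr; exact h1Y t
        _ = ENNReal.ofReal (M ^ 2) * (‖∫ s in W, X s‖ₑ * d t) := by ring
        _ ≤ ENNReal.ofReal (M ^ 2) * (ENNReal.ofReal η⁻¹ * ‖∫ s in W, X s‖ₑ ^ 2 +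
            ENNReal.ofReal η * d t ^ 2) := by
          gcongr
          exact ENNReal.mul_le_div_add_mul hη0 _ _
        _ ≤ _ := by gcongr
    · rw [enorm_inner_comm]
      refine (enorm_inner_integral_le hX.integrableOn _).trans ?_
      rw [← lintegral_const_mul _ (by fun_prop), ← lintegral_indicator hWm.compl]
      refine lintegral_mono fun s ↦ ?_
      by_cases hs : |s - t| ≤ R
      · simp [W, hs]
      · have hs' : R < |s - t| := not_le.1 hs
        have hne : s ≠ t := by rintro rfl; simp at hs'; linarith
        simp only [Set.indicator, W, Set.mem_compl_iff, Set.mem_ofPred_eq, hs, not_false_eq_true,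
          if_true, tailKernel, hs']
        rw [enorm_inner_comm]
        refine (h2 s t hne).trans (le_of_eq ?_)
        rw [mul_comm (|s - t| ^ (-(3 / 2) : ℝ)), ENNReal.ofReal_mul (by positivity), mul_assoc]
  have hbox : ∫⁻ t, ∫⁻ s, boxKernel R (s - t) * c s ^ 2 = ENNReal.ofReal (2 * R) * ∫⁻ s, c s ^ 2 := by
    rw [lintegral_lintegral_swap (by fun_prop), ← lintegral_const_mul _ (by fun_prop)]
    congr with s
    rw [lintegral_mul_const _ (by fun_prop), lintegral_sub_left_eq_self (boxKernel R) s,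
      lintegral_boxKernel hR0]
  have htail : ∫⁻ t, ∫⁻ s, tailKernel R (s - t) * (c s * d t) ≤
      ENNReal.ofReal (4 * η⁻¹) * ((∫⁻ t, c t ^ 2) + ∫⁻ t, d t ^ 2) := by
    rw [lintegral_lintegral_swap (by fun_prop)]
    have := lintegral_lintegral_kernel_le htm hc hd Set.univ
    simp only [Measure.restrict_univ] at this
    refine this.trans (le_of_eq ?_)
    rw [lintegral_tailKernel hR0, ← mul_add, hR, Real.rpow_neg (by positivity),
      ← Real.sqrt_eq_rpow, Real.sqrt_sq hη0.le]
  refine (enorm_inner_integral_le hY _).trans ((lintegral_mono key).trans ?_)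
  rw [lintegral_add_right, lintegral_const_mul, lintegral_add_right, lintegral_const_mul,
    lintegral_const_mul, lintegral_const_mul, lintegral_const_mul, hbox]
  · refine (add_le_add_right (mul_le_mul_right htail _) _).trans ?_
    set Ic := ∫⁻ t, c t ^ 2
    set Id := ∫⁻ t, d t ^ 2
    have e1 : ENNReal.ofReal (M ^ 2) * (ENNReal.ofReal η⁻¹ * (12 * (ENNReal.ofReal (2 * R) * Ic)) +
        ENNReal.ofReal η * Id) = 24 * ENNReal.ofReal ρ * Ic + ENNReal.ofReal ρ * Id := by
      have a1 : ENNReal.ofReal (M ^ 2) * ENNReal.ofReal η⁻¹ * ENNReal.ofReal (2 * R) =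
          2 * ENNReal.ofReal ρ := by
        rw [← ENNReal.ofReal_mul (by positivity), ← ENNReal.ofReal_mul (by positivity),
          ← ENNReal.ofReal_ofNat, ← ENNReal.ofReal_mul (by positivity)]
        congr 1
        rw [hR, hη]; field_simp
      have a2 : ENNReal.ofReal (M ^ 2) * ENNReal.ofReal η = ENNReal.ofReal ρ := by
        rw [← ENNReal.ofReal_mul (by positivity)]
        congr 1
        rw [hη]; field_simp
      calc _ = 12 * (ENNReal.ofReal (M ^ 2) * ENNReal.ofReal η⁻¹ * ENNReal.ofReal (2 * R)) * Ic +
            (ENNReal.ofReal (M ^ 2) * ENNReal.ofReal η) * Id := by ring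
        _ = _ := by rw [a1, a2]; ring
    have e2 : ENNReal.ofReal (L⁻¹ * M⁻¹) * (ENNReal.ofReal (4 * η⁻¹) * (Ic + Id)) =
        4 * ENNReal.ofReal ρ * (Ic + Id) := by
      rw [← mul_assoc, ← ENNReal.ofReal_mul (by positivity)]
      congr 1
      rw [← ENNReal.ofReal_ofNat, ← ENNReal.ofReal_mul (by positivity)]
      congr 1
      rw [hL, hη]; field_simp
    rw [e1, e2]
    calc 24 * ENNReal.ofReal ρ * Ic + ENNReal.ofReal ρ * Id + 4 * ENNReal.ofReal ρ * (Ic + Id)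
        = ENNReal.ofReal ρ * (28 * Ic + 5 * Id) := by ring
      _ ≤ ENNReal.ofReal ρ * (28 * Ic + 28 * Id) := by gcongr; norm_num
      _ = _ := by ring
  all_goals fun_prop

theorem tsum_int_two_pow_natAbs_ne_top : ∑' n : ℤ, ((2 : ℝ≥0∞)⁻¹) ^ n.natAbs ≠ ∞ := by
  have h0 : ∑' n : ℕ, ((2 : ℝ≥0∞)⁻¹) ^ n = 2 := by
    rw [ENNReal.tsum_geometric, ENNReal.one_sub_inv_two, inv_inv]
  have h1 : HasSum (fun n : ℕ ↦ ((2 : ℝ≥0∞)⁻¹) ^ (n : ℤ).natAbs)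
      (∑' n : ℕ, ((2 : ℝ≥0∞)⁻¹) ^ n) := ENNReal.summable.hasSum
  have h2 : HasSum (fun n : ℕ ↦ ((2 : ℝ≥0∞)⁻¹) ^ (-((n : ℤ) + 1)).natAbs)
      (∑' n : ℕ, ((2 : ℝ≥0∞)⁻¹) ^ (n + 1)) := by
    have e : ∀ n : ℕ, (-((n : ℤ) + 1)).natAbs = n + 1 := fun n ↦ by omega
    simp_rw [e]
    exact ENNReal.summable.hasSum
  have h3 := (HasSum.of_nat_of_neg_add_one (f := fun n : ℤ ↦ ((2 : ℝ≥0∞)⁻¹) ^ n.natAbs) h1 h2).tsum_eq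
  rw [h3, h0]
  simp_rw [pow_succ]
  rw [ENNReal.tsum_mul_right, h0]
  exact ENNReal.add_ne_top.2 ⟨ENNReal.ofNat_ne_top, ENNReal.mul_ne_top ENNReal.ofNat_ne_top (by simp)⟩

/-- Almost orthogonality of dispersive families at the scales `4 ^ k`. -/
theorem exists_enorm_sum_integral_sq_le : ∃ C : ℝ≥0, ∀ {H : Type} [NormedAddCommGroup H]
    [InnerProductSpace ℂ H] [CompleteSpace H] (X : ℤ → ℝ → H) (c : ℤ → ℝ → ℝ≥0∞),
    (∀ k, Integrable (X k)) → (∀ k, Measurable (c k)) →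
    (∀ k t, ‖X k t‖ₑ ≤ ENNReal.ofReal (((4 : ℝ) ^ k) ^ 2) * c k t) →
    (∀ k l, DispersiveBound ((4 : ℝ) ^ k) ((4 : ℝ) ^ l) (X k) (X l) (c k) (c l)) →
    ∀ S : Finset ℤ, ‖∑ k ∈ S, ∫ t, X k t‖ₑ ^ 2 ≤ C * ∑ k ∈ S, ∫⁻ t, c k t ^ 2 := by
  set G := ∑' n : ℤ, ((2 : ℝ≥0∞)⁻¹) ^ n.natAbs with hG
  refine ⟨(56 * G).toNNReal, fun {H} _ _ _ X c hX hc h1 h2 S ↦ ?_⟩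
  rw [ENNReal.coe_toNNReal (ENNReal.mul_ne_top (by norm_num) tsum_int_two_pow_natAbs_ne_top)]
  have key0 : ∀ k l : ℤ, l ≤ k → ‖inner ℂ (∫ t, X k t) (∫ t, X l t)‖ₑ ≤
      28 * ((2 : ℝ≥0∞)⁻¹) ^ (k - l).natAbs * ((∫⁻ t, c k t ^ 2) + ∫⁻ t, c l t ^ 2) := by
    intro k l hkl
    obtain ⟨n, rfl⟩ := Int.le.dest hkl
    -- For scales n steps apart the ratio is 4^n = (2^(-n))⁻², so ρ = 2^(-n) is the summable gain.
    have e : (4 : ℝ) ^ (l + n) = (4 : ℝ) ^ l / ((2 : ℝ)⁻¹ ^ n) ^ 2 := by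
      rw [zpow_add₀ (by norm_num), ← pow_mul, mul_comm n 2, pow_mul, inv_pow, inv_pow,
        div_inv_eq_mul]
      norm_num
    have := enorm_inner_integral_integral_le_ratio (M := (4 : ℝ) ^ l) (ρ := (2 : ℝ)⁻¹ ^ n)
      (by positivity) (by positivity) (hX (l + n)) (hX l) (hc _) (hc _)
      (by rw [← e]; exact h1 _) (h1 _) (by rw [← e]; exact h2 _ _) (by rw [← e]; exact h2 _ _)
    convert this using 3
    rw [ENNReal.ofReal_pow (by norm_num), ENNReal.ofReal_inv_of_pos (by norm_num)]
    simp
  have key : ∀ k l : ℤ, ‖inner ℂ (∫ t, X k t) (∫ t, X l t)‖ₑ ≤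
      28 * ((2 : ℝ≥0∞)⁻¹) ^ (k - l).natAbs * ((∫⁻ t, c k t ^ 2) + ∫⁻ t, c l t ^ 2) := by
    intro k l
    rcases le_total l k with h | h
    · exact key0 k l h
    · rw [enorm_inner_comm, ← Int.natAbs_neg, neg_sub, add_comm]
      exact key0 l k h
  have hsum : ∀ k, ∑ l ∈ S, ((2 : ℝ≥0∞)⁻¹) ^ (k - l).natAbs ≤ G := fun k ↦ by
    refine (ENNReal.sum_le_tsum S).trans (le_of_eq ?_)
    exact (Equiv.subLeft k).tsum_eq (fun n : ℤ ↦ ((2 : ℝ≥0∞)⁻¹) ^ n.natAbs)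
  have hsum' : ∀ l, ∑ k ∈ S, ((2 : ℝ≥0∞)⁻¹) ^ (k - l).natAbs ≤ G := fun l ↦ by
    refine (ENNReal.sum_le_tsum S).trans (le_of_eq ?_)
    exact (Equiv.subRight l).tsum_eq (fun n : ℤ ↦ ((2 : ℝ≥0∞)⁻¹) ^ n.natAbs)
  have h4 : ‖∑ k ∈ S, ∫ t, X k t‖ₑ ^ 2 =
      ‖inner ℂ (∑ k ∈ S, ∫ t, X k t) (∑ k ∈ S, ∫ t, X k t)‖ₑ := by
    rw [inner_self_eq_norm_sq_to_K, enorm_pow]; simp [← ofReal_norm]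
  rw [h4, sum_inner]
  simp_rw [inner_sum]
  calc _ ≤ ∑ k ∈ S, ∑ l ∈ S, 28 * ((2 : ℝ≥0∞)⁻¹) ^ (k - l).natAbs *
        ((∫⁻ t, c k t ^ 2) + ∫⁻ t, c l t ^ 2) := by
        refine (enorm_sum_le _ _).trans (Finset.sum_le_sum fun k _ ↦ ?_)
        exact (enorm_sum_le _ _).trans (Finset.sum_le_sum fun l _ ↦ key k l)
    _ = ∑ k ∈ S, 28 * (∫⁻ t, c k t ^ 2) * ∑ l ∈ S, ((2 : ℝ≥0∞)⁻¹) ^ (k - l).natAbs +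
        ∑ l ∈ S, 28 * (∫⁻ t, c l t ^ 2) * ∑ k ∈ S, ((2 : ℝ≥0∞)⁻¹) ^ (k - l).natAbs := by
        simp_rw [Finset.mul_sum]
        rw [Finset.sum_comm (s := S) (t := S)
          (f := fun l k ↦ 28 * (∫⁻ t, c l t ^ 2) * ((2 : ℝ≥0∞)⁻¹) ^ (k - l).natAbs),
          ← Finset.sum_add_distrib]
        refine Finset.sum_congr rfl fun k _ ↦ ?_
        rw [← Finset.sum_add_distrib]
        refine Finset.sum_congr rfl fun l _ ↦ ?_
        ring
    _ ≤ ∑ k ∈ S, 28 * (∫⁻ t, c k t ^ 2) * G + ∑ l ∈ S, 28 * (∫⁻ t, c l t ^ 2) * G := by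
        gcongr with k _ l _
        · exact hsum k
        · exact hsum' l
    _ = _ := by
        rw [Finset.mul_sum, ← Finset.sum_add_distrib]
        refine Finset.sum_congr rfl fun l _ ↦ ?_
        ring

end Bilinear

/-! ### Kernel families with heat scaling: smoothing and continuity in time -/

/-- The target may be an operator space that is not separable; the image of a subset of the line
under a continuous map is separable nevertheless. -/
theorem ContinuousOn.stronglyMeasurable_indicator_of_real {E : Type*} [NormedAddCommGroup E]
    {g : ℝ → E} {s : Set ℝ} (hg : ContinuousOn g s) (hs : MeasurableSet s) :
    StronglyMeasurable (s.indicator g) := by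
  classical
  borelize E
  refine stronglyMeasurable_iff_measurable_separable.2 ⟨?_, ?_⟩
  · rw [← Set.piecewise_eq_indicator]
    exact hg.measurable_piecewise continuousOn_const hs
  · have h1 : TopologicalSpace.IsSeparable (g '' s ∪ {0}) :=
      (hg.isSeparable_image (TopologicalSpace.IsSeparable.of_separableSpace s)).union
        (Set.finite_singleton 0).isSeparable
    refine h1.mono ?_
    rintro _ ⟨x, rfl⟩
    by_cases hx : x ∈ s
    · left; exact ⟨x, hx, by simp [hx]⟩
    · right; simp [hx]

/-- Kernel families with the scaling and the decay of the heat kernel and its derivatives: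
`‖κ_t‖_1 ≲ t^(-β)` and `‖κ_t‖_∞ ≲ t^(-β-3/2)`. -/
structure HeatFamily (β : ℝ) (κ : ℝ → R3 → ℂ) : Prop where
  nonneg : 0 ≤ β
  cont : ∀ t, 0 < t → Continuous (κ t)
  cont_time : ∀ x, ContinuousOn (fun t ↦ κ t x) (Set.Ioi 0)
  bound : ∃ A c : ℝ, 0 ≤ A ∧ 0 < c ∧
    ∀ t, 0 < t → ∀ x, ‖κ t x‖ ≤ A * t ^ (-(β + 3 / 2)) * Real.exp (-(c / t) * ‖x‖ ^ 2)

namespace HeatFamily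

variable {β : ℝ} {κ : ℝ → R3 → ℂ}

theorem goodKernel (h : HeatFamily β κ) {t : ℝ} (ht : 0 < t) : GoodKernel (κ t) := by
  obtain ⟨A, c, hA, hc, hb⟩ := h.bound
  refine ⟨h.cont t ht, ?_, (A * t ^ (-(β + 3 / 2))).toNNReal, fun x ↦ ?_⟩
  · refine Integrable.mono' ((integrable_exp_neg_mul_sq_norm (div_pos hc ht)).const_mul _)
      (h.cont t ht).aestronglyMeasurable (.of_forall (hb t ht))
  · rw [← ofReal_norm]
    refine ENNReal.ofReal_le_ofReal ((hb t ht x).trans (mul_le_of_le_one_right (by positivity) ?_))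
    rw [Real.exp_le_one_iff]
    have : 0 ≤ c / t * ‖x‖ ^ 2 := by positivity
    linarith

theorem exists_bounds (h : HeatFamily β κ) : ∃ A : ℝ, 0 ≤ A ∧ ∀ t, 0 < t →
    (∀ x, ‖κ t x‖ₑ ≤ ENNReal.ofReal (A * t ^ (-(β + 3 / 2)))) ∧
      ∫⁻ x, ‖κ t x‖ₑ ≤ ENNReal.ofReal (A * t ^ (-β)) := by
  obtain ⟨A, c, hA, hc, hb⟩ := h.bound
  refine ⟨max A (A * (Real.pi / c) ^ (3 / 2 : ℝ)), by positivity, fun t ht ↦ ⟨fun x ↦ ?_, ?_⟩⟩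
  · rw [← ofReal_norm]
    refine ENNReal.ofReal_le_ofReal ((hb t ht x).trans ?_)
    calc A * t ^ (-(β + 3 / 2)) * Real.exp (-(c / t) * ‖x‖ ^ 2) ≤ A * t ^ (-(β + 3 / 2)) * 1 := by
          gcongr
          rw [Real.exp_le_one_iff]
          have : 0 ≤ c / t * ‖x‖ ^ 2 := by positivity
          linarith
      _ ≤ _ := by
          rw [mul_one]
          gcongr
          exact le_max_left _ _
  · have hi := (integrable_exp_neg_mul_sq_norm (div_pos hc ht)).const_mul (A * t ^ (-(β + 3 / 2)))
    calc ∫⁻ x, ‖κ t x‖ₑ ≤ ∫⁻ x, ENNReal.ofReal (A * t ^ (-(β + 3 / 2)) *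
          Real.exp (-(c / t) * ‖x‖ ^ 2)) := by
          gcongr with x
          rw [← ofReal_norm]
          exact ENNReal.ofReal_le_ofReal (hb t ht x)
      _ = ENNReal.ofReal (A * t ^ (-(β + 3 / 2)) * (Real.pi / (c / t)) ^ (3 / 2 : ℝ)) := by
          rw [← ofReal_integral_eq_lintegral_ofReal hi (.of_forall fun x ↦ by positivity),
            integral_const_mul, GaussianFourier.integral_rexp_neg_mul_sq_norm (div_pos hc ht)]
          simp
      _ = ENNReal.ofReal (A * (Real.pi / c) ^ (3 / 2 : ℝ) * t ^ (-β)) := by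
          congr 1
          rw [show Real.pi / (c / t) = Real.pi / c * t by field_simp,
            Real.mul_rpow (by positivity) ht.le, neg_add, Real.rpow_add ht, Real.rpow_neg ht.le (3/2)]
          have : t ^ (3 / 2 : ℝ) ≠ 0 := by positivity
          field_simp
      _ ≤ _ := by
          gcongr
          exact le_max_right _ _

variable {p r : ℝ≥0∞} [Fact (1 ≤ p)] [Fact (1 ≤ r)]

/-- Heat smoothing. -/
theorem exists_enorm_convOp_le (h : HeatFamily β κ) (hpr : p ≤ r) (hr : r ≠ ∞) :
    ∃ A : ℝ≥0, ∀ t, 0 < t → ∀ f : Lp ℂ p (volume : Measure R3),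
      ‖convOp p r (κ t) f‖ₑ ≤
        A * ENNReal.ofReal (t ^ (-(β + 3 / 2 * expGap p r))) * ‖f‖ₑ := by
  obtain ⟨A, hA, hb⟩ := h.exists_bounds
  refine ⟨A.toNNReal, fun t ht f ↦ ?_⟩
  have h0 := expGap_nonneg Fact.out hpr hr
  have h1 := expGap_lt_one Fact.out hpr hr
  set δ := expGap p r
  -- Young's inequality interpolates between t^(-β) in L¹ and t^(-β-3/2) in L^∞, with weight δ on
  -- the latter.
  refine ((h.goodKernel ht).enorm_convOp_le hpr hr f (hb t ht).1).trans (mul_le_mul_left ?_ _)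
  calc _ ≤ ENNReal.ofReal (A * t ^ (-β)) ^ (1 - δ) *
        ENNReal.ofReal (A * t ^ (-(β + 3 / 2))) ^ δ := by
        gcongr
        exact (hb t ht).2
    _ = ENNReal.ofReal (A * t ^ (-(β + 3 / 2 * δ))) := by
        rw [ENNReal.ofReal_rpow_of_nonneg (by positivity) (by linarith),
          ENNReal.ofReal_rpow_of_nonneg (by positivity) h0, ← ENNReal.ofReal_mul (by positivity),
          Real.mul_rpow hA (by positivity), Real.mul_rpow hA (by positivity),
          ← Real.rpow_mul ht.le, ← Real.rpow_mul ht.le]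
        congr 1
        rw [mul_mul_mul_comm, ← Real.rpow_add_of_nonneg hA (by linarith) h0, ← Real.rpow_add ht]
        rw [sub_add_cancel, Real.rpow_one]
        congr 2
        ring
    _ = _ := by rw [ENNReal.ofReal_mul hA]; rfl

open Filter Topology in
-- Dominated convergence: for t between t₀/2 and 2t₀ a single Gaussian dominates all the kernels.
theorem tendsto_lintegral_sub (h : HeatFamily β κ) {t₀ : ℝ} (ht₀ : 0 < t₀) :
    Tendsto (fun t ↦ ∫⁻ x, ‖κ t x - κ t₀ x‖ₑ) (𝓝 t₀) (𝓝 0) := by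
  obtain ⟨A, c, hA, hc, hb⟩ := h.bound
  have hβ := h.nonneg
  set g : R3 → ℝ := fun x ↦ A * (t₀ / 2) ^ (-(β + 3 / 2)) * Real.exp (-(c / (2 * t₀)) * ‖x‖ ^ 2)
  have hgi : Integrable g := (integrable_exp_neg_mul_sq_norm (by positivity)).const_mul _
  have hnear : ∀ t, t₀ / 2 < t → t < 2 * t₀ → ∀ x, ‖κ t x‖ ≤ g x := by
    intro t h1 h2 x
    have ht : 0 < t := by linarith
    refine (hb t ht x).trans ?_
    simp only [g]
    have e1 : t ^ (-(β + 3 / 2)) ≤ (t₀ / 2) ^ (-(β + 3 / 2)) :=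
      Real.rpow_le_rpow_of_nonpos (by positivity) h1.le (by linarith)
    have e2 : c / (2 * t₀) ≤ c / t := by gcongr
    gcongr
  have hev : ∀ᶠ t in 𝓝 t₀, t₀ / 2 < t ∧ t < 2 * t₀ :=
    (lt_mem_nhds (by linarith)).and (gt_mem_nhds (by linarith))
  have hlim := tendsto_lintegral_filter_of_dominated_convergence (μ := (volume : Measure R3))
    (l := 𝓝 t₀) (F := fun t x ↦ ‖κ t x - κ t₀ x‖ₑ) (f := fun _ ↦ 0)
    (fun x ↦ ENNReal.ofReal (g x) + ENNReal.ofReal (g x)) ?_ ?_ ?_ ?_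
  · simpa using hlim
  · filter_upwards [hev] with t ht
    have := h.cont t (by linarith)
    have := h.cont t₀ ht₀
    fun_prop
  · filter_upwards [hev] with t ht
    refine .of_forall fun x ↦ enorm_sub_le.trans (add_le_add ?_ ?_)
    · rw [← ofReal_norm]
      exact ENNReal.ofReal_le_ofReal (hnear t ht.1 ht.2 x)
    · rw [← ofReal_norm]
      exact ENNReal.ofReal_le_ofReal (hnear t₀ (by linarith) (by linarith) x)
  · have hfin : ∫⁻ x, ENNReal.ofReal (g x) < ∞ := hgi.lintegral_lt_top
    rw [lintegral_add_left (by fun_prop)]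
    exact (ENNReal.add_lt_top.2 ⟨hfin, hfin⟩).ne
  · refine .of_forall fun x ↦ ?_
    have h1 : ContinuousAt (fun t ↦ κ t x) t₀ := (h.cont_time x).continuousAt (Ioi_mem_nhds ht₀)
    have h2 : Tendsto (fun t ↦ κ t x - κ t₀ x) (𝓝 t₀) (𝓝 0) := by
      simpa using h1.tendsto.sub_const (κ t₀ x)
    simpa using h2.enorm

open Filter Topology in
-- In Young's inequality the L¹ norm of the difference appears with the exponent 1 - `expGap p r`,
-- which is positive because r is finite, while the sup norms stay bounded near t₀. The continuity
-- is in operator norm, which makes joint measurability with a source immediate.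
theorem continuousOn_convOp (h : HeatFamily β κ) (hpr : p ≤ r) (hr : r ≠ ∞) :
    ContinuousOn (fun t ↦ convOp p r (κ t)) (Set.Ioi 0) := by
  intro t₀ ht₀
  refine ContinuousAt.continuousWithinAt ?_
  have ht₀' : 0 < t₀ := ht₀
  obtain ⟨A, hA, hb⟩ := h.exists_bounds
  have hβ := h.nonneg
  have hδ0 := expGap_nonneg (p := p) Fact.out hpr hr
  have hδ1 := expGap_lt_one (p := p) Fact.out hpr hr
  set B : ℝ≥0∞ := ENNReal.ofReal (A * (t₀ / 2) ^ (-(β + 3 / 2))) +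
    ENNReal.ofReal (A * t₀ ^ (-(β + 3 / 2)))
  have hBt : B ≠ ∞ := by simp [B]
  set E : ℝ → ℝ≥0∞ := fun t ↦ (∫⁻ x, ‖κ t x - κ t₀ x‖ₑ) ^ (1 - expGap p r) * B ^ expGap p r
  have hE : Tendsto E (𝓝 t₀) (𝓝 0) := by
    have h1 := ((h.tendsto_lintegral_sub ht₀').ennrpow_const (1 - expGap p r))
    rw [ENNReal.zero_rpow_of_pos (by linarith)] at h1
    have := ENNReal.Tendsto.mul_const h1
      (Or.inr (ENNReal.rpow_ne_top_of_nonneg hδ0 hBt) : (0 : ℝ≥0∞) ≠ 0 ∨ B ^ expGap p r ≠ ∞)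
    simpa using this
  have hEr : Tendsto (fun t ↦ (E t).toReal) (𝓝 t₀) (𝓝 0) := by
    simpa [Function.comp_def] using (ENNReal.tendsto_toReal ENNReal.zero_ne_top).comp hE
  rw [ContinuousAt, tendsto_iff_norm_sub_tendsto_zero]
  refine squeeze_zero' (.of_forall fun _ ↦ norm_nonneg _) ?_ hEr
  have hfin : ∀ᶠ t in 𝓝 t₀, E t < 1 := hE.eventually_lt_const one_pos
  filter_upwards [hfin, lt_mem_nhds (show t₀ / 2 < t₀ by linarith)] with t hEt ht
  have ht' : 0 < t := by linarith
  rw [← (h.goodKernel ht').convOp_sub (h.goodKernel ht₀') hpr hr]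
  refine ContinuousLinearMap.opNorm_le_bound _ ENNReal.toReal_nonneg fun f ↦ ?_
  have hB : ∀ x, ‖(κ t - κ t₀) x‖ₑ ≤ B := fun x ↦ by
    refine enorm_sub_le.trans (add_le_add (((hb t ht').1 x).trans ?_) ((hb t₀ ht₀').1 x))
    refine ENNReal.ofReal_le_ofReal ?_
    gcongr ?_ * ?_
    exact Real.rpow_le_rpow_of_nonpos (by positivity) ht.le (by linarith)
  have := ((h.goodKernel ht').sub (h.goodKernel ht₀')).enorm_convOp_le hpr hr f hB
  have h3 := ENNReal.toReal_mono (ENNReal.mul_ne_top (hEt.trans ENNReal.one_lt_top).ne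
    enorm_ne_top) this
  simpa [ENNReal.toReal_mul, E] using h3

theorem aestronglyMeasurable_convOp (h : HeatFamily β κ) (hpr : p ≤ r) (hr : r ≠ ∞)
    {α : Type*} [MeasurableSpace α] {μ : Measure α} {g : α → ℝ} (hg : Measurable g)
    (hpos : ∀ᵐ a ∂μ, 0 < g a) {F : α → Lp ℂ p (volume : Measure R3)}
    (hF : AEStronglyMeasurable F μ) :
    AEStronglyMeasurable (fun a ↦ convOp p r (κ (g a)) (F a)) μ := by
  have h1 := ((h.continuousOn_convOp (p := p) hpr hr).stronglyMeasurable_indicator_of_real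
    measurableSet_Ioi).comp_measurable hg
  have h2 : AEStronglyMeasurable (fun a ↦ convOp p r (κ (g a))) μ := by
    refine h1.aestronglyMeasurable.congr ?_
    filter_upwards [hpos] with a ha
    simp [Set.indicator, ha]
  exact ContinuousLinearMap.aestronglyMeasurable_comp₂ (ContinuousLinearMap.id ℂ _) h2 hF

end HeatFamily

/-- The Gaussian rate Re(1/(4ω)) degenerates as Re ω → 0. This is one way in which constants of the
inhomogeneous estimates come to depend on ε. -/
theorem heatFamily_heatKernel {ω : ℂ} (hω : 0 < ω.re) :
    HeatFamily 0 (fun t ↦ heatKernel (t * ω)) := by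
  have hω0 : ω ≠ 0 := by rintro rfl; simp at hω
  refine ⟨le_rfl, fun t _ ↦ continuous_heatKernel _, fun x ↦ ?_, ‖ω‖ ^ (-(3 / 2) : ℝ),
    (1 / (4 * ω)).re, by positivity, re_inv_four_mul_pos hω, fun t ht x ↦ ?_⟩
  · unfold heatKernel
    refine ContinuousOn.mul ?_ ?_
    · intro t ht
      have ht' : 0 < t := ht
      refine ContinuousAt.continuousWithinAt ?_
      have hre : 0 < (1 / (4 * Real.pi * (t * ω))).re := by
        rw [show 1 / (4 * Real.pi * (t * ω)) = (((Real.pi * t)⁻¹ : ℝ) : ℂ) * (1 / (4 * ω)) by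
          push_cast; field_simp, Complex.re_ofReal_mul]
        have := re_inv_four_mul_pos hω
        positivity
      refine ContinuousAt.cpow ?_ continuousAt_const (Or.inl hre)
      refine ContinuousAt.div continuousAt_const (by fun_prop) ?_
      have : (t : ℂ) ≠ 0 := by exact_mod_cast ht'.ne'
      simp [hω0, this]
    · refine ContinuousOn.cexp (ContinuousOn.div continuousOn_const (by fun_prop) fun t ht ↦ ?_)
      have : (t : ℂ) ≠ 0 := by exact_mod_cast (show (0 : ℝ) < t from ht).ne'
      simp [hω0, this]
  · have hz : 0 < ((t : ℂ) * ω).re := by rw [Complex.re_ofReal_mul]; positivity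
    refine (norm_heatKernel_le hz x).trans (le_of_eq ?_)
    rw [norm_mul, Complex.norm_real, Real.norm_of_nonneg ht.le, Real.mul_rpow ht.le (norm_nonneg _)]
    congr 1
    · rw [mul_comm]; norm_num
    · congr 1
      rw [show 1 / (4 * (t * ω)) = ((t⁻¹ : ℝ) : ℂ) * (1 / (4 * ω)) by push_cast; field_simp,
        Complex.re_ofReal_mul]
      ring

/-- The factor |x|/t equals t^(-1/2) times y = |x|/√t, and y is absorbed by giving up half of the
Gaussian rate. -/
theorem heatFamily_heatKernelDeriv (j : Fin 3) {ω : ℂ} (hω : 0 < ω.re) :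
    HeatFamily (1 / 2) (fun t ↦ heatKernelDeriv j (t * ω)) := by
  have hω0 : ω ≠ 0 := by rintro rfl; simp at hω
  have H := heatFamily_heatKernel hω
  obtain ⟨A, c, hA, hc, hb⟩ := H.bound
  refine ⟨by norm_num, fun t _ ↦ continuous_heatKernelDeriv j _, fun x ↦ ?_,
    A * (1 + 1 / c) * ‖ω‖⁻¹, c / 2, by positivity, by positivity, fun t ht x ↦ ?_⟩
  · unfold heatKernelDeriv
    refine ContinuousOn.mul (ContinuousOn.div continuousOn_const (by fun_prop) fun t ht ↦ ?_)
      (H.cont_time x)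
    have : (t : ℂ) ≠ 0 := by exact_mod_cast (show (0 : ℝ) < t from ht).ne'
    simp [hω0, this]
  · have hx : |x j| ≤ ‖x‖ := by
      have := EuclideanSpace.norm_eq x
      rw [this]
      refine Real.le_sqrt_of_sq_le ?_
      have := Finset.single_le_sum (f := fun i ↦ ‖x i‖ ^ 2) (fun i _ ↦ by positivity)
        (Finset.mem_univ j)
      simpa using this
    set y := ‖x‖ / √t with hy
    have hst : 0 < √t := Real.sqrt_pos.2 ht
    have hyt : ‖x‖ ^ 2 / t = y ^ 2 := by rw [hy, div_pow, Real.sq_sqrt ht.le]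
    -- The bound y exp(-c y²/2) ≤ 1 + 1/c follows from exp(u) ≥ 1 + u.
    have key : y * Real.exp (-(c * y ^ 2)) ≤ (1 + 1 / c) * Real.exp (-(c / 2 * y ^ 2)) := by
      have e1 : Real.exp (-(c * y ^ 2)) = Real.exp (-(c / 2 * y ^ 2)) * Real.exp (-(c / 2 * y ^ 2)) := by
        rw [← Real.exp_add]; congr 1; ring
      have e2 : y * Real.exp (-(c / 2 * y ^ 2)) ≤ 1 + 1 / c := by
        rw [Real.exp_neg, ← div_eq_mul_inv, div_le_iff₀ (Real.exp_pos _)]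
        have := Real.add_one_le_exp (c / 2 * y ^ 2)
        calc y ≤ (1 + 1 / c) * (c / 2 * y ^ 2 + 1) := by
              have : (1 + 1 / c) * (c / 2 * y ^ 2 + 1) = (c / 2 * y ^ 2) + 1 + y ^ 2 / 2 + 1 / c := by
                field_simp; ring
              rw [this]
              have h1 : 0 ≤ c / 2 * y ^ 2 := by positivity
              have h2 : 0 < 1 / c := by positivity
              nlinarith [sq_nonneg (y - 1)]
          _ ≤ _ := by gcongr
      rw [e1, ← mul_assoc]
      gcongr
    unfold heatKernelDeriv
    rw [norm_mul, norm_div, norm_neg, Complex.norm_real, norm_mul, norm_mul, Complex.norm_real,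
      Real.norm_of_nonneg ht.le, Real.norm_eq_abs, Complex.norm_ofNat]
    have hB := hb t ht x
    rw [zero_add] at hB
    have e3 : -(c / t) * ‖x‖ ^ 2 = -(c * y ^ 2) := by rw [← hyt]; ring
    have e4 : -(c / 2 / t) * ‖x‖ ^ 2 = -(c / 2 * y ^ 2) := by rw [← hyt]; ring
    rw [e3] at hB
    rw [e4]
    have e5 : ‖x‖ = y * √t := by rw [hy]; field_simp
    have e6 : t ^ (-(1 / 2 + 3 / 2) : ℝ) = t ^ (-(3 / 2) : ℝ) * (√t / t) := by
      rw [Real.sqrt_div_self, Real.sqrt_eq_rpow, ← Real.rpow_neg ht.le, ← Real.rpow_add ht]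
      norm_num
    calc |x j| / (2 * (t * ‖ω‖)) * ‖heatKernel (t * ω) x‖
        ≤ ‖x‖ / (1 * (t * ‖ω‖)) * (A * t ^ (-(3 / 2) : ℝ) * Real.exp (-(c * y ^ 2))) := by
          gcongr
          norm_num
      _ = A * t ^ (-(3 / 2) : ℝ) * (√t / t) * ‖ω‖⁻¹ * (y * Real.exp (-(c * y ^ 2))) := by
          rw [e5]; field_simp
      _ ≤ A * t ^ (-(3 / 2) : ℝ) * (√t / t) * ‖ω‖⁻¹ *
          ((1 + 1 / c) * Real.exp (-(c / 2 * y ^ 2))) := by gcongr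
      _ = _ := by rw [e6]; ring

/-! ### Splitting a complex number into dyadic shells -/

section Shell

/-- The radial retraction of `ℂ` onto the disc of radius `L`. -/
noncomputable def radialProj (L : ℝ) (z : ℂ) : ℂ := ((min L ‖z‖ / ‖z‖ : ℝ) : ℂ) * z

theorem norm_radialProj {L : ℝ} (hL : 0 < L) (z : ℂ) : ‖radialProj L z‖ = min L ‖z‖ := by
  rw [radialProj, norm_mul, Complex.norm_real, Real.norm_of_nonneg (by positivity)]
  by_cases h : z = 0
  · simp [h, hL.le]
  · have : ‖z‖ ≠ 0 := norm_ne_zero_iff.2 h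
    field_simp

/-- A Lipschitz cutoff, rather than an indicator of level sets, acts continuously on L²; the shells
of a measurable L²-valued function are then measurable in time. -/
theorem norm_radialProj_sub_le {L : ℝ} (hL : 0 < L) (z w : ℂ) :
    ‖radialProj L z - radialProj L w‖ ≤ 3 * ‖z - w‖ := by
  by_cases hz : z = 0
  · have h1 : radialProj L z = 0 := by simp [radialProj, hz]
    rw [h1, hz, zero_sub, zero_sub, norm_neg, norm_neg, norm_radialProj hL]
    linarith [min_le_right L ‖w‖, norm_nonneg w]
  by_cases hw : w = 0
  · have h1 : radialProj L w = 0 := by simp [radialProj, hw]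
    rw [h1, hw, sub_zero, sub_zero, norm_radialProj hL]
    linarith [min_le_right L ‖z‖, norm_nonneg z]
  have hz' : 0 < ‖z‖ := norm_pos_iff.2 hz
  have hw' : 0 < ‖w‖ := norm_pos_iff.2 hw
  -- Three successive changes: of the vector, of its normalisation and of the truncated length. Each
  -- costs at most ‖z - w‖.
  have e : radialProj L z - radialProj L w =
      ((min L ‖z‖ / ‖z‖ : ℝ) : ℂ) * ((z - w) + (((‖w‖ - ‖z‖) / ‖w‖ : ℝ) : ℂ) * w) +
        (((min L ‖z‖ - min L ‖w‖) / ‖w‖ : ℝ) : ℂ) * w := by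
    have h1 : (‖z‖ : ℂ) ≠ 0 := by exact_mod_cast hz'.ne'
    have h2 : (‖w‖ : ℂ) ≠ 0 := by exact_mod_cast hw'.ne'
    rw [radialProj, radialProj]
    push_cast
    field_simp
    ring
  have a1 : |‖w‖ - ‖z‖| ≤ ‖z - w‖ := by
    rw [abs_sub_comm]; exact abs_norm_sub_norm_le z w
  have a2 : |min L ‖z‖ - min L ‖w‖| ≤ ‖z - w‖ := by
    refine le_trans ?_ (abs_norm_sub_norm_le z w)
    have := abs_min_sub_min_le_max L ‖z‖ L ‖w‖
    simpa using this
  have b1 : min L ‖z‖ / ‖z‖ ≤ 1 := by rw [div_le_one hz']; exact min_le_right _ _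
  rw [e]
  refine (norm_add_le _ _).trans ?_
  rw [norm_mul, norm_mul, Complex.norm_real, Complex.norm_real,
    Real.norm_of_nonneg (by positivity : 0 ≤ min L ‖z‖ / ‖z‖), Real.norm_eq_abs, abs_div,
    abs_of_pos hw', div_mul_cancel₀ _ hw'.ne']
  have b2 : ‖(z - w) + (((‖w‖ - ‖z‖) / ‖w‖ : ℝ) : ℂ) * w‖ ≤ 2 * ‖z - w‖ := by
    refine (norm_add_le _ _).trans ?_
    rw [norm_mul, Complex.norm_real, Real.norm_eq_abs, abs_div, abs_of_pos hw',
      div_mul_cancel₀ _ hw'.ne']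
    linarith
  calc _ ≤ 1 * (2 * ‖z - w‖) + ‖z - w‖ := by gcongr
    _ = _ := by ring

/-- The part of `z` in the shell between the radii `L` and `4 L`. -/
noncomputable def shell (L : ℝ) (z : ℂ) : ℂ := radialProj (4 * L) z - radialProj L z

theorem shell_zero (L : ℝ) : shell L 0 = 0 := by simp [shell, radialProj]

theorem lipschitzWith_shell {L : ℝ} (hL : 0 < L) : LipschitzWith 6 (shell L) := by
  refine LipschitzWith.of_dist_le_mul fun z w ↦ ?_
  rw [dist_eq_norm, dist_eq_norm]
  have h1 := norm_radialProj_sub_le (L := 4 * L) (by positivity) z w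
  have h2 := norm_radialProj_sub_le hL z w
  have e : shell L z - shell L w = (radialProj (4 * L) z - radialProj (4 * L) w) -
      (radialProj L z - radialProj L w) := by simp only [shell]; ring
  rw [e]
  refine (norm_sub_le _ _).trans ?_
  push_cast
  linarith

/-- The modulus of `shell L z` in terms of that of `z`. -/
noncomputable def shellSize (L ρ : ℝ) : ℝ := min (4 * L) ρ - min L ρ

theorem shell_eq {L : ℝ} (z : ℂ) : shell L z = ((shellSize L ‖z‖ / ‖z‖ : ℝ) : ℂ) * z := by
  rw [shell, radialProj, radialProj, shellSize, ← sub_mul]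
  push_cast
  ring

theorem shellSize_nonneg {L : ℝ} (hL : 0 < L) (ρ : ℝ) : 0 ≤ shellSize L ρ := by
  rw [shellSize, sub_nonneg]
  exact min_le_min_right _ (by linarith)

theorem norm_shell {L : ℝ} (hL : 0 < L) (z : ℂ) : ‖shell L z‖ = shellSize L ‖z‖ := by
  rw [shell_eq, norm_mul, Complex.norm_real,
    Real.norm_of_nonneg (div_nonneg (shellSize_nonneg hL _) (norm_nonneg _))]
  by_cases h : z = 0
  · simp [h, shellSize, hL.le]
  · have : ‖z‖ ≠ 0 := norm_ne_zero_iff.2 h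
    field_simp

/-- The shell is a nonnegative multiple of z, so this pairing has no phase. Positivity of the dual
pairing rests on this. -/
theorem inner_shell_mul (L A : ℝ) (z : ℂ) :
    inner ℂ (shell L z) ((A : ℂ) * z) = ((A * (shellSize L ‖z‖ * ‖z‖) : ℝ) : ℂ) := by
  rw [shell_eq, RCLike.inner_apply, map_mul, Complex.conj_ofReal]
  by_cases h : z = 0
  · simp [h]
  · have h1 : (‖z‖ : ℂ) ≠ 0 := by exact_mod_cast norm_ne_zero_iff.2 h
    have h2 : (starRingEnd ℂ) z * z = (‖z‖ : ℂ) ^ 2 := Complex.conj_mul' z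
    push_cast
    calc _ = (A : ℂ) * ((shellSize L ‖z‖ : ℂ) / ‖z‖) * ((starRingEnd ℂ) z * z) := by ring
      _ = _ := by rw [h2]; field_simp

theorem shellSize_of_le {L ρ : ℝ} (hL : 0 < L) (h : ρ ≤ L) : shellSize L ρ = 0 := by
  rw [shellSize, min_eq_right h, min_eq_right (by linarith), sub_self]

theorem shellSize_of_ge {L ρ : ℝ} (hL : 0 < L) (h : 4 * L ≤ ρ) : shellSize L ρ = 3 * L := by
  rw [shellSize, min_eq_left h, min_eq_left (by linarith)]; ring

theorem shellSize_le {L ρ : ℝ} (hL : 0 < L) : shellSize L ρ ≤ 3 * L := by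
  rw [shellSize]
  rcases le_total ρ L with h | h
  · rw [min_eq_right h, min_eq_right (by linarith)]; linarith
  · rw [min_eq_left h]; linarith [min_le_left (4 * L) ρ]

theorem shellSize_le_self {L ρ : ℝ} (hL : 0 < L) (hρ : 0 ≤ ρ) : shellSize L ρ ≤ ρ := by
  rw [shellSize]
  linarith [min_le_right (4 * L) ρ, le_min hL.le hρ]

/-- Where the next shell is nonzero, ρ exceeds 4L and the present shell is saturated at 3L, against
at most 12L for the next. -/
theorem shellSize_four_mul_le {L ρ : ℝ} (hL : 0 < L) :
    shellSize (4 * L) ρ ≤ 4 * shellSize L ρ := by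
  rcases le_total ρ (4 * L) with h | h
  · rw [shellSize_of_le (by positivity) h]
    linarith [shellSize_nonneg hL ρ]
  · rw [shellSize_of_ge hL h]
    linarith [shellSize_le (ρ := ρ) (L := 4 * L) (by positivity)]

/-- Saturation again: 4L · 12L = (16/3)(3L)². Thus the L¹ norm of a shell is controlled by the
square of the L² norm of the preceding one. -/
theorem mul_shellSize_four_mul_le {L ρ : ℝ} (hL : 0 < L) :
    (4 * L) * shellSize (4 * L) ρ ≤ 16 / 3 * shellSize L ρ ^ 2 := by
  rcases le_total ρ (4 * L) with h | h
  · rw [shellSize_of_le (by positivity) h, mul_zero]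
    positivity
  · rw [shellSize_of_ge hL h]
    have := shellSize_le (ρ := ρ) (L := 4 * L) (by positivity)
    nlinarith

/-- The bound is a difference of sixth powers of truncations, which telescopes over L = 4^k and sums
to at most ρ⁶. -/
theorem pow_mul_shellSize_sq_le {L ρ : ℝ} (hL : 0 < L) :
    L ^ 4 * shellSize L ρ ^ 2 ≤ min (4 * L) ρ ^ 6 - min L ρ ^ 6 := by
  rcases le_total ρ L with h | h
  · rw [shellSize_of_le hL h, min_eq_right h, min_eq_right (by linarith)]; simp
  · rw [shellSize, min_eq_left h]
    set b := min (4 * L) ρ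
    have hb : L ≤ b := le_min (by linarith) h
    have h1 : L ^ 4 ≤ b ^ 4 := by gcongr
    have h2 : L ^ 4 * (b - L) ^ 2 ≤ L ^ 4 * (b ^ 2 - L ^ 2) := by
      gcongr
      nlinarith
    nlinarith [mul_le_mul_of_nonneg_right h1 (sq_nonneg b)]

theorem pow_mul_shellSize_sq_le' {L ρ : ℝ} (hL : 0 < L) (hρ : 0 ≤ ρ) :
    L ^ 4 * shellSize L ρ ^ 2 ≤ ρ ^ 6 := by
  refine (pow_mul_shellSize_sq_le hL).trans ?_
  have h1 : min (4 * L) ρ ^ 6 ≤ ρ ^ 6 := by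
    gcongr
    exact min_le_right _ _
  have : 0 ≤ min L ρ ^ 6 := by positivity
  linarith

theorem Monotone.sum_int_sub_le {g : ℤ → ℝ} (hg : Monotone g) {M : ℝ} (h0 : ∀ k, 0 ≤ g k)
    (hM : ∀ k, g k ≤ M) (S : Finset ℤ) : ∑ k ∈ S, (g k - g (k - 1)) ≤ M := by
  obtain ⟨a, ha⟩ := S.bddBelow
  obtain ⟨b, hb⟩ := S.bddAbove
  have hsub : S ⊆ (Finset.range (b - a + 1).toNat).image (fun i : ℕ ↦ a + (i : ℤ)) := by
    intro k hk
    have h1 : a ≤ k := ha hk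
    have h2 : k ≤ b := hb hk
    rw [Finset.mem_image]
    exact ⟨(k - a).toNat, by simp; omega, by simp; omega⟩
  have hnn : ∀ k, 0 ≤ g k - g (k - 1) := fun k ↦ sub_nonneg.2 (hg (by omega))
  refine (Finset.sum_le_sum_of_subset_of_nonneg hsub fun k _ _ ↦ hnn k).trans ?_
  rw [Finset.sum_image (by intro i _ j _ h; simpa using h)]
  have h3 : ∀ n : ℕ, ∑ i ∈ Finset.range n, (g (a + (i : ℤ)) - g (a + (i : ℤ) - 1)) =
      g (a + n - 1) - g (a - 1) := by
    intro n
    induction n with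
    | zero => simp
    | succ n ih =>
      rw [Finset.sum_range_succ, ih]
      have : a + ((n + 1 : ℕ) : ℤ) - 1 = a + n := by push_cast; ring
      rw [this]; ring
  rw [h3]
  linarith [hM (a + ((b - a + 1).toNat : ℤ) - 1), h0 (a - 1)]

theorem sum_pow_mul_shellSize_sq_le {ρ : ℝ} (hρ : 0 ≤ ρ) (S : Finset ℤ) :
    ∑ k ∈ S, ((4 : ℝ) ^ (k - 1)) ^ 4 * shellSize ((4 : ℝ) ^ (k - 1)) ρ ^ 2 ≤ ρ ^ 6 := by
  have hg : Monotone fun k : ℤ ↦ min ((4 : ℝ) ^ k) ρ ^ 6 := by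
    intro k l hkl
    have : (4 : ℝ) ^ k ≤ 4 ^ l := zpow_le_zpow_right₀ (by norm_num) hkl
    dsimp only
    gcongr
  refine le_trans (Finset.sum_le_sum fun k _ ↦ ?_)
    (hg.sum_int_sub_le (M := ρ ^ 6) (fun k ↦ by positivity) (fun k ↦ ?_) S)
  · have := pow_mul_shellSize_sq_le (L := (4 : ℝ) ^ (k - 1)) (ρ := ρ) (by positivity)
    rwa [show 4 * (4 : ℝ) ^ (k - 1) = 4 ^ k by
      rw [zpow_sub_one₀ (by norm_num)]; ring] at this
  · gcongr
    exact min_le_right _ _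

/-- One shell suffices: choose k with 4L ≤ ρ < 16L for L = 4^k. The shell is saturated at 3L and ρ⁵
≤ (16L)⁵, whence the constant 3/16⁵ = 3/4¹⁰. -/
theorem exists_le_pow_mul_shellSize {ρ : ℝ} (hρ : 0 < ρ) :
    ∃ k : ℤ, 3 / 4 ^ 10 * ρ ^ 6 ≤ ((4 : ℝ) ^ k) ^ 4 * (shellSize ((4 : ℝ) ^ k) ρ * ρ) := by
  obtain ⟨n, hn1, hn2⟩ := exists_mem_Ico_zpow hρ (by norm_num : (1 : ℝ) < 4)
  refine ⟨n - 1, ?_⟩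
  set L : ℝ := (4 : ℝ) ^ (n - 1) with hL
  have hL0 : 0 < L := by positivity
  have e1 : (4 : ℝ) ^ n = 4 * L := by
    rw [hL, zpow_sub_one₀ (by norm_num)]; ring
  have e2 : (4 : ℝ) ^ (n + 1) = 16 * L := by
    rw [zpow_add_one₀ (by norm_num), e1]; ring
  rw [e1] at hn1
  rw [e2] at hn2
  rw [shellSize_of_ge hL0 hn1]
  have : ρ ^ 5 ≤ (16 * L) ^ 5 := by gcongr
  calc 3 / 4 ^ 10 * ρ ^ 6 = 3 / 4 ^ 10 * ρ ^ 5 * ρ := by ring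
    _ ≤ 3 / 4 ^ 10 * (16 * L) ^ 5 * ρ := by gcongr
    _ = _ := by ring

end Shell

/-! ### Shells of functions in L² -/

section ShellEnorm

theorem enorm_shell {L : ℝ} (hL : 0 < L) (z : ℂ) :
    ‖shell L z‖ₑ = ENNReal.ofReal (shellSize L ‖z‖) := by
  rw [← ofReal_norm, norm_shell hL]

theorem enorm_shell_four_mul_le {L : ℝ} (hL : 0 < L) (z : ℂ) :
    ‖shell (4 * L) z‖ₑ ≤ 4 * ‖shell L z‖ₑ := by
  rw [enorm_shell hL, enorm_shell (by positivity), show (4 : ℝ≥0∞) = ENNReal.ofReal 4 by simp,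
    ← ENNReal.ofReal_mul (by norm_num)]
  exact ENNReal.ofReal_le_ofReal (shellSize_four_mul_le hL)

theorem mul_enorm_shell_four_mul_le {L : ℝ} (hL : 0 < L) (z : ℂ) :
    ENNReal.ofReal (4 * L) * ‖shell (4 * L) z‖ₑ ≤ 6 * ‖shell L z‖ₑ ^ 2 := by
  rw [enorm_shell hL, enorm_shell (by positivity), show (6 : ℝ≥0∞) = ENNReal.ofReal 6 by simp,
    ← ENNReal.ofReal_pow (shellSize_nonneg hL _), ← ENNReal.ofReal_mul (by positivity),
    ← ENNReal.ofReal_mul (by positivity)]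
  refine ENNReal.ofReal_le_ofReal ((mul_shellSize_four_mul_le hL).trans ?_)
  gcongr
  norm_num

theorem pow_mul_enorm_shell_sq_le {L : ℝ} (hL : 0 < L) (z : ℂ) :
    ENNReal.ofReal L ^ 4 * ‖shell L z‖ₑ ^ 2 ≤ ‖z‖ₑ ^ 6 := by
  rw [enorm_shell hL, ← ENNReal.ofReal_pow (shellSize_nonneg hL _), ← ENNReal.ofReal_pow hL.le,
    ← ENNReal.ofReal_mul (by positivity), ← ofReal_norm, ← ENNReal.ofReal_pow (norm_nonneg _)]
  exact ENNReal.ofReal_le_ofReal (pow_mul_shellSize_sq_le' hL (norm_nonneg z))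

theorem sum_pow_mul_enorm_shell_sq_le (z : ℂ) (S : Finset ℤ) :
    ∑ k ∈ S, ENNReal.ofReal ((4 : ℝ) ^ (k - 1)) ^ 4 * ‖shell ((4 : ℝ) ^ (k - 1)) z‖ₑ ^ 2 ≤
      ‖z‖ₑ ^ 6 := by
  have h := ENNReal.ofReal_le_ofReal (sum_pow_mul_shellSize_sq_le (norm_nonneg z) S)
  rw [ENNReal.ofReal_sum_of_nonneg fun k _ ↦ by positivity, ENNReal.ofReal_pow (norm_nonneg _),
    ofReal_norm] at h
  refine le_trans (le_of_eq (Finset.sum_congr rfl fun k _ ↦ ?_)) h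
  have hL : 0 < (4 : ℝ) ^ (k - 1) := by positivity
  rw [enorm_shell hL, ← ENNReal.ofReal_pow (shellSize_nonneg hL _), ← ENNReal.ofReal_pow hL.le,
    ← ENNReal.ofReal_mul (by positivity)]

theorem le_tsum_pow_mul_enorm_shell (z : ℂ) :
    ENNReal.ofReal (3 / 4 ^ 10) * ‖z‖ₑ ^ 6 ≤
      ∑' k : ℤ, ENNReal.ofReal ((4 : ℝ) ^ k) ^ 4 * (‖shell ((4 : ℝ) ^ k) z‖ₑ * ‖z‖ₑ) := by
  by_cases hz : z = 0
  · simp [hz]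
  obtain ⟨k, hk⟩ := exists_le_pow_mul_shellSize (norm_pos_iff.2 hz)
  have hL : 0 < (4 : ℝ) ^ k := by positivity
  refine le_trans ?_ (ENNReal.le_tsum k)
  rw [enorm_shell hL, ← ofReal_norm, ← ENNReal.ofReal_pow (norm_nonneg _),
    ← ENNReal.ofReal_mul (by positivity), ← ENNReal.ofReal_pow hL.le,
    ← ENNReal.ofReal_mul (shellSize_nonneg hL _), ← ENNReal.ofReal_mul (by positivity)]
  exact ENNReal.ofReal_le_ofReal hk

theorem enorm_sq_eq_lintegral (g : L2) : ‖g‖ₑ ^ 2 = ∫⁻ x, ‖g x‖ₑ ^ 2 := by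
  rw [Lp.enorm_def, ← lintegral_enorm_rpow_eq (by norm_num) (by norm_num), ← ENNReal.rpow_natCast,
    ← ENNReal.rpow_mul]
  simp

/-- The part of `v` with values of size about `4 ^ k`. -/
noncomputable def shellLp (k : ℤ) (v : L2) : L2 :=
  (lipschitzWith_shell (L := (4 : ℝ) ^ k) (by positivity)).compLp (shell_zero _) v

theorem coeFn_shellLp (k : ℤ) (v : L2) : shellLp k v =ᵐ[volume] fun x ↦ shell ((4 : ℝ) ^ k) (v x) :=
  LipschitzWith.coeFn_compLp _ _ _

theorem continuous_shellLp (k : ℤ) : Continuous (shellLp k) :=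
  (lipschitzWith_shell (L := (4 : ℝ) ^ k) (by positivity)).continuous_compLp (shell_zero _)

theorem measurable_enorm_shell_comp (k : ℤ) (v : L2) :
    Measurable fun x ↦ ‖shell ((4 : ℝ) ^ k) (v x)‖ₑ :=
  ((lipschitzWith_shell (L := (4 : ℝ) ^ k) (by positivity)).continuous.measurable.comp
    (Lp.stronglyMeasurable v).measurable).enorm

theorem measurable_enorm_shell_mul (k : ℤ) (v : L2) :
    Measurable fun x ↦ ‖shell ((4 : ℝ) ^ k) (v x)‖ₑ * ‖v x‖ₑ :=
  (measurable_enorm_shell_comp k v).mul (Lp.stronglyMeasurable v).measurable.enorm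

theorem norm_shellLp_le (k : ℤ) (v : L2) : ‖shellLp k v‖ ≤ 6 * ‖v‖ :=
  LipschitzWith.norm_compLp_le _ _ _

theorem enorm_shellLp_sq (k : ℤ) (v : L2) :
    ‖shellLp k v‖ₑ ^ 2 = ∫⁻ x, ‖shell ((4 : ℝ) ^ k) (v x)‖ₑ ^ 2 := by
  rw [enorm_sq_eq_lintegral]
  refine lintegral_congr_ae ?_
  filter_upwards [coeFn_shellLp k v] with x hx
  rw [hx]

theorem four_zpow_eq (k : ℤ) : (4 : ℝ) ^ k = 4 * (4 : ℝ) ^ (k - 1) := by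
  rw [zpow_sub_one₀ (by norm_num)]; ring

theorem enorm_shellLp_le (k : ℤ) (v : L2) : ‖shellLp k v‖ₑ ≤ 4 * ‖shellLp (k - 1) v‖ₑ := by
  have h : ‖shellLp k v‖ₑ ^ 2 ≤ (4 * ‖shellLp (k - 1) v‖ₑ) ^ 2 := by
    rw [mul_pow, enorm_shellLp_sq, enorm_shellLp_sq,
      ← lintegral_const_mul _ ((measurable_enorm_shell_comp _ v).pow_const 2)]
    refine lintegral_mono fun x ↦ ?_
    dsimp only
    rw [← mul_pow, four_zpow_eq k]
    gcongr
    exact enorm_shell_four_mul_le (by positivity) _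
  exact (ENNReal.pow_le_pow_left_iff two_ne_zero).1 h

theorem mul_lintegral_enorm_shellLp_le (k : ℤ) (v : L2) :
    ENNReal.ofReal (4 ^ k) * ∫⁻ x, ‖shellLp k v x‖ₑ ≤ 6 * ‖shellLp (k - 1) v‖ₑ ^ 2 := by
  have e : ∫⁻ x, ‖shellLp k v x‖ₑ = ∫⁻ x, ‖shell ((4 : ℝ) ^ k) (v x)‖ₑ := by
    refine lintegral_congr_ae ?_
    filter_upwards [coeFn_shellLp k v] with x hx
    rw [hx]
  rw [e, enorm_shellLp_sq, ← lintegral_const_mul _ (measurable_enorm_shell_comp k v),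
    ← lintegral_const_mul _ ((measurable_enorm_shell_comp _ v).pow_const 2)]
  refine lintegral_mono fun x ↦ ?_
  dsimp only
  rw [four_zpow_eq k]
  exact mul_enorm_shell_four_mul_le (by positivity) _

/-- A Chebyshev bound from the L⁶ normalisation. The constant 16 = 4² comes from expressing 4^k
through 4^(k-1). -/
theorem pow_mul_enorm_shellLp_le (k : ℤ) {v : L2} (hv : ∫⁻ x, ‖v x‖ₑ ^ 6 ≤ 1) :
    ENNReal.ofReal (4 ^ k) ^ 2 * ‖shellLp (k - 1) v‖ₑ ≤ 16 := by
  have h : ENNReal.ofReal (4 ^ (k - 1)) ^ 2 * ‖shellLp (k - 1) v‖ₑ ≤ 1 := by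
    have h2 : (ENNReal.ofReal (4 ^ (k - 1)) ^ 2 * ‖shellLp (k - 1) v‖ₑ) ^ 2 ≤ 1 ^ 2 := by
      rw [mul_pow, ← pow_mul, enorm_shellLp_sq, one_pow,
        ← lintegral_const_mul _ ((measurable_enorm_shell_comp _ v).pow_const 2)]
      exact (lintegral_mono fun x ↦ pow_mul_enorm_shell_sq_le (by positivity) _).trans hv
    exact (ENNReal.pow_le_pow_left_iff two_ne_zero).1 h2
  calc _ = 16 * (ENNReal.ofReal (4 ^ (k - 1)) ^ 2 * ‖shellLp (k - 1) v‖ₑ) := by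
        rw [four_zpow_eq k, ENNReal.ofReal_mul (by norm_num), ENNReal.ofReal_ofNat, mul_pow,
          ← mul_assoc]
        norm_num
    _ ≤ 16 * 1 := by gcongr
    _ = 16 := mul_one _

theorem sum_pow_mul_enorm_shellLp_sq_le (v : L2) (S : Finset ℤ) :
    ∑ k ∈ S, (ENNReal.ofReal (4 ^ k) ^ 2 * ‖shellLp (k - 1) v‖ₑ) ^ 2 ≤
      256 * ∫⁻ x, ‖v x‖ₑ ^ 6 := by
  calc _ = ∑ k ∈ S, 256 * ∫⁻ x, ENNReal.ofReal ((4 : ℝ) ^ (k - 1)) ^ 4 *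
        ‖shell ((4 : ℝ) ^ (k - 1)) (v x)‖ₑ ^ 2 := by
        refine Finset.sum_congr rfl fun k _ ↦ ?_
        rw [four_zpow_eq k, ENNReal.ofReal_mul (by norm_num), ENNReal.ofReal_ofNat, mul_pow,
          mul_pow, mul_pow, enorm_shellLp_sq,
          lintegral_const_mul _ ((measurable_enorm_shell_comp _ v).pow_const 2)]
        ring
    _ = 256 * ∫⁻ x, ∑ k ∈ S, ENNReal.ofReal ((4 : ℝ) ^ (k - 1)) ^ 4 *
        ‖shell ((4 : ℝ) ^ (k - 1)) (v x)‖ₑ ^ 2 := by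
        rw [lintegral_finsetSum _ fun k _ ↦
          ((measurable_enorm_shell_comp _ v).pow_const 2).const_mul _, Finset.mul_sum]
    _ ≤ _ := by
        gcongr
        exact sum_pow_mul_enorm_shell_sq_le _ S

/-- Reverse direction of the shell decomposition: tested against v, the weighted shells recover the
L⁶ norm. -/
theorem le_tsum_pow_mul_lintegral_shell (v : L2) :
    ENNReal.ofReal (3 / 4 ^ 10) * ∫⁻ x, ‖v x‖ₑ ^ 6 ≤
      ∑' k : ℤ, ENNReal.ofReal ((4 : ℝ) ^ k) ^ 4 *
        ∫⁻ x, ‖shell ((4 : ℝ) ^ k) (v x)‖ₑ * ‖v x‖ₑ := by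
  have hv := (Lp.stronglyMeasurable v).measurable.enorm
  rw [← lintegral_const_mul _ (hv.pow_const 6)]
  refine (lintegral_mono fun x ↦ le_tsum_pow_mul_enorm_shell (v x)).trans ?_
  rw [lintegral_tsum fun k ↦
    ((measurable_enorm_shell_mul k v).const_mul _).aemeasurable]
  refine le_of_eq (tsum_congr fun k ↦ ?_)
  rw [lintegral_const_mul _ (measurable_enorm_shell_mul k v)]

theorem inner_shellLp (k : ℤ) (v : L2) :
    inner ℂ v (shellLp k v) =
      (((∫⁻ x, ‖shell ((4 : ℝ) ^ k) (v x)‖ₑ * ‖v x‖ₑ).toReal : ℝ) : ℂ) := by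
  rw [← integral_toReal (measurable_enorm_shell_mul k v).aemeasurable
    (.of_forall fun x ↦ by finiteness), L2.inner_def, ← integral_complex_ofReal]
  refine integral_congr_ae ?_
  filter_upwards [coeFn_shellLp k v] with x hx
  have h := inner_shell_mul ((4 : ℝ) ^ k) 1 (v x)
  rw [Complex.ofReal_one, one_mul, one_mul] at h
  rw [hx, ← inner_conj_symm, h, Complex.conj_ofReal, ENNReal.toReal_mul, toReal_enorm,
    toReal_enorm, norm_shell (by positivity)]

end ShellEnorm

/-! ### The endpoint estimate in L²L⁶ by duality -/

section Endpoint

theorem enorm_complex_ofReal (a : ℝ) : ‖(a : ℂ)‖ₑ = ‖a‖ₑ := by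
  rw [← ofReal_norm, Complex.norm_real, ofReal_norm]

/-- The heat-Schrödinger evolution of `f`, extended by zero to negative times. -/
noncomputable def evol (r : ℝ≥0∞) [Fact (1 ≤ r)] (ω : ℂ) (f : L2) :
    ℝ → Lp ℂ r (volume : Measure R3) :=
  (Set.Ioi 0).indicator fun t ↦ convOp 2 r (heatKernel (t * ω)) f

variable {ω : ℂ}

theorem evol_of_pos {r : ℝ≥0∞} [Fact (1 ≤ r)] {t : ℝ} (ht : 0 < t) (f : L2) :
    evol r ω f t = convOp 2 r (heatKernel (t * ω)) f := Set.indicator_of_mem (by exact ht) _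

theorem re_ofReal_mul_pos (hω : 0 < ω.re) {t : ℝ} (ht : 0 < t) : 0 < ((t : ℂ) * ω).re := by
  rw [Complex.re_ofReal_mul]; positivity

theorem stronglyMeasurable_evol {r : ℝ≥0∞} [Fact (1 ≤ r)] (hω : 0 < ω.re) (hr2 : 2 ≤ r)
    (hr : r ≠ ∞) (f : L2) : StronglyMeasurable (evol r ω f) :=
  (((heatFamily_heatKernel hω).continuousOn_convOp hr2 hr).clm_apply
    continuousOn_const).stronglyMeasurable_indicator_of_real measurableSet_Ioi

/-- The evolutions in the various L^r are a priori different classes; they have the same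
representative, which permits comparing and interpolating norms. -/
theorem coeFn_evol {r : ℝ≥0∞} [Fact (1 ≤ r)] (hω : 0 < ω.re) (hr2 : 2 ≤ r)
    (hr : r ≠ ∞) (f : L2) (t : ℝ) : evol r ω f t =ᵐ[volume] evol 2 ω f t := by
  by_cases ht : 0 < t
  · rw [evol_of_pos ht, evol_of_pos ht]
    have hk := goodKernel_heatKernel (re_ofReal_mul_pos hω ht)
    exact (hk.coeFn_convOp hr2 hr f).trans (hk.coeFn_convOp le_rfl (by norm_num) f).symm
  · rw [evol, evol, Set.indicator_of_notMem (by exact ht), Set.indicator_of_notMem (by exact ht)]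
    exact (Lp.coeFn_zero _ _ _).trans (Lp.coeFn_zero _ _ _).symm

theorem norm_evol_two_le (hω : 0 < ω.re) (f : L2) (t : ℝ) : ‖evol 2 ω f t‖ ≤ ‖f‖ := by
  by_cases ht : 0 < t
  · rw [evol_of_pos ht]
    exact norm_convOp_heatKernel_le (re_ofReal_mul_pos hω ht) f
  · rw [evol, Set.indicator_of_notMem (by exact ht), norm_zero]
    positivity

instance : Fact ((1 : ℝ≥0∞) ≤ 6) := ⟨by norm_num⟩

/-- The `L⁶` size of the evolution, restricted to a time window. -/
noncomputable def evolSize (ω : ℂ) (f : L2) (I : Set ℝ) (t : ℝ) : ℝ :=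
  I.indicator (fun t ↦ ‖evol 6 ω f t‖) t

theorem evolSize_nonneg (f : L2) (I : Set ℝ) (t : ℝ) : 0 ≤ evolSize ω f I t :=
  Set.indicator_nonneg (fun _ _ ↦ norm_nonneg _) t

/-- The evolution normalised in `L⁶`. -/
noncomputable def evolUnit (ω : ℂ) (f : L2) (I : Set ℝ) (t : ℝ) : L2 :=
  -- When the size vanishes its inverse is 0 by convention, and so is the normalised evolution; in
  -- particular this happens off the window.
  ((evolSize ω f I t)⁻¹ : ℂ) • evol 2 ω f t

variable {I : Set ℝ}

theorem stronglyMeasurable_evolSize (hω : 0 < ω.re) (f : L2) (hI : MeasurableSet I) :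
    StronglyMeasurable (evolSize ω f I) :=
  (stronglyMeasurable_evol hω (by norm_num) (by norm_num) f).norm.indicator hI

theorem stronglyMeasurable_evolUnit (hω : 0 < ω.re) (f : L2) (hI : MeasurableSet I) :
    StronglyMeasurable (evolUnit ω f I) := by
  refine StronglyMeasurable.smul (𝕜 := ℂ) ?_ (stronglyMeasurable_evol hω le_rfl (by norm_num) f)
  have := (stronglyMeasurable_evolSize hω f hI).measurable
  exact Measurable.stronglyMeasurable (by fun_prop)

theorem enorm_evolSize_mul_lintegral (hω : 0 < ω.re) (f : L2) (t : ℝ) (ht : evolSize ω f I t ≠ 0) :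
    ∫⁻ x, ‖evolUnit ω f I t x‖ₑ ^ 6 = 1 := by
  have htI : t ∈ I := Set.mem_of_indicator_ne_zero ht
  have h1 : eLpNorm (evolUnit ω f I t) 6 volume = 1 := by
    have e : evolUnit ω f I t =ᵐ[volume] ((evolSize ω f I t)⁻¹ : ℂ) • (evol 6 ω f t : R3 → ℂ) := by
      filter_upwards [Lp.coeFn_smul ((evolSize ω f I t)⁻¹ : ℂ) (evol 2 ω f t),
        coeFn_evol (r := 6) hω (by norm_num) (by norm_num) f t] with x h1 h2
      rw [evolUnit, h1, Pi.smul_apply, Pi.smul_apply, h2]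
    have e2 : evolSize ω f I t = ‖evol 6 ω f t‖ := Set.indicator_of_mem htI _
    rw [eLpNorm_congr_ae e, eLpNorm_const_smul, ← Lp.enorm_def, e2]
    rw [e2] at ht
    rw [← ofReal_norm, ← ofReal_norm, ← ENNReal.ofReal_mul (norm_nonneg _), norm_inv,
      Complex.norm_real, norm_norm, inv_mul_cancel₀ ht, ENNReal.ofReal_one]
  rw [← lintegral_enorm_rpow_eq (by norm_num) (by norm_num)] at h1
  have h2 := congrArg (· ^ (6 : ℝ)) h1
  simp only [← ENNReal.rpow_mul, ENNReal.one_rpow] at h2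
  simpa using h2

theorem lintegral_evolUnit_le (hω : 0 < ω.re) (f : L2) (t : ℝ) :
    ∫⁻ x, ‖evolUnit ω f I t x‖ₑ ^ 6 ≤ 1 := by
  by_cases ht : evolSize ω f I t = 0
  · have : evolUnit ω f I t = 0 := by simp [evolUnit, ht]
    rw [this]
    have e : ∫⁻ x, ‖(0 : L2) x‖ₑ ^ 6 = ∫⁻ x : R3, 0 := by
      refine lintegral_congr_ae ?_
      filter_upwards [Lp.coeFn_zero ℂ 2 (volume : Measure R3)] with x hx
      rw [hx]; simp
    rw [e]; simp
  · exact (enorm_evolSize_mul_lintegral hω f t ht).le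

theorem enorm_evolSize_sq_mul_lintegral (hω : 0 < ω.re) (f : L2) (t : ℝ) :
    ‖evolSize ω f I t‖ₑ ^ 2 * ∫⁻ x, ‖evolUnit ω f I t x‖ₑ ^ 6 = ‖evolSize ω f I t‖ₑ ^ 2 := by
  by_cases ht : evolSize ω f I t = 0
  · simp [ht]
  · rw [enorm_evolSize_mul_lintegral hω f t ht, mul_one]

theorem evolSize_smul_evolUnit (f : L2) (t : ℝ) (ht : evolSize ω f I t ≠ 0) :
    (evolSize ω f I t : ℂ) • evolUnit ω f I t = evol 2 ω f t := by
  rw [evolUnit, smul_smul, mul_inv_cancel₀ (by exact_mod_cast ht), one_smul]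

/-- The test family that is dual to the evolution at scale `4 ^ k`. -/
noncomputable def evolDual (ω : ℂ) (f : L2) (I : Set ℝ) (k : ℤ) (t : ℝ) : L2 :=
  convOp 2 2 (heatKernel (t * star ω))
    (((evolSize ω f I t * ((4 : ℝ) ^ k) ^ 4 : ℝ) : ℂ) • shellLp k (evolUnit ω f I t))

/-- The size of `evolDual`. -/
noncomputable def evolWeight (ω : ℂ) (f : L2) (I : Set ℝ) (k : ℤ) (t : ℝ) : ℝ≥0∞ :=
  96 * (‖evolSize ω f I t‖ₑ *
    (ENNReal.ofReal (4 ^ k) ^ 2 * ‖shellLp (k - 1) (evolUnit ω f I t)‖ₑ))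

theorem evolDual_of_notMem {k : ℤ} {t : ℝ} (f : L2) (ht : t ∉ I) : evolDual ω f I k t = 0 := by
  have : evolSize ω f I t = 0 := Set.indicator_of_notMem ht _
  simp [evolDual, this]

theorem enorm_ofReal_mul_pow_smul (A L : ℝ) (hL : 0 < L) (v : L2) :
    ‖((A * L ^ 4 : ℝ) : ℂ) • v‖ₑ = ‖A‖ₑ * ENNReal.ofReal L ^ 4 * ‖v‖ₑ := by
  rw [enorm_smul, enorm_complex_ofReal, enorm_mul, enorm_pow, Real.enorm_of_nonneg hL.le]

/-- Contraction leaves the norm of the data, and one power 4^(2k) goes into the weight. The constant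
4 is enlarged to 96 so that the same weight serves the L¹ bound. -/
theorem enorm_evolDual_le (hω : 0 < ω.re) (hI : I ⊆ Set.Ioi 0) (f : L2) (k : ℤ) (t : ℝ) :
    ‖evolDual ω f I k t‖ₑ ≤ ENNReal.ofReal (((4 : ℝ) ^ k) ^ 2) * evolWeight ω f I k t := by
  by_cases ht : t ∈ I
  swap
  · rw [evolDual_of_notMem f ht]; simp
  have h1 : ‖evolDual ω f I k t‖ₑ ≤ ‖((evolSize ω f I t * ((4 : ℝ) ^ k) ^ 4 : ℝ) : ℂ) •
      shellLp k (evolUnit ω f I t)‖ₑ := by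
    rw [← ofReal_norm, ← ofReal_norm]
    exact ENNReal.ofReal_le_ofReal (norm_convOp_heatKernel_le
      (re_ofReal_mul_pos (star_re_pos hω) (hI ht)) _)
  rw [enorm_ofReal_mul_pow_smul _ _ (by positivity)] at h1
  refine h1.trans ?_
  rw [evolWeight, ENNReal.ofReal_pow (by positivity)]
  calc _ ≤ ‖evolSize ω f I t‖ₑ * ENNReal.ofReal (4 ^ k) ^ 4 *
        (4 * ‖shellLp (k - 1) (evolUnit ω f I t)‖ₑ) := by
        gcongr
        exact enorm_shellLp_le k _
    _ = 4 * (‖evolSize ω f I t‖ₑ * ENNReal.ofReal (4 ^ k) ^ 4 *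
        ‖shellLp (k - 1) (evolUnit ω f I t)‖ₑ) := by ring
    _ ≤ 96 * (‖evolSize ω f I t‖ₑ * ENNReal.ofReal (4 ^ k) ^ 4 *
        ‖shellLp (k - 1) (evolUnit ω f I t)‖ₑ) := by gcongr; norm_num
    _ = _ := by ring

/-- The L¹ norm of a shell is at most 6 · 4^(-k) times the squared L² norm of the preceding one. One
of the two factors is absorbed by the L⁶ normalisation at the price of 16, and 6 · 16 = 96. -/
theorem lintegral_evolDual_data_le (hω : 0 < ω.re) (f : L2) (k : ℤ) (t : ℝ) :
    ∫⁻ x, ‖(((evolSize ω f I t * ((4 : ℝ) ^ k) ^ 4 : ℝ) : ℂ) •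
      shellLp k (evolUnit ω f I t) : L2) x‖ₑ ≤
      ENNReal.ofReal ((4 ^ k)⁻¹) * evolWeight ω f I k t := by
  set v := evolUnit ω f I t
  set A := evolSize ω f I t with hA
  set L := (4 : ℝ) ^ k with hLdef
  have hL : 0 < L := by positivity
  have e : ∫⁻ x, ‖(((A * L ^ 4 : ℝ) : ℂ) • shellLp k v : L2) x‖ₑ =
      ‖A‖ₑ * ENNReal.ofReal L ^ 4 * ∫⁻ x, ‖shellLp k v x‖ₑ := by
    rw [← lintegral_const_mul _ (Lp.stronglyMeasurable _).measurable.enorm]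
    refine lintegral_congr_ae ?_
    filter_upwards [Lp.coeFn_smul ((A * L ^ 4 : ℝ) : ℂ) (shellLp k v)] with x hx
    rw [hx, Pi.smul_apply, enorm_smul, enorm_complex_ofReal, enorm_mul, enorm_pow,
      Real.enorm_of_nonneg hL.le]
  have hl : ENNReal.ofReal L⁻¹ * ENNReal.ofReal L = 1 := by
    rw [← ENNReal.ofReal_mul (by positivity), inv_mul_cancel₀ hL.ne', ENNReal.ofReal_one]
  have h6 := mul_lintegral_enorm_shellLp_le k v
  have h16 := pow_mul_enorm_shellLp_le k (lintegral_evolUnit_le (I := I) hω f t)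
  rw [e, evolWeight, ← hA]
  calc _ = (ENNReal.ofReal L⁻¹ * ENNReal.ofReal L) * (‖A‖ₑ * ENNReal.ofReal L ^ 4 *
        ∫⁻ x, ‖shellLp k v x‖ₑ) := by rw [hl, one_mul]
    _ = ENNReal.ofReal L⁻¹ * (‖A‖ₑ * ENNReal.ofReal L ^ 4 *
        (ENNReal.ofReal L * ∫⁻ x, ‖shellLp k v x‖ₑ)) := by ring
    _ ≤ ENNReal.ofReal L⁻¹ * (‖A‖ₑ * ENNReal.ofReal L ^ 4 *
        (6 * ‖shellLp (k - 1) v‖ₑ ^ 2)) := by gcongr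
    _ = ENNReal.ofReal L⁻¹ * (6 * (ENNReal.ofReal L ^ 2 * ‖shellLp (k - 1) v‖ₑ) * (‖A‖ₑ *
        (ENNReal.ofReal L ^ 2 * ‖shellLp (k - 1) v‖ₑ))) := by ring
    _ ≤ ENNReal.ofReal L⁻¹ * (6 * 16 * (‖A‖ₑ *
        (ENNReal.ofReal L ^ 2 * ‖shellLp (k - 1) v‖ₑ))) := by gcongr
    _ = _ := by norm_num [L, v]

/-- The only use of Im ω = 1 in the endpoint argument, and the reason why its constant does not
involve Re ω. -/
theorem dispersiveBound_evolDual (hω : 0 < ω.re) (him : ω.im = 1) (hI : I ⊆ Set.Ioi 0) (f : L2)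
    (k l : ℤ) : DispersiveBound ((4 : ℝ) ^ k) ((4 : ℝ) ^ l) (evolDual ω f I k) (evolDual ω f I l)
      (evolWeight ω f I k) (evolWeight ω f I l) := by
  intro s t hst
  by_cases hs : s ∈ I
  swap
  · rw [evolDual_of_notMem f hs]; simp
  by_cases ht : t ∈ I
  swap
  · rw [evolDual_of_notMem f ht]; simp
  refine (enorm_inner_convOp_heatKernel_le (re_ofReal_mul_pos (star_re_pos hω) (hI hs))
    (re_ofReal_mul_pos (star_re_pos hω) (hI ht)) _ _).trans ?_
  -- The combined parameter is sω + tω̄, whose imaginary part is s - t.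
  have h1 : ‖star ((s : ℂ) * star ω) + t * star ω‖ ^ (-(3 / 2) : ℝ) ≤
      |s - t| ^ (-(3 / 2) : ℝ) := by
    refine Real.rpow_le_rpow_of_nonpos (abs_pos.2 (sub_ne_zero.2 hst)) ?_ (by norm_num)
    refine le_trans (le_of_eq ?_) (Complex.abs_im_le_norm _)
    simp [him, sub_eq_add_neg]
  calc _ ≤ ENNReal.ofReal (|s - t| ^ (-(3 / 2) : ℝ)) *
        ((ENNReal.ofReal ((4 ^ k)⁻¹) * evolWeight ω f I k s) *
        (ENNReal.ofReal ((4 ^ l)⁻¹) * evolWeight ω f I l t)) := by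
        gcongr
        · exact lintegral_evolDual_data_le hω f k s
        · exact lintegral_evolDual_data_le hω f l t
    _ = _ := by
        rw [ENNReal.ofReal_mul (by positivity), ENNReal.ofReal_mul (by positivity)]
        ring

theorem measurable_evolWeight (hω : 0 < ω.re) (f : L2) (hI : MeasurableSet I) (k : ℤ) :
    Measurable (evolWeight ω f I k) := by
  have h1 := (stronglyMeasurable_evolSize hω f hI).measurable
  have h2 := ((continuous_shellLp (k - 1)).comp_stronglyMeasurable
    (stronglyMeasurable_evolUnit hω f hI)).enorm
  unfold evolWeight
  fun_prop

/-- The window is bounded, and undoing the normalisation turns A(t) times the norm of v(t) into the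
norm of the evolution, so the integrand is bounded for each fixed k. -/
theorem integrable_evolDual (hω : 0 < ω.re) (f : L2) {a b : ℝ} (ha : 0 < a) (k : ℤ) :
    Integrable (evolDual ω f (Set.Ioc a b) k) := by
  set I := Set.Ioc a b
  have hI : MeasurableSet I := measurableSet_Ioc
  have e : evolDual ω f I k = I.indicator (evolDual ω f I k) := by
    ext1 t
    by_cases ht : t ∈ I
    · rw [Set.indicator_of_mem ht]
    · rw [Set.indicator_of_notMem ht, evolDual_of_notMem f ht]
  rw [e, integrable_indicator_iff hI]
  have hsm : AEStronglyMeasurable (evolDual ω f I k) (volume.restrict I) := by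
    refine (heatFamily_heatKernel (star_re_pos hω)).aestronglyMeasurable_convOp (g := id)
      le_rfl (by norm_num) measurable_id ?_ ?_
    · filter_upwards [ae_restrict_mem hI] with t ht using ha.trans ht.1
    · refine StronglyMeasurable.aestronglyMeasurable ?_
      refine StronglyMeasurable.smul (𝕜 := ℂ) ?_ ((continuous_shellLp k).comp_stronglyMeasurable
        (stronglyMeasurable_evolUnit hω f hI))
      have := (stronglyMeasurable_evolSize hω f hI).measurable
      exact Measurable.stronglyMeasurable (by fun_prop)
  refine Integrable.of_bound hsm (((4 : ℝ) ^ k) ^ 4 * (6 * ‖f‖)) ?_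
  filter_upwards [ae_restrict_mem hI] with t ht
  refine (norm_convOp_heatKernel_le
      (re_ofReal_mul_pos (star_re_pos hω) (ha.trans ht.1)) _).trans ?_
  by_cases h0 : evolSize ω f I t = 0
  · simp [h0]; positivity
  have h1 := evolSize_smul_evolUnit f t h0
  rw [norm_smul, Complex.norm_real, norm_mul, norm_pow, Real.norm_of_nonneg (r := (4 : ℝ) ^ k)
    (by positivity)]
  calc _ ≤ ‖evolSize ω f I t‖ * (4 ^ k) ^ 4 * (6 * ‖evolUnit ω f I t‖) := by
        gcongr; exact norm_shellLp_le k _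
    _ = (4 ^ k) ^ 4 * (6 * ‖(evolSize ω f I t : ℂ) • evolUnit ω f I t‖) := by
        rw [norm_smul, Complex.norm_real]; ring
    _ ≤ _ := by
        rw [h1]; gcongr; exact norm_evol_two_le hω f t

/-- Moving the adjoint flow onto f gives back A(t) v(t), which is then paired with its own shell. -/
theorem inner_evolDual (hω : 0 < ω.re) (hI : I ⊆ Set.Ioi 0) (f : L2) (k : ℤ) (t : ℝ) :
    inner ℂ f (evolDual ω f I k t) = (((‖evolSize ω f I t‖ₑ ^ 2 * (ENNReal.ofReal (4 ^ k) ^ 4 *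
      ∫⁻ x, ‖shell ((4 : ℝ) ^ k) (evolUnit ω f I t x)‖ₑ * ‖evolUnit ω f I t x‖ₑ)).toReal : ℝ)
        : ℂ) := by
  by_cases h0 : evolSize ω f I t = 0
  · simp [h0, evolDual]
  have ht : t ∈ I := Set.mem_of_indicator_ne_zero h0
  have ht0 : 0 < t := hI ht
  have e : star ((t : ℂ) * ω) = t * star ω := by simp
  rw [evolDual, ← e, ← inner_convOp_heatKernel (re_ofReal_mul_pos hω ht0), ← evol_of_pos ht0,
    ← evolSize_smul_evolUnit f t h0, inner_smul_left, inner_smul_right, inner_shellLp]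
  rw [ENNReal.toReal_mul, ENNReal.toReal_mul, ENNReal.toReal_pow, ENNReal.toReal_pow, toReal_enorm,
    ENNReal.toReal_ofReal (by positivity), Real.norm_of_nonneg (evolSize_nonneg f I t),
    Complex.conj_ofReal]
  push_cast
  ring

theorem lintegral_sum_evolWeight_sq_le (hω : 0 < ω.re) (f : L2) (hI : MeasurableSet I)
    (S : Finset ℤ) : ∑ k ∈ S, ∫⁻ t, evolWeight ω f I k t ^ 2 ≤
      96 ^ 2 * 256 * ∫⁻ t, ‖evolSize ω f I t‖ₑ ^ 2 := by
  have hA := (stronglyMeasurable_evolSize hω f hI).measurable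
  rw [← lintegral_finsetSum _ fun k _ ↦ (measurable_evolWeight hω f hI k).pow_const 2,
    ← lintegral_const_mul _ (hA.enorm.pow_const 2)]
  refine lintegral_mono fun t ↦ ?_
  calc _ = 96 ^ 2 * ‖evolSize ω f I t‖ₑ ^ 2 * ∑ k ∈ S,
        (ENNReal.ofReal (4 ^ k) ^ 2 * ‖shellLp (k - 1) (evolUnit ω f I t)‖ₑ) ^ 2 := by
        rw [Finset.mul_sum]
        refine Finset.sum_congr rfl fun k _ ↦ ?_
        rw [evolWeight]; ring
    _ ≤ 96 ^ 2 * ‖evolSize ω f I t‖ₑ ^ 2 * (256 * 1) := by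
        gcongr
        refine (sum_pow_mul_enorm_shellLp_sq_le _ S).trans ?_
        gcongr
        exact lintegral_evolUnit_le hω f t
    _ = _ := by ring

theorem lintegral_shell_mul_ne_top (k : ℤ) (v : L2) :
    ∫⁻ x, ‖shell ((4 : ℝ) ^ k) (v x)‖ₑ * ‖v x‖ₑ ≠ ∞ := by
  refine ne_top_of_le_ne_top (b := ‖v‖ₑ ^ 2) (by finiteness) ?_
  rw [enorm_sq_eq_lintegral]
  refine lintegral_mono fun x ↦ ?_
  dsimp only
  rw [sq, enorm_shell (by positivity), ← ofReal_norm]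
  gcongr
  exact shellSize_le_self (by positivity) (norm_nonneg _)

/-- All pairings are nonnegative reals, so the sum of their absolute values is one inner product of
f with a sum of vectors, and Cauchy–Schwarz loses nothing to cancellation. -/
theorem lintegral_evolSize_sq_le_tsum (hω : 0 < ω.re) (hI : I ⊆ Set.Ioi 0)
    (hIm : MeasurableSet I) (f : L2) (hX : ∀ k, Integrable (evolDual ω f I k)) :
    ENNReal.ofReal (3 / 4 ^ 10) * ∫⁻ t, ‖evolSize ω f I t‖ₑ ^ 2 ≤
      ⨆ S : Finset ℤ, ‖∑ k ∈ S, ∫ t, evolDual ω f I k t‖ₑ * ‖f‖ₑ := by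
  have hA := (stronglyMeasurable_evolSize hω f hIm).measurable
  have hi : ∀ k t, ‖inner ℂ f (evolDual ω f I k t)‖ₑ = ‖evolSize ω f I t‖ₑ ^ 2 *
      (ENNReal.ofReal (4 ^ k) ^ 4 * ∫⁻ x, ‖shell ((4 : ℝ) ^ k) (evolUnit ω f I t x)‖ₑ *
        ‖evolUnit ω f I t x‖ₑ) := by
    intro k t
    rw [inner_evolDual hω hI, enorm_complex_ofReal, Real.enorm_of_nonneg ENNReal.toReal_nonneg,
      ENNReal.ofReal_toReal]
    have := lintegral_shell_mul_ne_top k (evolUnit ω f I t)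
    finiteness
  have hint : ∀ k, Integrable fun t ↦ inner ℂ f (evolDual ω f I k t) :=
    fun k ↦ (hX k).const_inner f
  calc _ = ∫⁻ t, ENNReal.ofReal (3 / 4 ^ 10) * ‖evolSize ω f I t‖ₑ ^ 2 :=
        (lintegral_const_mul _ (hA.enorm.pow_const 2)).symm
    _ ≤ ∫⁻ t, ∑' k : ℤ, ‖inner ℂ f (evolDual ω f I k t)‖ₑ := by
        refine lintegral_mono fun t ↦ ?_
        rw [← enorm_evolSize_sq_mul_lintegral hω f t]
        simp_rw [hi]
        rw [ENNReal.tsum_mul_left, mul_left_comm]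
        gcongr
        exact le_tsum_pow_mul_lintegral_shell _
    _ = ∑' k : ℤ, ∫⁻ t, ‖inner ℂ f (evolDual ω f I k t)‖ₑ :=
        lintegral_tsum fun k ↦ (hint k).aestronglyMeasurable.enorm
    _ = ⨆ S : Finset ℤ, ∑ k ∈ S, ∫⁻ t, ‖inner ℂ f (evolDual ω f I k t)‖ₑ :=
        ENNReal.tsum_eq_iSup_sum
    _ ≤ _ := by
        refine iSup_mono fun S ↦ ?_
        have e : ∀ k, ∫⁻ t, ‖inner ℂ f (evolDual ω f I k t)‖ₑ =
            ENNReal.ofReal (∫ t, ‖inner ℂ f (evolDual ω f I k t)‖) := fun k ↦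
          (ofReal_integral_norm_eq_lintegral_enorm (hint k)).symm
        have e2 : inner ℂ f (∑ k ∈ S, ∫ t, evolDual ω f I k t) =
            ((∑ k ∈ S, ∫ t, ‖inner ℂ f (evolDual ω f I k t)‖ : ℝ) : ℂ) := by
          rw [inner_sum]
          push_cast
          refine Finset.sum_congr rfl fun k _ ↦ ?_
          rw [← integral_inner (hX k), ← integral_complex_ofReal]
          refine integral_congr_ae (.of_forall fun t ↦ ?_)
          dsimp only
          rw [inner_evolDual hω hI, Complex.norm_real, Real.norm_of_nonneg ENNReal.toReal_nonneg]
        simp_rw [e]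
        rw [← ENNReal.ofReal_sum_of_nonneg fun k _ ↦ integral_nonneg fun t ↦ norm_nonneg _]
        have h0 : 0 ≤ ∑ k ∈ S, ∫ t, ‖inner ℂ f (evolDual ω f I k t)‖ :=
          Finset.sum_nonneg fun k _ ↦ integral_nonneg fun t ↦ norm_nonneg _
        rw [← Real.enorm_of_nonneg h0, ← enorm_complex_ofReal, ← e2, mul_comm]
        exact enorm_inner_le _ _

/-- Qualitative finiteness from heat smoothing away from t = 0. The bound degenerates with ω and a,
and serves only to justify cancelling this integral later. -/
theorem lintegral_evolSize_ne_top (hω : 0 < ω.re) (f : L2) {a b : ℝ} (ha : 0 < a) :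
    ∫⁻ t, ‖evolSize ω f (Set.Ioc a b) t‖ₑ ^ 2 ≠ ∞ := by
  obtain ⟨A, hA⟩ := (heatFamily_heatKernel hω).exists_enorm_convOp_le (p := 2) (r := 6)
    (by norm_num) (by norm_num)
  have e : expGap 2 6 = 1 / 3 := by simp [expGap]; norm_num
  refine ne_top_of_le_ne_top (b := ∫⁻ t in Set.Ioc a b,
    (A * ENNReal.ofReal (a ^ (-(1 / 2) : ℝ)) * ‖f‖ₑ) ^ 2) ?_ ?_
  · rw [setLIntegral_const, Real.volume_Ioc]
    finiteness
  · rw [← lintegral_indicator measurableSet_Ioc]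
    refine lintegral_mono fun t ↦ ?_
    by_cases ht : t ∈ Set.Ioc a b
    · have ht0 : 0 < t := ha.trans ht.1
      rw [Set.indicator_of_mem ht, evolSize, Set.indicator_of_mem ht, enorm_norm, evol_of_pos ht0]
      gcongr
      refine (hA t ht0 f).trans ?_
      gcongr
      rw [e, show -(0 + 3 / 2 * (1 / 3) : ℝ) = -(1 / 2) by norm_num]
      exact Real.rpow_le_rpow_of_nonpos ha ht.1.le (by norm_num)
    · simp [evolSize, ht]

/-- The endpoint Strichartz estimate, uniformly in the dissipation. -/
theorem exists_lintegral_enorm_heatKernel_sq_le : ∃ C : ℝ≥0, ∀ (ω : ℂ), 0 < ω.re → ω.im = 1 →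
    ∀ f : L2, ∫⁻ t in Set.Ioi (0 : ℝ), ‖convOp 2 6 (heatKernel (t * ω)) f‖ₑ ^ 2 ≤ C * ‖f‖ₑ ^ 2 := by
  obtain ⟨C, hC⟩ := exists_enorm_sum_integral_sq_le
  set m := ENNReal.ofReal (3 / 4 ^ 10)
  have hm0 : m ≠ 0 := by simp [m]
  have hmt : m ≠ ∞ := ENNReal.ofReal_ne_top
  set D : ℝ≥0∞ := C * (96 ^ 2 * 256)
  refine ⟨(D / m ^ 2).toNNReal, fun ω hω him f ↦ ?_⟩
  rw [ENNReal.coe_toNNReal (by finiteness)]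
  have key : ∀ a b : ℝ, 0 < a →
      ∫⁻ t, ‖evolSize ω f (Set.Ioc a b) t‖ₑ ^ 2 ≤ D / m ^ 2 * ‖f‖ₑ ^ 2 := by
    intro a b ha
    set I := Set.Ioc a b
    have hI : I ⊆ Set.Ioi 0 := fun t ht ↦ ha.trans ht.1
    have hIm : MeasurableSet I := measurableSet_Ioc
    set Q := ∫⁻ t, ‖evolSize ω f I t‖ₑ ^ 2
    have hQ : Q ≠ ∞ := lintegral_evolSize_ne_top hω f ha
    have hX := fun k ↦ integrable_evolDual (b := b) hω f ha k
    have hS : ∀ S : Finset ℤ, ‖∑ k ∈ S, ∫ t, evolDual ω f I k t‖ₑ ^ 2 ≤ D * Q := by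
      intro S
      refine (hC (evolDual ω f I) (evolWeight ω f I) hX (measurable_evolWeight hω f hIm)
        (enorm_evolDual_le hω hI f) (dispersiveBound_evolDual hω him hI f) S).trans ?_
      rw [mul_assoc]
      gcongr
      exact lintegral_sum_evolWeight_sq_le hω f hIm S
    have h1 := lintegral_evolSize_sq_le_tsum hω hI hIm f hX
    -- The dual sum is at most (D Q)^(1/2), so m Q ≤ (D Q)^(1/2) ‖f‖. Squaring and cancelling one
    -- finite nonzero factor Q bounds Q by D/m² times ‖f‖².
    have h2 : (m * Q) ^ 2 ≤ D * Q * ‖f‖ₑ ^ 2 := by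
      have : m * Q ≤ (D * Q) ^ (2 : ℝ)⁻¹ * ‖f‖ₑ := by
        refine h1.trans (iSup_le fun S ↦ ?_)
        gcongr
        rw [ENNReal.le_rpow_inv_iff (by norm_num)]
        exact_mod_cast hS S
      calc _ ≤ ((D * Q) ^ (2 : ℝ)⁻¹ * ‖f‖ₑ) ^ 2 := by gcongr
        _ = _ := by
          rw [mul_pow, ← ENNReal.rpow_natCast, ← ENNReal.rpow_mul]; simp
    rw [mul_pow, sq Q] at h2
    by_cases hQ0 : Q = 0
    · rw [hQ0]; positivity
    have h3 : m ^ 2 * Q ≤ D * ‖f‖ₑ ^ 2 := by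
      refine (ENNReal.mul_le_mul_iff_left hQ0 hQ).1 ?_
      calc _ = m ^ 2 * (Q * Q) := by ring
        _ ≤ _ := h2
        _ = _ := by ring
    rw [mul_comm, ← ENNReal.le_div_iff_mul_le (by left; positivity) (by left; finiteness)] at h3
    refine h3.trans (le_of_eq ?_)
    rw [div_eq_mul_inv, div_eq_mul_inv]; ring
  -- The bound is independent of the window, so monotone exhaustion of (0, ∞) concludes.
  have hU : (⋃ n : ℕ, Set.Ioc ((n + 1 : ℝ)⁻¹) n) = Set.Ioi (0 : ℝ) := by
    ext t
    simp only [Set.mem_iUnion, Set.mem_Ioc, Set.mem_Ioi]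
    refine ⟨fun ⟨n, h, _⟩ ↦ lt_trans (by positivity) h, fun ht ↦ ?_⟩
    obtain ⟨n, hn⟩ := exists_nat_gt (max t t⁻¹)
    have h1 := (le_max_left _ _).trans_lt hn
    have h2 := (le_max_right _ _).trans_lt hn
    refine ⟨n, ?_, h1.le⟩
    rw [inv_lt_comm₀ (by positivity) ht]
    linarith
  have hdir : Directed (· ⊆ ·) fun n : ℕ ↦ Set.Ioc ((n + 1 : ℝ)⁻¹) (n : ℝ) := by
    refine Monotone.directed_le fun i j hij ↦ ?_
    have : (i : ℝ) ≤ j := by exact_mod_cast hij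
    exact Set.Ioc_subset_Ioc (by gcongr) this
  rw [← hU, setLIntegral_iUnion_of_directed _ hdir]
  refine iSup_le fun n ↦ ?_
  refine le_trans (le_of_eq ?_) (key ((n + 1 : ℝ)⁻¹) n (by positivity))
  rw [← lintegral_indicator measurableSet_Ioc]
  refine lintegral_congr fun t ↦ ?_
  by_cases ht : t ∈ Set.Ioc ((n + 1 : ℝ)⁻¹) (n : ℝ)
  · have ht0 : 0 < t := lt_trans (by positivity) ht.1
    rw [Set.indicator_of_mem ht, evolSize, Set.indicator_of_mem ht, enorm_norm, evol_of_pos ht0]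
  · simp [evolSize, ht]

end Endpoint

/-! ### Admissible pairs and the full homogeneous estimate -/

section Homogeneous

theorem toReal_two_div_add_three_div {a b : ℝ≥0∞} (ha : a ≠ 0) (hb : b ≠ 0) :
    (2 / a + 3 / b).toReal = 2 / a.toReal + 3 / b.toReal := by
  rw [ENNReal.toReal_add (ENNReal.div_ne_top (by simp) ha) (ENNReal.div_ne_top (by simp) hb),
    ENNReal.toReal_div, ENNReal.toReal_div]
  simp

theorem Admissible.ne_zero_left {q r : ℝ≥0∞} (h : Admissible q r) : q ≠ 0 := by
  rintro rfl
  have := h.1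
  rw [ENNReal.div_zero (by norm_num), top_add] at this
  exact ENNReal.div_ne_top (by norm_num) (by norm_num) this.symm

theorem Admissible.ne_top_right {q r : ℝ≥0∞} (h : Admissible q r) : r ≠ ∞ :=
  ne_top_of_le_ne_top (by norm_num) h.2.2

theorem Admissible.toReal_eq {q r : ℝ≥0∞} (h : Admissible q r) :
    2 / q.toReal + 3 / r.toReal = 3 / 2 := by
  have h0 : r ≠ 0 := (lt_of_lt_of_le (by norm_num) h.2.1).ne'
  rw [← toReal_two_div_add_three_div h.ne_zero_left h0, h.1]
  simp

theorem Admissible.two_le_toReal {q r : ℝ≥0∞} (h : Admissible q r) : 2 ≤ r.toReal := by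
  simpa using ENNReal.toReal_mono h.ne_top_right h.2.1

theorem Admissible.toReal_le_six {q r : ℝ≥0∞} (h : Admissible q r) : r.toReal ≤ 6 := by
  simpa using ENNReal.toReal_mono (by norm_num) h.2.2

theorem Admissible.right_eq_two {r : ℝ≥0∞} (h : Admissible ∞ r) : r = 2 := by
  have h1 := h.toReal_eq
  have h2 := h.two_le_toReal
  rw [ENNReal.toReal_top, div_zero, zero_add, div_eq_div_iff (by linarith) (by norm_num)] at h1
  rw [← ENNReal.ofReal_toReal h.ne_top_right, show r.toReal = 2 by linarith]
  simp

theorem Admissible.toReal_pos {q r : ℝ≥0∞} (h : Admissible q r) (hq : q ≠ ∞) : 0 < q.toReal :=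
  ENNReal.toReal_pos h.ne_zero_left hq

theorem Admissible.two_lt_toReal {q r : ℝ≥0∞} (h : Admissible q r) (hq : q ≠ ∞) :
    2 < r.toReal := by
  have h1 := h.toReal_eq
  have h2 := h.two_le_toReal
  have h3 : 0 < 2 / q.toReal := div_pos two_pos (h.toReal_pos hq)
  have h4 : 3 / r.toReal < 3 / 2 := by linarith
  rwa [div_lt_div_iff_of_pos_left (by norm_num) (by linarith) (by norm_num)] at h4

theorem Admissible.two_le_toReal_left {q r : ℝ≥0∞} (h : Admissible q r) (hq : q ≠ ∞) :
    2 ≤ q.toReal := by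
  have h1 := h.toReal_eq
  have h2 := h.toReal_le_six
  have h3 := h.toReal_pos hq
  have h4 : 3 / 6 ≤ 3 / r.toReal :=
    div_le_div_of_nonneg_left (by norm_num) (by linarith [h.two_le_toReal]) h2
  have h5 : 2 / q.toReal ≤ 2 / 2 := by linarith
  rwa [div_le_div_iff_of_pos_left (by norm_num) (by linarith) (by norm_num)] at h5

/-- Interpolation of `L^r` between `L²` and `L⁶`. -/
theorem eLpNorm_rpow_le_two_six {g : R3 → ℂ} (hg : Measurable g) {q r : ℝ≥0∞}
    (h : Admissible q r) (hq : q ≠ ∞) :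
    eLpNorm g r volume ^ q.toReal ≤
      eLpNorm g 2 volume ^ (q.toReal - 2) * eLpNorm g 6 volume ^ (2 : ℝ) := by
  have hq0 := h.toReal_pos hq
  have hr2 := h.two_le_toReal
  have hr6 := h.toReal_le_six
  have e := h.toReal_eq
  rw [← lintegral_enorm_rpow_eq (le_trans (by norm_num) h.2.1) h.ne_top_right,
    ← lintegral_enorm_rpow_eq (by norm_num) (by norm_num),
    ← lintegral_enorm_rpow_eq (p := 6) (by norm_num) (by norm_num)]
  set ρ := r.toReal
  set κ := q.toReal
  have hρ : 0 < ρ := by linarith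
  rw [div_add_div _ _ hq0.ne' hρ.ne', div_eq_div_iff (by positivity) (by norm_num)] at e
  have h2 : ((2 : ℝ≥0∞).toReal) = 2 := by simp
  have h6 : ((6 : ℝ≥0∞).toReal) = 6 := by simp
  rw [h2, h6, ← ENNReal.rpow_mul, ← ENNReal.rpow_mul, ← ENNReal.rpow_mul]
  have key := ENNReal.lintegral_mul_norm_pow_le (μ := (volume : Measure R3))
    (hg.enorm.pow_const (2 : ℝ)).aemeasurable (hg.enorm.pow_const (6 : ℝ)).aemeasurable
    (p := (6 - ρ) / 4) (q := (ρ - 2) / 4) (by linarith) (by linarith) (by ring)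
  have e1 : ∀ x, (‖g x‖ₑ ^ (2 : ℝ)) ^ ((6 - ρ) / 4) * (‖g x‖ₑ ^ (6 : ℝ)) ^ ((ρ - 2) / 4) =
      ‖g x‖ₑ ^ ρ := by
    intro x
    rw [← ENNReal.rpow_mul, ← ENNReal.rpow_mul, ← ENNReal.rpow_add_of_nonneg _ _ (by linarith)
      (by linarith)]
    congr 1; ring
  simp_rw [e1] at key
  refine (ENNReal.rpow_le_rpow key (by positivity : 0 ≤ 1 / ρ * κ)).trans (le_of_eq ?_)
  rw [ENNReal.mul_rpow_of_nonneg _ _ (by positivity), ← ENNReal.rpow_mul, ← ENNReal.rpow_mul]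
  congr 2
  · field_simp; linarith
  · field_simp; linarith

/-- The homogeneous Strichartz estimates, uniformly in the dissipation. -/
theorem exists_eLpNorm_evol_le : ∃ C : ℝ≥0, ∀ (ω : ℂ) (q r : ℝ≥0∞) [Fact (1 ≤ r)],
    0 < ω.re → ω.im = 1 → Admissible q r → ∀ f : L2,
      eLpNorm (evol r ω f) q volume ≤ C * ‖f‖ₑ := by
  obtain ⟨C, hC⟩ := exists_lintegral_enorm_heatKernel_sq_le
  -- With a constant at least 1, C is bounded by its q-th power, so one constant serves all q.
  refine ⟨max 1 C, fun ω q r _ hω him h f ↦ ?_⟩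
  have hmono : ∀ t, ‖evol 2 ω f t‖ₑ ≤ ‖f‖ₑ := fun t ↦ by
    rw [← ofReal_norm, ← ofReal_norm]
    exact ENNReal.ofReal_le_ofReal (norm_evol_two_le hω f t)
  by_cases hq : q = ∞
  · subst hq
    obtain rfl := h.right_eq_two
    rw [eLpNorm_exponent_top]
    refine (eLpNormEssSup_le_of_ae_enorm_bound (.of_forall hmono)).trans ?_
    exact le_mul_of_one_le_left (by positivity) (by simp)
  have hq0 := h.toReal_pos hq
  rw [eLpNorm_eq_lintegral_rpow_enorm_toReal h.ne_zero_left hq, one_div,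
    ENNReal.rpow_inv_le_iff hq0]
  -- Interpolation at fixed time produces exactly the square of the L⁶ norm; the remaining q - 2
  -- powers of the L² norm are bounded by contraction.
  have hpt : ∀ t, ‖evol r ω f t‖ₑ ^ q.toReal ≤
      ‖f‖ₑ ^ (q.toReal - 2) * ‖evol 6 ω f t‖ₑ ^ (2 : ℝ) := by
    intro t
    rw [Lp.enorm_def, Lp.enorm_def (f := evol 6 ω f t),
      eLpNorm_congr_ae (coeFn_evol hω h.2.1 h.ne_top_right f t),
      eLpNorm_congr_ae (coeFn_evol (r := 6) hω (by norm_num) (by norm_num) f t)]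
    refine (eLpNorm_rpow_le_two_six (Lp.stronglyMeasurable _).measurable h hq).trans ?_
    gcongr
    · linarith [h.two_le_toReal_left hq]
    · exact (Lp.enorm_def _).symm.le.trans (hmono t)
  have h6 : ∫⁻ t, ‖evol 6 ω f t‖ₑ ^ (2 : ℝ) ≤ C * ‖f‖ₑ ^ 2 := by
    refine le_trans (le_of_eq ?_) (hC ω hω him f)
    rw [← lintegral_indicator measurableSet_Ioi]
    refine lintegral_congr fun t ↦ ?_
    by_cases ht : t ∈ Set.Ioi (0 : ℝ)
    · rw [Set.indicator_of_mem ht, evol_of_pos ht, ENNReal.rpow_two]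
    · rw [Set.indicator_of_notMem ht, evol, Set.indicator_of_notMem ht]; simp
  have hm := (stronglyMeasurable_evol (r := 6) hω (by norm_num) (by norm_num) f).enorm
  calc _ ≤ ∫⁻ t, ‖f‖ₑ ^ (q.toReal - 2) * ‖evol 6 ω f t‖ₑ ^ (2 : ℝ) := lintegral_mono hpt
    _ = ‖f‖ₑ ^ (q.toReal - 2) * ∫⁻ t, ‖evol 6 ω f t‖ₑ ^ (2 : ℝ) :=
        lintegral_const_mul _ (hm.pow_const _)
    _ ≤ ‖f‖ₑ ^ (q.toReal - 2) * (C * ‖f‖ₑ ^ 2) := by gcongr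
    _ = C * ‖f‖ₑ ^ q.toReal := by
        rw [mul_left_comm, ← ENNReal.rpow_two, ← ENNReal.rpow_add_of_nonneg _ _
          (by linarith [h.two_le_toReal_left hq]) (by norm_num), sub_add_cancel]
    _ ≤ _ := by
        rw [ENNReal.mul_rpow_of_nonneg _ _ hq0.le]
        gcongr
        have h1 : (1 : ℝ≥0∞) ≤ ((max 1 C : ℝ≥0) : ℝ≥0∞) := by simp
        calc (C : ℝ≥0∞) ≤ ((max 1 C : ℝ≥0) : ℝ≥0∞) := by simp
          _ = ((max 1 C : ℝ≥0) : ℝ≥0∞) ^ (1 : ℝ) := (ENNReal.rpow_one _).symm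
          _ ≤ _ := ENNReal.rpow_le_rpow_of_exponent_le h1
              (by linarith [h.two_le_toReal_left hq])

end Homogeneous

/-! ### Fractional integration on the line -/

section HardyLittlewoodSobolev

/-- Converse of Hölder's inequality. -/
theorem lintegral_rpow_le_of_forall_dual {g : ℝ → ℝ≥0∞} (hg : Measurable g) {q q' : ℝ}
    (hqq : q.HolderConjugate q') {M : ℝ≥0∞}
    (H : ∀ h : ℝ → ℝ≥0, Measurable h → ∫⁻ x, (h x : ℝ≥0∞) ^ q' ≤ 1 → ∫⁻ x, g x * h x ≤ M) :
    ∫⁻ x, g x ^ q ≤ M ^ q := by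
  have hq0 := hqq.pos
  have hq0' := hqq.symm.pos
  -- Truncation in space and height makes the q-th moment finite, so that it may be divided by;
  -- monotone convergence removes the truncation.
  set G : ℕ → ℝ → ℝ≥0∞ := fun n ↦ (Set.Icc (-n : ℝ) n).indicator fun x ↦ min (g x) n with hG
  have hGm : ∀ n, Measurable (G n) := fun n ↦
    (hg.min measurable_const).indicator measurableSet_Icc
  have hGle : ∀ n x, G n x ≤ g x := fun n x ↦ by
    by_cases hx : x ∈ Set.Icc (-n : ℝ) n
    · simp only [hG, Set.indicator_of_mem hx]; exact min_le_left _ _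
    · simp only [hG, Set.indicator_of_notMem hx]; positivity
  have hGn : ∀ n x, G n x ≤ n := fun n x ↦ by
    by_cases hx : x ∈ Set.Icc (-n : ℝ) n
    · simp only [hG, Set.indicator_of_mem hx]; exact min_le_right _ _
    · simp only [hG, Set.indicator_of_notMem hx]; positivity
  have hGt : ∀ n x, G n x ≠ ∞ := fun n x ↦ ne_top_of_le_ne_top (by simp) (hGn n x)
  have hmono : ∀ x, Monotone fun n ↦ G n x := by
    intro x m n hmn
    have hmn' : (m : ℝ) ≤ n := by exact_mod_cast hmn
    by_cases hx : x ∈ Set.Icc (-m : ℝ) m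
    · have hx' : x ∈ Set.Icc (-n : ℝ) n := ⟨by linarith [hx.1], by linarith [hx.2]⟩
      simp only [hG, Set.indicator_of_mem hx, Set.indicator_of_mem hx']
      gcongr
    · simp only [hG, Set.indicator_of_notMem hx]; positivity
  have hsup : ∀ x, ⨆ n, G n x = g x := by
    intro x
    refine le_antisymm (iSup_le fun n ↦ hGle n x) (le_of_forall_lt fun c hc ↦ ?_)
    obtain ⟨n1, hn1⟩ := ENNReal.exists_nat_gt (ne_top_of_lt hc)
    obtain ⟨n2, hn2⟩ := exists_nat_gt |x|
    refine lt_of_lt_of_le ?_ (le_iSup _ (max n1 n2))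
    have hx : x ∈ Set.Icc (-(max n1 n2 : ℕ) : ℝ) (max n1 n2 : ℕ) := by
      have : (n2 : ℝ) ≤ (max n1 n2 : ℕ) := by exact_mod_cast le_max_right _ _
      exact abs_le.1 (hn2.le.trans this)
    simp only [hG, Set.indicator_of_mem hx]
    refine lt_min hc (hn1.trans_le ?_)
    exact_mod_cast le_max_left _ _
  have hN : ∀ n, ∫⁻ x, G n x ^ q ≤ M ^ q := by
    intro n
    set N := ∫⁻ x, G n x ^ q with hNdef
    by_cases hN0 : N = 0
    · rw [hN0]; positivity
    have hNt : N ≠ ∞ := by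
      refine ne_top_of_le_ne_top (b := ∫⁻ x in Set.Icc (-n : ℝ) n, (n : ℝ≥0∞) ^ q) ?_ ?_
      · rw [setLIntegral_const, Real.volume_Icc]
        finiteness
      · rw [hNdef, ← lintegral_indicator measurableSet_Icc]
        refine lintegral_mono fun x ↦ ?_
        by_cases hx : x ∈ Set.Icc (-n : ℝ) n
        · rw [Set.indicator_of_mem hx]
          gcongr
          exact hGn n x
        · simp [hG, Set.indicator_of_notMem hx, hq0]
    -- The extremiser in Hölder's inequality is G^(q-1), normalised by a = N^(1/q').
    set a := N ^ (1 / q') with ha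
    have ha0 : a ≠ 0 := by simp [ha, hN0, hNt]
    have hat : a ≠ ∞ := by finiteness
    have hainv : a⁻¹ ≠ ∞ := ENNReal.inv_ne_top.2 ha0
    have hpt : ∀ x, G n x ^ (q - 1) ≠ ∞ := fun x ↦
      ENNReal.rpow_ne_top_of_nonneg (by linarith [hqq.lt]) (hGt n x)
    have h1 := H (fun x ↦ (G n x ^ (q - 1) * a⁻¹).toNNReal)
      (((hGm n).pow_const _).mul_const _).ennreal_toNNReal
    have e1 : ∀ x, (((G n x ^ (q - 1) * a⁻¹).toNNReal : ℝ≥0) : ℝ≥0∞) = G n x ^ (q - 1) * a⁻¹ :=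
      fun x ↦ ENNReal.coe_toNNReal (ENNReal.mul_ne_top (hpt x) hainv)
    simp_rw [e1] at h1
    have h2 : ∫⁻ x, (G n x ^ (q - 1) * a⁻¹) ^ q' = 1 := by
      have e2 : ∀ x, (G n x ^ (q - 1) * a⁻¹) ^ q' = G n x ^ q * N⁻¹ := fun x ↦ by
        rw [ENNReal.mul_rpow_of_nonneg _ _ hq0'.le, ← ENNReal.rpow_mul, hqq.sub_one_mul_conj,
          ENNReal.inv_rpow, ha, ← ENNReal.rpow_mul, one_div, inv_mul_cancel₀ hq0'.ne',
          ENNReal.rpow_one]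
      simp_rw [e2]
      rw [lintegral_mul_const _ ((hGm n).pow_const _), ENNReal.mul_inv_cancel hN0 hNt]
    have h3 : N * a⁻¹ ≤ M := by
      rw [hNdef, ← lintegral_mul_const _ ((hGm n).pow_const _)]
      refine le_trans (lintegral_mono fun x ↦ ?_) (h1 h2.le)
      have : G n x ^ q = G n x * G n x ^ (q - 1) := by
        conv_lhs => rw [show q = 1 + (q - 1) by ring]
        rw [ENNReal.rpow_add_of_nonneg _ _ (by norm_num) (by linarith [hqq.lt]), ENNReal.rpow_one]
      dsimp only
      rw [this, mul_assoc]
      gcongr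
      exact hGle n x
    have h4 : N ^ (1 / q) = N * a⁻¹ := by
      have : 1 / q = 1 + -(1 / q') := by
        have := hqq.inv_add_inv_eq_one
        simp only [one_div]; linarith
      rw [this, ENNReal.rpow_add _ _ hN0 hNt, ENNReal.rpow_one, ENNReal.rpow_neg]
    rw [← h4, one_div, ENNReal.rpow_inv_le_iff hq0] at h3
    exact h3
  have hq : ∀ x, g x ^ q = ⨆ n, G n x ^ q := fun x ↦ by
    rw [← hsup x]
    exact (ENNReal.monotone_rpow_of_nonneg hq0.le).map_iSup_of_continuousAt
      ENNReal.continuous_rpow_const.continuousAt (by simp [hq0])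
  simp_rw [hq]
  rw [lintegral_iSup (fun n ↦ (hGm n).pow_const q)
    (fun m n hmn x ↦ ENNReal.rpow_le_rpow (hmono x hmn) hq0.le)]
  exact iSup_le hN

/-- Split at distance v = |E| from x: inside, the kernel is integrated over the whole interval;
outside, it is at most v^(-α) on a set of measure at most v. -/
theorem setLIntegral_riesz_le {α : ℝ} (h0 : 0 < α) (h1 : α < 1) (E : Set ℝ)
    (x : ℝ) :
    ∫⁻ y in E, ENNReal.ofReal (|x - y| ^ (-α)) ≤
      ENNReal.ofReal (2 / (1 - α) + 1) * volume E ^ (1 - α) := by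
  by_cases hv0 : volume E = 0
  · rw [setLIntegral_measure_zero _ _ hv0]; positivity
  by_cases hvt : volume E = ∞
  · rw [hvt, ENNReal.top_rpow_of_pos (by linarith), ENNReal.mul_top]
    · exact le_top
    · have : 0 < 1 - α := by linarith
      simp; positivity
  set v := (volume E).toReal with hv
  have hvpos : 0 < v := ENNReal.toReal_pos hv0 hvt
  have hvE : volume E = ENNReal.ofReal v := (ENNReal.ofReal_toReal hvt).symm
  have hpt : ∀ y, ENNReal.ofReal (|x - y| ^ (-α)) ≤
      (fun z ↦ (Set.Iic v).indicator (fun ρ ↦ ENNReal.ofReal (ρ ^ (-α))) |z|) (x - y) +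
        ENNReal.ofReal (v ^ (-α)) := by
    intro y
    dsimp only
    by_cases hy : |x - y| ∈ Set.Iic v
    · rw [Set.indicator_of_mem hy]; exact le_self_add
    · rw [Set.indicator_of_notMem hy, zero_add]
      refine ENNReal.ofReal_le_ofReal
        (Real.rpow_le_rpow_of_nonpos hvpos (not_le.1 hy).le (by linarith))
  have hloc : ∫⁻ y, (Set.Iic v).indicator (fun ρ ↦ ENNReal.ofReal (ρ ^ (-α))) |x - y| =
      ENNReal.ofReal (2 / (1 - α) * v ^ (1 - α)) := by
    rw [lintegral_sub_left_eq_self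
      (fun z ↦ (Set.Iic v).indicator (fun ρ ↦ ENNReal.ofReal (ρ ^ (-α))) |z|) x,
      lintegral_abs_eq, lintegral_indicator measurableSet_Iic,
      Measure.restrict_restrict measurableSet_Iic, Set.inter_comm, Set.Ioi_inter_Iic,
      setLIntegral_Ioc_rpow hvpos.le (by linarith), show (2 : ℝ≥0∞) = ENNReal.ofReal 2 by simp,
      ← ENNReal.ofReal_mul (by norm_num)]
    congr 1
    rw [neg_add_eq_sub]
    ring
  calc _ ≤ ∫⁻ y in E, (fun z ↦ (Set.Iic v).indicator (fun ρ ↦ ENNReal.ofReal (ρ ^ (-α))) |z|)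
        (x - y) + ENNReal.ofReal (v ^ (-α)) := lintegral_mono hpt
    _ = (∫⁻ y in E, (fun z ↦ (Set.Iic v).indicator (fun ρ ↦ ENNReal.ofReal (ρ ^ (-α))) |z|)
        (x - y)) + ENNReal.ofReal (v ^ (-α)) * volume E := by
        rw [lintegral_add_right _ measurable_const, setLIntegral_const]
    _ ≤ ENNReal.ofReal (2 / (1 - α) * v ^ (1 - α)) + ENNReal.ofReal (v ^ (-α)) * volume E := by
        gcongr
        exact (setLIntegral_le_lintegral _ _).trans hloc.le
    _ = _ := by
        have h2 : 0 < 1 - α := by linarith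
        rw [hvE, ENNReal.ofReal_rpow_of_pos hvpos, ← ENNReal.ofReal_mul (by positivity),
          ← ENNReal.ofReal_mul (by positivity), ← ENNReal.ofReal_add (by positivity)
          (by positivity), Real.rpow_sub hvpos, Real.rpow_neg hvpos.le, Real.rpow_one]
        congr 1
        field_simp

theorem coe_min_eq_lintegral (a b : ℝ≥0) :
    ((min a b : ℝ≥0) : ℝ≥0∞) =
      ∫⁻ c in Set.Ioc (0 : ℝ) b, (Set.Iic (a : ℝ)).indicator 1 c := by
  rw [lintegral_indicator_one measurableSet_Iic, Measure.restrict_apply measurableSet_Iic,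
    Set.inter_comm, Set.Ioc_inter_Iic, Real.volume_Ioc, sub_zero, ← NNReal.coe_min,
    ENNReal.ofReal_coe_nnreal, min_comm]

/-- Layer cake over the heights b ≤ A. Chebyshev gives |{h ≥ b}| ≤ b^(-t), hence the integrand
b^(-t(1-α)), which is integrable at 0 by the assumption on t. -/
theorem exists_lintegral_min_mul_riesz_le {α t : ℝ} (h0 : 0 < α) (h1 : α < 1) (ht0 : 0 < t)
    (ht : t * (1 - α) < 1) : ∃ C : ℝ≥0, ∀ h : ℝ → ℝ≥0, Measurable h →
      ∫⁻ y, (h y : ℝ≥0∞) ^ t ≤ 1 → ∀ (A : ℝ≥0) (x : ℝ),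
        ∫⁻ y, ((min (h y) A : ℝ≥0) : ℝ≥0∞) * ENNReal.ofReal (|x - y| ^ (-α)) ≤
          C * (A : ℝ≥0∞) ^ (1 - t * (1 - α)) := by
  set c := ENNReal.ofReal (2 / (1 - α) + 1)
  refine ⟨(c * ENNReal.ofReal (1 / (1 - t * (1 - α)))).toNNReal, fun h hh hn A x ↦ ?_⟩
  rw [ENNReal.coe_toNNReal (by finiteness)]
  set K : ℝ → ℝ≥0∞ := fun y ↦ ENNReal.ofReal (|x - y| ^ (-α))
  have hK : Measurable K := by fun_prop
  have hset : Measurable fun z : ℝ × ℝ ↦ (Set.Iic (h z.1 : ℝ)).indicator (1 : ℝ → ℝ≥0∞) z.2 := by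
    have e : (fun z : ℝ × ℝ ↦ (Set.Iic (h z.1 : ℝ)).indicator (1 : ℝ → ℝ≥0∞) z.2) =
        {z : ℝ × ℝ | z.2 ≤ (h z.1 : ℝ)}.indicator 1 := by
      ext z; simp [Set.indicator]
    rw [e]
    exact measurable_one.indicator (measurableSet_le measurable_snd (by fun_prop))
  have hcheb : ∀ b : ℝ, 0 < b → volume {y | b ≤ (h y : ℝ)} ≤ ENNReal.ofReal (b ^ (-t)) := by
    intro b hb
    have hbt : 0 < b ^ t := Real.rpow_pos_of_pos hb t
    have h2 := meas_ge_le_lintegral_div (μ := (volume : Measure ℝ))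
      (f := fun y ↦ (h y : ℝ≥0∞) ^ t) (by fun_prop) (ε := ENNReal.ofReal (b ^ t))
      (by simpa using hbt) ENNReal.ofReal_ne_top
    refine (measure_mono fun y hy ↦ ?_).trans (h2.trans ?_)
    · rw [Set.mem_ofPred_eq] at hy ⊢
      rw [← ENNReal.ofReal_coe_nnreal, ENNReal.ofReal_rpow_of_nonneg (h y).coe_nonneg ht0.le]
      gcongr
    · rw [Real.rpow_neg hb.le, ENNReal.ofReal_inv_of_pos hbt, ← one_div]
      gcongr
  calc _ = ∫⁻ y, ∫⁻ b in Set.Ioc (0 : ℝ) A, (Set.Iic (h y : ℝ)).indicator 1 b * K y := by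
        refine lintegral_congr fun y ↦ ?_
        rw [coe_min_eq_lintegral, lintegral_mul_const _ (measurable_one.indicator measurableSet_Iic)]
    _ = ∫⁻ b in Set.Ioc (0 : ℝ) A, ∫⁻ y, (Set.Iic (h y : ℝ)).indicator 1 b * K y :=
        lintegral_lintegral_swap (hset.mul (hK.comp measurable_fst)).aemeasurable
    _ ≤ ∫⁻ b in Set.Ioc (0 : ℝ) A, c * ENNReal.ofReal (b ^ (-(t * (1 - α)))) := by
        refine setLIntegral_mono' measurableSet_Ioc fun b hb ↦ ?_
        have hE : MeasurableSet {y | b ≤ (h y : ℝ)} := measurableSet_le measurable_const (by fun_prop)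
        calc _ = ∫⁻ y in {y | b ≤ (h y : ℝ)}, K y := by
              rw [← lintegral_indicator hE]
              refine lintegral_congr fun y ↦ ?_
              simp [Set.indicator]
          _ ≤ c * volume {y | b ≤ (h y : ℝ)} ^ (1 - α) := setLIntegral_riesz_le h0 h1 _ x
          _ ≤ c * ENNReal.ofReal (b ^ (-t)) ^ (1 - α) := by
              have : 0 ≤ 1 - α := by linarith
              gcongr
              exact hcheb b hb.1
          _ = _ := by
              rw [ENNReal.ofReal_rpow_of_nonneg (Real.rpow_nonneg hb.1.le _) (by linarith),
                ← Real.rpow_mul hb.1.le, neg_mul]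
    _ = _ := by
        rw [lintegral_const_mul _ (by fun_prop),
          setLIntegral_Ioc_rpow A.coe_nonneg (by linarith), mul_assoc, neg_add_eq_sub,
          div_eq_mul_inv, mul_comm (_ ^ _), ENNReal.ofReal_mul (by
            have : 0 < 1 - t * (1 - α) := by linarith
            positivity), one_div, ← ENNReal.ofReal_rpow_of_nonneg A.coe_nonneg (by linarith),
          ENNReal.ofReal_coe_nnreal]

/-- The Hardy–Littlewood–Sobolev inequality on the line in normalised bilinear form. -/
theorem exists_lintegral_lintegral_riesz_le {α s t : ℝ} (h0 : 0 < α) (h1 : α < 1) (hs : 1 < s)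
    (ht : 1 < t) (hst : 1 / s + 1 / t + α = 2) : ∃ C : ℝ≥0, ∀ f h : ℝ → ℝ≥0, Measurable f →
      Measurable h → ∫⁻ y, (f y : ℝ≥0∞) ^ s ≤ 1 → ∫⁻ y, (h y : ℝ≥0∞) ^ t ≤ 1 →
        ∫⁻ x, (∫⁻ y, ENNReal.ofReal (|x - y| ^ (-α)) * f y) * h x ≤ C := by
  have hs1 : 1 / s < 1 := by rw [div_lt_one] <;> linarith
  have ht1 : 1 / t < 1 := by rw [div_lt_one] <;> linarith
  have hta : t * (1 - α) = 1 - t / s * (s - 1) := by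
    rw [show 1 - α = 1 / s + 1 / t - 1 by linarith]; field_simp; ring
  have hsa : s * (1 - α) = 1 - s / t * (t - 1) := by
    rw [show 1 - α = 1 / s + 1 / t - 1 by linarith]; field_simp; ring
  have ht' : t * (1 - α) < 1 := by
    rw [hta]
    have : 0 < t / s * (s - 1) := mul_pos (by positivity) (by linarith)
    linarith
  have hs' : s * (1 - α) < 1 := by
    rw [hsa]
    have : 0 < s / t * (t - 1) := mul_pos (by positivity) (by linarith)
    linarith
  obtain ⟨C1, hC1⟩ := exists_lintegral_min_mul_riesz_le h0 h1 (by linarith) ht'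
  obtain ⟨C2, hC2⟩ := exists_lintegral_min_mul_riesz_le h0 h1 (by linarith) hs'
  refine ⟨C1 + C2, fun f h hf hh hfn hhn ↦ ?_⟩
  -- The threshold b = a^(s/t) compares the normalised densities a^s and b^t: the smaller one is
  -- truncated at the level set by the larger.
  have hsplit : ∀ a b : ℝ≥0, a * b ≤ a * min b (a ^ (s / t)) + b * min a (b ^ (t / s)) := by
    intro a b
    rcases le_total b (a ^ (s / t)) with h | h
    · rw [min_eq_left h]; exact le_self_add
    · have : a ≤ b ^ (t / s) := by
        have h2 := NNReal.rpow_le_rpow h (by positivity : 0 ≤ t / s)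
        rwa [← NNReal.rpow_mul, show s / t * (t / s) = 1 by field_simp, NNReal.rpow_one] at h2
      rw [min_eq_left this, mul_comm b a]; exact le_add_self
  set K : ℝ → ℝ → ℝ≥0∞ := fun x y ↦ ENNReal.ofReal (|x - y| ^ (-α)) with hKdef
  have hKs : ∀ x y, K x y = K y x := fun x y ↦ by simp only [hKdef, abs_sub_comm]
  have hKm : Measurable (Function.uncurry K) := by
    simp only [hKdef]; unfold Function.uncurry; fun_prop
  -- The truncated estimate raises the level to a power that, by scaling, restores exactly the σ-th
  -- power of z, so each term ends in a normalised integral.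
  have hfin : ∀ {σ τ : ℝ}, 1 < σ → 0 < τ → τ * (1 - α) = 1 - τ / σ * (σ - 1) → ∀ z : ℝ≥0,
      (z : ℝ≥0∞) * ((z ^ (σ / τ) : ℝ≥0) : ℝ≥0∞) ^ (1 - τ * (1 - α)) = (z : ℝ≥0∞) ^ σ := by
    intro σ τ hσ hτ e z
    have h2 : 0 < τ / σ * (σ - 1) := mul_pos (by positivity) (by linarith)
    have h3 : 0 ≤ σ / τ * (1 - τ * (1 - α)) := by rw [e, sub_sub_cancel]; positivity
    conv_lhs => enter [1]; rw [← ENNReal.rpow_one (z : ℝ≥0∞)]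
    rw [ENNReal.coe_rpow_of_nonneg _ (by positivity), ← ENNReal.rpow_mul,
      ← ENNReal.rpow_add_of_nonneg _ _ zero_le_one h3, e]
    congr 1
    field_simp
    ring
  calc _ = ∫⁻ x, ∫⁻ y, ((f y * h x : ℝ≥0) : ℝ≥0∞) * K x y := by
        refine lintegral_congr fun x ↦ ?_
        rw [← lintegral_mul_const _ (by fun_prop)]
        refine lintegral_congr fun y ↦ ?_
        push_cast; ring
    _ ≤ ∫⁻ x, ∫⁻ y, (((f y * min (h x) (f y ^ (s / t)) : ℝ≥0) : ℝ≥0∞) * K x y +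
          ((h x * min (f y) (h x ^ (t / s)) : ℝ≥0) : ℝ≥0∞) * K x y) := by
        refine lintegral_mono fun x ↦ lintegral_mono fun y ↦ ?_
        rw [← add_mul]
        gcongr
        rw [← ENNReal.coe_add, ENNReal.coe_le_coe]
        exact hsplit _ _
    _ = (∫⁻ x, ∫⁻ y, ((f y * min (h x) (f y ^ (s / t)) : ℝ≥0) : ℝ≥0∞) * K x y) +
          ∫⁻ x, ∫⁻ y, ((h x * min (f y) (h x ^ (t / s)) : ℝ≥0) : ℝ≥0∞) * K x y := by
        rw [← lintegral_add_left (by unfold Function.uncurry at hKm; fun_prop)]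
        refine lintegral_congr fun x ↦ ?_
        rw [← lintegral_add_left (by simp only [hKdef]; fun_prop)]
    _ ≤ C1 * (∫⁻ y, (f y : ℝ≥0∞) ^ s) + C2 * ∫⁻ x, (h x : ℝ≥0∞) ^ t := by
        refine add_le_add ?_ ?_
        · rw [lintegral_lintegral_swap (by unfold Function.uncurry at *; fun_prop),
            ← lintegral_const_mul _ (by fun_prop)]
          refine lintegral_mono fun y ↦ ?_
          dsimp only
          calc _ = (f y : ℝ≥0∞) * ∫⁻ x, ((min (h x) (f y ^ (s / t)) : ℝ≥0) : ℝ≥0∞) * K y x := by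
                rw [← lintegral_const_mul _ (by simp only [hKdef]; fun_prop)]
                refine lintegral_congr fun x ↦ ?_
                rw [hKs y x, ENNReal.coe_mul, mul_assoc]
            _ ≤ (f y : ℝ≥0∞) * (C1 * ((f y ^ (s / t) : ℝ≥0) : ℝ≥0∞) ^ (1 - t * (1 - α))) := by
                gcongr
                exact hC1 h hh hhn _ _
            _ = _ := by
                rw [mul_left_comm, hfin hs (by linarith) hta]
        · rw [← lintegral_const_mul _ (by fun_prop)]
          refine lintegral_mono fun x ↦ ?_
          dsimp only
          calc _ = (h x : ℝ≥0∞) * ∫⁻ y, ((min (f y) (h x ^ (t / s)) : ℝ≥0) : ℝ≥0∞) * K x y := by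
                rw [← lintegral_const_mul _ (by simp only [hKdef]; fun_prop)]
                refine lintegral_congr fun y ↦ ?_
                rw [ENNReal.coe_mul, mul_assoc]
            _ ≤ (h x : ℝ≥0∞) * (C2 * ((h x ^ (t / s) : ℝ≥0) : ℝ≥0∞) ^ (1 - s * (1 - α))) := by
                gcongr
                exact hC2 f hf hfn _ _
            _ = _ := by
                rw [mul_left_comm, hfin ht (by linarith) hsa]
    _ ≤ C1 * 1 + C2 * 1 := by gcongr
    _ = _ := by simp

end HardyLittlewoodSobolev

/-! ### The inequalities of Hardy–Littlewood–Sobolev and Minkowski in norm form -/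

section Minkowski

theorem lintegral_rpow_inv_le_of_forall_dual {g : ℝ → ℝ≥0∞} (hg : AEMeasurable g) {q q' : ℝ}
    (hqq : q.HolderConjugate q') {M : ℝ≥0∞}
    (H : ∀ h : ℝ → ℝ≥0, Measurable h → ∫⁻ x, (h x : ℝ≥0∞) ^ q' ≤ 1 → ∫⁻ x, g x * h x ≤ M) :
    (∫⁻ x, g x ^ q) ^ (1 / q) ≤ M := by
  rw [one_div, ENNReal.rpow_inv_le_iff hqq.pos]
  have e : ∫⁻ x, g x ^ q = ∫⁻ x, hg.mk g x ^ q :=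
    lintegral_congr_ae (by filter_upwards [hg.ae_eq_mk] with x hx; rw [hx])
  rw [e]
  refine lintegral_rpow_le_of_forall_dual hg.measurable_mk hqq fun h hh hn ↦ ?_
  refine le_trans (le_of_eq (lintegral_congr_ae ?_)) (H h hh hn)
  filter_upwards [hg.ae_eq_mk] with x hx
  rw [hx]

/-- The Hardy–Littlewood–Sobolev inequality on the line. -/
theorem exists_lintegral_riesz_rpow_le {α s q : ℝ} (h0 : 0 < α) (h1 : α < 1) (hs : 1 < s)
    (hq : 1 < q) (hsq : 1 / s + α = 1 + 1 / q) : ∃ C : ℝ≥0, ∀ f : ℝ → ℝ≥0, AEMeasurable f →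
      (∫⁻ x, (∫⁻ y, ENNReal.ofReal (|x - y| ^ (-α)) * f y) ^ q) ^ (1 / q) ≤
        C * (∫⁻ y, (f y : ℝ≥0∞) ^ s) ^ (1 / s) := by
  have hs0 : 0 < s := by linarith
  have hq0 : 0 < q := by linarith
  have hqq := Real.HolderConjugate.conjExponent hq
  have e1 : 1 / s + 1 / q.conjExponent + α = 2 := by
    have := hqq.inv_add_inv_eq_one
    rw [one_div, one_div] at *
    linarith
  obtain ⟨C, hC⟩ := exists_lintegral_lintegral_riesz_le h0 h1 hs hqq.symm.lt e1
  -- A nonzero constant makes the right-hand side infinite when the norm of f is.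
  refine ⟨C + 1, fun f hfae ↦ ?_⟩
  wlog hf : Measurable f generalizing f with Hf
  · obtain ⟨g, hg, hfg⟩ := hfae
    have h2 := Hf g hg.aemeasurable hg
    have e3 : ∀ x, ∫⁻ y, ENNReal.ofReal (|x - y| ^ (-α)) * f y =
        ∫⁻ y, ENNReal.ofReal (|x - y| ^ (-α)) * g y := fun x ↦
      lintegral_congr_ae (by filter_upwards [hfg] with y hy; rw [hy])
    have e4 : ∫⁻ y, (f y : ℝ≥0∞) ^ s = ∫⁻ y, (g y : ℝ≥0∞) ^ s :=
      lintegral_congr_ae (by filter_upwards [hfg] with y hy; rw [hy])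
    simp_rw [e3, e4]
    exact h2
  set N := ∫⁻ y, (f y : ℝ≥0∞) ^ s
  by_cases hN0 : N = 0
  · have hz : ∀ᵐ y, f y = 0 := by
      have := (lintegral_eq_zero_iff (by fun_prop)).1 hN0
      filter_upwards [this] with y hy
      simpa [hs0, hs0.le] using hy
    have e3 : ∀ x, ∫⁻ y, ENNReal.ofReal (|x - y| ^ (-α)) * f y = 0 := fun x ↦ by
      rw [← lintegral_zero (μ := (volume : Measure ℝ))]
      refine lintegral_congr_ae ?_
      filter_upwards [hz] with y hy
      simp [hy]
    simp_rw [e3]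
    simp [hq0]
  by_cases hNt : N = ∞
  · rw [hNt, ENNReal.top_rpow_of_pos (by positivity), ENNReal.mul_top (by simp)]
    exact le_top
  set a := N ^ (1 / s) with ha
  have ha0 : a ≠ 0 := by simp [ha, hN0, hNt]
  have hat : a ≠ ∞ := by finiteness
  have hainv : a⁻¹ ≠ ∞ := ENNReal.inv_ne_top.2 ha0
  set f' : ℝ → ℝ≥0 := fun y ↦ f y * (a⁻¹).toNNReal with hf'
  have hf'c : ∀ y, (f' y : ℝ≥0∞) = f y * a⁻¹ := fun y ↦ by
    rw [hf', ENNReal.coe_mul, ENNReal.coe_toNNReal hainv]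
  have hn : ∫⁻ y, (f' y : ℝ≥0∞) ^ s ≤ 1 := by
    have e3 : ∀ y, (f' y : ℝ≥0∞) ^ s = (f y : ℝ≥0∞) ^ s * N⁻¹ := fun y ↦ by
      rw [hf'c, ENNReal.mul_rpow_of_nonneg _ _ hs0.le, ENNReal.inv_rpow, ha, ← ENNReal.rpow_mul,
        one_div, inv_mul_cancel₀ hs0.ne', ENNReal.rpow_one]
    simp_rw [e3]
    rw [lintegral_mul_const _ (by fun_prop), ENNReal.mul_inv_cancel hN0 hNt]
  have key : (∫⁻ x, (∫⁻ y, ENNReal.ofReal (|x - y| ^ (-α)) * f' y) ^ q) ^ (1 / q) ≤ C :=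
    lintegral_rpow_inv_le_of_forall_dual (by fun_prop) hqq fun h hh hhn ↦
      hC f' h (by fun_prop) hh hn hhn
  have e5 : ∀ x, ∫⁻ y, ENNReal.ofReal (|x - y| ^ (-α)) * f y =
      (∫⁻ y, ENNReal.ofReal (|x - y| ^ (-α)) * f' y) * a := by
    intro x
    rw [← lintegral_mul_const _ (by fun_prop)]
    refine lintegral_congr fun y ↦ ?_
    rw [hf'c, mul_assoc, mul_assoc, ENNReal.inv_mul_cancel ha0 hat, mul_one]
  simp_rw [e5, ENNReal.mul_rpow_of_nonneg _ _ hq0.le]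
  rw [lintegral_mul_const _ (by fun_prop), ENNReal.mul_rpow_of_nonneg _ _ (by positivity),
    ← ENNReal.rpow_mul, mul_one_div_cancel hq0.ne', ENNReal.rpow_one]
  gcongr
  exact key.trans (by simp)

/-- Minkowski's integral inequality. -/
theorem lintegral_rpow_lintegral_le {k : ℝ × ℝ → ℝ≥0∞} (hk : AEMeasurable k (volume.prod volume))
    {q : ℝ} (hq : 1 < q) {f : ℝ → ℝ≥0∞}
    (hf : ∀ τ, (∫⁻ t, k (t, τ) ^ q) ^ (1 / q) ≤ f τ) :
    (∫⁻ t, (∫⁻ τ, k (t, τ)) ^ q) ^ (1 / q) ≤ ∫⁻ τ, f τ := by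
  have hqq := Real.HolderConjugate.conjExponent hq
  refine lintegral_rpow_inv_le_of_forall_dual hk.lintegral_prod_right' hqq fun h hh hn ↦ ?_
  have hsec : ∀ᵐ τ : ℝ, AEMeasurable (fun t ↦ k (t, τ)) := by
    filter_upwards [hk.aestronglyMeasurable.prod_swap.prodMk_left] with τ hτ
    exact hτ.aemeasurable
  have hsec' : ∀ᵐ t : ℝ, AEMeasurable (fun τ ↦ k (t, τ)) := by
    filter_upwards [hk.aestronglyMeasurable.prodMk_left] with t ht
    exact ht.aemeasurable
  calc _ = ∫⁻ t, ∫⁻ τ, k (t, τ) * h t := by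
        refine lintegral_congr_ae ?_
        filter_upwards [hsec'] with t ht
        rw [lintegral_mul_const'' _ ht]
    _ = ∫⁻ τ, ∫⁻ t, k (t, τ) * h t :=
        lintegral_lintegral_swap (hk.mul (by fun_prop))
    _ ≤ ∫⁻ τ, f τ := by
        refine lintegral_mono_ae ?_
        filter_upwards [hsec] with τ hτ
        refine (ENNReal.lintegral_mul_le_Lp_mul_Lq volume hqq hτ (by fun_prop)).trans ?_
        calc _ ≤ f τ * 1 := by
              gcongr
              · exact hf τ
              · exact ENNReal.rpow_le_one hn (by have := hqq.symm.pos; positivity)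
          _ = f τ := mul_one _

end Minkowski

/-! ### Retarded integrals: measurability, convergence, fractional integration -/

section Duhamel

variable {β : ℝ} {κ : ℝ → R3 → ℂ} {p r : ℝ≥0∞} [Fact (1 ≤ p)] [Fact (1 ≤ r)]
  {F : ℝ → Lp ℂ p (volume : Measure R3)}

/-- The retarded integral `∫_{τ < t} κ_{t - τ} * F(τ) dτ`. -/
noncomputable def duhamel (p r : ℝ≥0∞) [Fact (1 ≤ p)] [Fact (1 ≤ r)] (κ : ℝ → R3 → ℂ)
    (F : ℝ → Lp ℂ p (volume : Measure R3)) (t : ℝ) : Lp ℂ r (volume : Measure R3) :=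
  ∫ τ in Set.Iio t, convOp p r (κ (t - τ)) (F τ)

/-- The integrand of the retarded integral as a function of both times. -/
noncomputable def duhamelIntegrand (p r : ℝ≥0∞) [Fact (1 ≤ p)] [Fact (1 ≤ r)] (κ : ℝ → R3 → ℂ)
    (F : ℝ → Lp ℂ p (volume : Measure R3)) : ℝ × ℝ → Lp ℂ r (volume : Measure R3) :=
  {z : ℝ × ℝ | z.2 < z.1}.indicator fun z ↦ convOp p r (κ (z.1 - z.2)) (F z.2)

theorem duhamelIntegrand_apply (t τ : ℝ) : duhamelIntegrand p r κ F (t, τ) =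
    (Set.Iio t).indicator (fun τ ↦ convOp p r (κ (t - τ)) (F τ)) τ := by
  simp [duhamelIntegrand, Set.indicator]

theorem duhamel_eq_integral (t : ℝ) :
    duhamel p r κ F t = ∫ τ, duhamelIntegrand p r κ F (t, τ) := by
  simp_rw [duhamelIntegrand_apply]
  rw [integral_indicator measurableSet_Iio, duhamel]

theorem enorm_duhamel_le (t : ℝ) :
    ‖duhamel p r κ F t‖ₑ ≤ ∫⁻ τ, ‖duhamelIntegrand p r κ F (t, τ)‖ₑ := by
  rw [duhamel_eq_integral]
  exact enorm_integral_le_lintegral_enorm _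

theorem setLIntegral_Icc_riesz_lt_top {α : ℝ} (h0 : 0 ≤ α) (h1 : α < 1) (T : ℝ) :
    ∃ K : ℝ≥0, ∀ τ, ∫⁻ t in Set.Icc 0 T, ENNReal.ofReal (|t - τ| ^ (-α)) ≤ K := by
  -- Without singularity (α = 0) the integral is the length of the interval; the Riesz estimate
  -- needs α > 0.
  rcases h0.eq_or_lt with rfl | h0
  · refine ⟨(ENNReal.ofReal T).toNNReal, fun τ ↦ ?_⟩
    simp
  · refine ⟨(ENNReal.ofReal (2 / (1 - α) + 1) * volume (Set.Icc 0 T) ^ (1 - α)).toNNReal,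
      fun τ ↦ ?_⟩
    rw [ENNReal.coe_toNNReal]
    · simp_rw [abs_sub_comm _ τ]
      exact setLIntegral_riesz_le h0 h1 _ τ
    · rw [Real.volume_Icc]
      have : 0 ≤ 1 - α := by linarith
      finiteness

namespace HeatFamily

theorem aestronglyMeasurable_duhamelIntegrand (h : HeatFamily β κ) (hpr : p ≤ r) (hr : r ≠ ∞)
    (hF : AEStronglyMeasurable F) :
    AEStronglyMeasurable (duhamelIntegrand p r κ F) (volume.prod volume) := by
  have hs : MeasurableSet {z : ℝ × ℝ | z.2 < z.1} := measurableSet_lt measurable_snd measurable_fst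
  refine (aestronglyMeasurable_indicator_iff hs).2 ?_
  refine h.aestronglyMeasurable_convOp (g := fun z : ℝ × ℝ ↦ z.1 - z.2) hpr hr (by fun_prop) ?_
    (hF.comp_snd.restrict)
  filter_upwards [ae_restrict_mem hs] with z hz
  exact sub_pos.2 hz

theorem aestronglyMeasurable_duhamel (h : HeatFamily β κ) (hpr : p ≤ r) (hr : r ≠ ∞)
    (hF : AEStronglyMeasurable F) : AEStronglyMeasurable (duhamel p r κ F) volume := by
  have e : duhamel p r κ F = fun t ↦ ∫ τ, duhamelIntegrand p r κ F (t, τ) :=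
    funext duhamel_eq_integral
  rw [e]
  exact (h.aestronglyMeasurable_duhamelIntegrand hpr hr hF).integral_prod_right'

theorem exists_enorm_duhamelIntegrand_le (h : HeatFamily β κ) (hpr : p ≤ r) (hr : r ≠ ∞) :
    ∃ A : ℝ≥0, ∀ (F : ℝ → Lp ℂ p (volume : Measure R3)) (t τ : ℝ),
      ‖duhamelIntegrand p r κ F (t, τ)‖ₑ ≤
        A * (ENNReal.ofReal (|t - τ| ^ (-(β + 3 / 2 * expGap p r))) * ‖F τ‖ₑ) := by
  obtain ⟨A, hA⟩ := h.exists_enorm_convOp_le hpr hr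
  refine ⟨A, fun F t τ ↦ ?_⟩
  rw [duhamelIntegrand_apply]
  by_cases ht : τ ∈ Set.Iio t
  · rw [Set.indicator_of_mem ht, abs_of_pos (sub_pos.2 ht), ← mul_assoc]
    exact hA _ (sub_pos.2 ht) _
  · rw [Set.indicator_of_notMem ht]; simp

/-- The retarded integral converges absolutely at almost every time. -/
theorem ae_integrableOn_convOp (h : HeatFamily β κ) (hpr : p ≤ r) (hr : r ≠ ∞)
    (hα : β + 3 / 2 * expGap p r < 1) (hF : Integrable F) (T : ℝ) :
    ∀ᵐ t ∂(timeMeasure T), IntegrableOn (fun τ ↦ convOp p r (κ (t - τ)) (F τ)) (Set.Iio t) := by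
  have hα0 : 0 ≤ β + 3 / 2 * expGap p r := by
    have := expGap_nonneg (p := p) Fact.out hpr hr
    have := h.nonneg
    positivity
  obtain ⟨A, hA⟩ := h.exists_enorm_duhamelIntegrand_le (p := p) hpr hr
  obtain ⟨K, hK⟩ := setLIntegral_Icc_riesz_lt_top hα0 hα T
  have hm := h.aestronglyMeasurable_duhamelIntegrand hpr hr hF.1
  set α := β + 3 / 2 * expGap p r
  -- By Tonelli the t-integral of t ↦ |t - τ|^(-α) is bounded uniformly in τ, because α < 1 is
  -- locally integrable. Finiteness of the double integral gives it for almost every t.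
  have hfin : ∫⁻ t in Set.Icc 0 T, ∫⁻ τ, ‖duhamelIntegrand p r κ F (t, τ)‖ₑ ≠ ∞ := by
    refine ne_top_of_le_ne_top (b := A * (K * ∫⁻ τ, ‖F τ‖ₑ))
      (by have := hF.2.ne; finiteness) ?_
    calc _ ≤ ∫⁻ t in Set.Icc 0 T, ∫⁻ τ, A * (ENNReal.ofReal (|t - τ| ^ (-α)) * ‖F τ‖ₑ) :=
          lintegral_mono fun t ↦ lintegral_mono fun τ ↦ hA F t τ
      _ = ∫⁻ τ, ∫⁻ t in Set.Icc 0 T, A * (ENNReal.ofReal (|t - τ| ^ (-α)) * ‖F τ‖ₑ) := by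
          refine lintegral_lintegral_swap ?_
          have h1 : AEMeasurable (fun z : ℝ × ℝ ↦ ‖F z.2‖ₑ)
              ((volume.restrict (Set.Icc 0 T)).prod volume) := hF.1.enorm.comp_snd
          have h2 : Measurable fun z : ℝ × ℝ ↦ ENNReal.ofReal (|z.1 - z.2| ^ (-α)) := by fun_prop
          exact (h2.aemeasurable.mul h1).const_mul _
      _ = ∫⁻ τ, A * ((∫⁻ t in Set.Icc 0 T, ENNReal.ofReal (|t - τ| ^ (-α))) * ‖F τ‖ₑ) := by
          refine lintegral_congr fun τ ↦ ?_
          rw [lintegral_const_mul _ (by fun_prop), lintegral_mul_const _ (by fun_prop)]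
      _ ≤ ∫⁻ τ, A * (K * ‖F τ‖ₑ) := by
          gcongr with τ
          exact hK τ
      _ = _ := by
          rw [lintegral_const_mul'' _ (hF.1.enorm.const_mul _), lintegral_const_mul'' _ hF.1.enorm]
  have hm' : AEMeasurable (fun t ↦ ∫⁻ τ, ‖duhamelIntegrand p r κ F (t, τ)‖ₑ) volume :=
    hm.enorm.lintegral_prod_right'
  have hsec : ∀ᵐ t : ℝ, AEStronglyMeasurable (fun τ ↦ duhamelIntegrand p r κ F (t, τ)) :=
    hm.prodMk_left
  filter_upwards [ae_lt_top' hm'.restrict hfin, ae_restrict_of_ae hsec] with t ht hts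
  rw [← integrable_indicator_iff measurableSet_Iio]
  have hi : Integrable fun τ ↦ duhamelIntegrand p r κ F (t, τ) :=
    ⟨hts, hasFiniteIntegral_iff_enorm.2 ht⟩
  exact hi.congr (.of_forall fun τ ↦ duhamelIntegrand_apply t τ)

/-- Estimate of the retarded integral by fractional integration in time. -/
theorem exists_eLpNorm_duhamel_le (h : HeatFamily β κ) (hpr : p ≤ r) (hr : r ≠ ∞)
    (hα0 : 0 < β + 3 / 2 * expGap p r) (hα : β + 3 / 2 * expGap p r < 1) {s q : ℝ≥0∞}
    (hs : 1 < s.toReal) (hq : 1 < q.toReal)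
    (hsq : 1 / s.toReal + (β + 3 / 2 * expGap p r) = 1 + 1 / q.toReal) :
    ∃ C : ℝ≥0, ∀ F : ℝ → Lp ℂ p (volume : Measure R3), AEStronglyMeasurable F →
      eLpNorm (duhamel p r κ F) q volume ≤ C * eLpNorm F s volume := by
  have hs0 : s ≠ 0 ∧ s ≠ ∞ := by
    constructor <;> rintro rfl <;> simp at hs <;> linarith
  have hq0 : q ≠ 0 ∧ q ≠ ∞ := by
    constructor <;> rintro rfl <;> simp at hq <;> linarith
  obtain ⟨A, hA⟩ := h.exists_enorm_duhamelIntegrand_le (p := p) hpr hr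
  obtain ⟨C, hC⟩ := exists_lintegral_riesz_rpow_le hα0 hα hs hq hsq
  refine ⟨A * C, fun F hF ↦ ?_⟩
  rw [eLpNorm_eq_lintegral_rpow_enorm_toReal hq0.1 hq0.2,
    eLpNorm_eq_lintegral_rpow_enorm_toReal hs0.1 hs0.2]
  have hC' := hC (fun τ ↦ ‖F τ‖₊) hF.nnnorm.aemeasurable
  set α := β + 3 / 2 * expGap p r
  have hK : AEMeasurable (fun t ↦ ∫⁻ τ, ENNReal.ofReal (|t - τ| ^ (-α)) * ‖F τ‖ₑ) volume := by
    have h1 : AEMeasurable (fun z : ℝ × ℝ ↦ ‖F z.2‖ₑ) (volume.prod volume) := hF.enorm.comp_snd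
    have h2 : Measurable fun z : ℝ × ℝ ↦ ENNReal.ofReal (|z.1 - z.2| ^ (-α)) := by fun_prop
    exact (h2.aemeasurable.mul h1).lintegral_prod_right'
  calc _ ≤ (∫⁻ t, (A * ∫⁻ τ, ENNReal.ofReal (|t - τ| ^ (-α)) * ‖F τ‖ₑ) ^ q.toReal) ^
        (1 / q.toReal) := by
        gcongr with t
        refine (enorm_duhamel_le t).trans ((lintegral_mono fun τ ↦ hA F t τ).trans ?_)
        rw [lintegral_const_mul'' _ (by
          have h1 := hF.enorm
          fun_prop)]
    _ = A * (∫⁻ t, (∫⁻ τ, ENNReal.ofReal (|t - τ| ^ (-α)) * ‖F τ‖ₑ) ^ q.toReal) ^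
        (1 / q.toReal) := by
        simp_rw [ENNReal.mul_rpow_of_nonneg _ _ ENNReal.toReal_nonneg]
        rw [lintegral_const_mul'' _ (hK.pow_const _), ENNReal.mul_rpow_of_nonneg _ _ (by positivity),
          ← ENNReal.rpow_mul, mul_one_div_cancel (by linarith), ENNReal.rpow_one]
    _ ≤ A * (C * (∫⁻ y, (‖F y‖ₑ : ℝ≥0∞) ^ s.toReal) ^ (1 / s.toReal)) := by
        gcongr
        exact hC'
    _ = _ := by rw [ENNReal.coe_mul, mul_assoc]

end HeatFamily

end Duhamel

/-! ### Retarded integrals as distributions and the Duhamel property -/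

section Pairing

variable {β : ℝ} {κ : ℝ → R3 → ℂ} {p r : ℝ≥0∞} [Fact (1 ≤ p)] [Fact (1 ≤ r)]
  {F : ℝ → Lp ℂ p (volume : Measure R3)}

/-- Pairing with a test function as a continuous functional on `L^r`. -/
noncomputable def pairingCLM (r : ℝ≥0∞) [Fact (1 ≤ r)] (φ : 𝓢(R3, ℂ)) :
    Lp ℂ r (volume : Measure R3) →L[ℂ] ℂ :=
  (PointwiseConvergenceCLM.evalCLM _ ℂ φ).comp (Lp.toTemperedDistributionCLM ℂ volume r)

theorem pairingCLM_apply (φ : 𝓢(R3, ℂ)) (f : Lp ℂ r (volume : Measure R3)) :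
    pairingCLM r φ f = (f : 𝓢'(R3, ℂ)) φ := rfl

theorem duhamel_apply {t : ℝ}
    (h : IntegrableOn (fun τ ↦ convOp p r (κ (t - τ)) (F τ)) (Set.Iio t)) (φ : 𝓢(R3, ℂ)) :
    (duhamel p r κ F t : 𝓢'(R3, ℂ)) φ =
      ∫ τ in Set.Iio t, ((convOp p r (κ (t - τ)) (F τ) : Lp ℂ r (volume : Measure R3)) :
        𝓢'(R3, ℂ)) φ := by
  rw [← pairingCLM_apply, duhamel, ← ContinuousLinearMap.integral_comp_comm _ h]
  rfl

/-- Pairing the retarded integral with a test function by means of the kernels. -/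
theorem HeatFamily.duhamel_apply (h : HeatFamily β κ) (hpr : p ≤ r) (hr : r ≠ ∞) {t : ℝ}
    (hint : IntegrableOn (fun τ ↦ convOp p r (κ (t - τ)) (F τ)) (Set.Iio t)) (φ : 𝓢(R3, ℂ)) :
    (duhamel p r κ F t : 𝓢'(R3, ℂ)) φ =
      ∫ τ in Set.Iio t, ∫ y, F τ y * ∫ x, φ x * κ (t - τ) (x - y) := by
  rw [_root_.duhamel_apply hint]
  refine setIntegral_congr_fun measurableSet_Iio fun τ hτ ↦ ?_
  exact (h.goodKernel (sub_pos.2 hτ)).convOp_toTemperedDistribution hpr hr _ φ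

theorem exists_enorm_convOp_heatKernel_le {ω : ℂ} (hω : 0 < ω.re) (hp : p ≠ ∞) :
    ∃ A : ℝ≥0, ∀ t : ℝ, 0 < t → ∀ f : Lp ℂ p (volume : Measure R3),
      ‖convOp p p (heatKernel (t * ω)) f‖ₑ ≤ A * ‖f‖ₑ := by
  obtain ⟨A, hA⟩ := (heatFamily_heatKernel hω).exists_enorm_convOp_le (p := p) le_rfl hp
  refine ⟨A, fun t ht f ↦ ?_⟩
  have := hA t ht f
  simpa [expGap] using this

/-- From L^p to itself the flow is uniformly bounded, so convergence holds at every t. Hence the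
distributional solution is defined in L^p at all times, whereas membership in L^r is available only
at almost every time. -/
theorem integrableOn_convOp_heatKernel {ω : ℂ} (hω : 0 < ω.re) (hp : p ≠ ∞) (hF : Integrable F)
    (t : ℝ) :
    IntegrableOn (fun τ ↦ convOp p p (heatKernel (((t - τ : ℝ) : ℂ) * ω)) (F τ)) (Set.Iio t) := by
  obtain ⟨A, hA⟩ := exists_enorm_convOp_heatKernel_le (p := p) hω hp
  refine ⟨(heatFamily_heatKernel hω).aestronglyMeasurable_convOp (g := fun τ ↦ t - τ) le_rfl hp
    (by fun_prop) ?_ hF.1.restrict, ?_⟩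
  · filter_upwards [ae_restrict_mem measurableSet_Iio] with τ hτ using sub_pos.2 hτ
  · rw [hasFiniteIntegral_iff_enorm]
    calc _ ≤ ∫⁻ τ in Set.Iio t, A * ‖F τ‖ₑ :=
          setLIntegral_mono' measurableSet_Iio fun τ hτ ↦ hA _ (sub_pos.2 hτ) _
      _ ≤ ∫⁻ τ, A * ‖F τ‖ₑ := setLIntegral_le_lintegral _ _
      _ = A * ∫⁻ τ, ‖F τ‖ₑ := lintegral_const_mul'' _ hF.1.enorm
      _ < ∞ := ENNReal.mul_lt_top (by simp) hF.2

/-- The retarded integral of the heat-Schrödinger flow solves the Duhamel problem. -/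
theorem isDuhamel_duhamel {ε : ℝ} (hε : 0 < ε) (hp : p ≠ ∞) (hF : Integrable F)
    (hF0 : ∀ τ < 0, F τ = 0) {t : ℝ} (ht : 0 ≤ t) :
    IsDuhamel ε t (fun τ ↦ (F τ : 𝓢'(R3, ℂ)))
      (duhamel p p (fun t ↦ heatKernel (t * (ε + Complex.I))) F t : 𝓢'(R3, ℂ)) := by
  have hω : 0 < ((ε : ℂ) + Complex.I).re := by simpa using hε
  have hint := integrableOn_convOp_heatKernel hω hp hF t
  intro φ
  have e1 : ∀ τ ∈ Set.Iio t, pairingCLM p φ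
      (convOp p p (heatKernel (((t - τ : ℝ) : ℂ) * (ε + Complex.I))) (F τ)) =
      heatSchrodinger ε (t - τ) (F τ : 𝓢'(R3, ℂ)) φ := fun τ hτ ↦ by
    rw [pairingCLM_apply, convOp_heatKernel_eq_heatSchrodinger hε (sub_pos.2 hτ) le_rfl hp]
  have hint2 : IntegrableOn (fun τ ↦ heatSchrodinger ε (t - τ) (F τ : 𝓢'(R3, ℂ)) φ)
      (Set.Iio t) :=
    IntegrableOn.congr_fun ((pairingCLM p φ).integrable_comp hint) e1 measurableSet_Iio
  have hsub : Set.Ioo 0 t ⊆ Set.Iio t := fun τ hτ ↦ hτ.2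
  refine ⟨?_, ?_⟩
  · rw [intervalIntegrable_iff_integrableOn_Ioo_of_le ht]
    exact hint2.mono_set hsub
  · rw [duhamel_apply hint, intervalIntegral.integral_of_le ht, integral_Ioc_eq_integral_Ioo]
    -- The integral over τ < t reduces to [0, t) because the source vanishes at negative times.
    have hz : ∀ τ ∈ Set.Iio t \ Set.Ico 0 t, heatSchrodinger ε (t - τ) (F τ : 𝓢'(R3, ℂ)) φ = 0 := by
      intro τ hτ
      have : τ < 0 := by
        by_contra hcon
        exact hτ.2 ⟨not_lt.1 hcon, hτ.1⟩
      rw [hF0 τ this, ← Lp.toTemperedDistributionCLM_apply, map_zero, map_zero]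
      rfl
    rw [← integral_Ico_eq_integral_Ioo, ← setIntegral_eq_of_subset_of_forall_sdiff_eq_zero
      measurableSet_Iio (fun τ hτ ↦ hτ.2) hz]
    exact setIntegral_congr_fun measurableSet_Iio e1

theorem GoodKernel.integrable_schwartz_mul {k : R3 → ℂ} (hk : GoodKernel k) (φ : 𝓢(R3, ℂ))
    (y : R3) : Integrable fun x ↦ φ x * k (x - y) := by
  obtain ⟨B, hB⟩ := hk.bdd
  refine (φ.integrable (μ := volume)).mul_bdd (c := B)
    (hk.cont.comp (continuous_id.sub continuous_const)).aestronglyMeasurable (.of_forall fun x ↦ ?_)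
  exact enorm_le_coe.1 (hB (x - y))

theorem goodKernel_heatKernelDeriv (j : Fin 3) {z : ℂ} (hz : 0 < z.re) :
    GoodKernel (heatKernelDeriv j z) := by
  have := (heatFamily_heatKernelDeriv j hz).goodKernel one_pos
  simpa using this

/-- Integration by parts against the derivative of the heat kernel. -/
theorem integral_mul_heatKernelDeriv {z : ℂ} (hz : 0 < z.re) (j : Fin 3) (φ : 𝓢(R3, ℂ)) (y : R3) :
    ∫ x, φ x * heatKernelDeriv j z (x - y) =
      -∫ x, (∂_{(EuclideanSpace.single j (1 : ℝ) : R3)} φ) x * heatKernel z (x - y) := by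
  have h1 : ∀ x, HasLineDerivAt ℝ (fun x ↦ heatKernel z (x - y)) (heatKernelDeriv j z (x - y)) x
      (EuclideanSpace.single j 1) := by
    intro x
    have := hasLineDerivAt_heatKernel (z := z) j (x - y)
    simp only [HasLineDerivAt, sub_add_eq_add_sub] at this
    exact this
  have h2 : ∀ x, HasLineDerivAt ℝ φ
      ((∂_{(EuclideanSpace.single j (1 : ℝ) : R3)} φ) x) x (EuclideanSpace.single j 1) := by
    intro x
    rw [SchwartzMap.lineDerivOp_apply_eq_fderiv]
    exact φ.differentiableAt.hasFDerivAt.hasLineDerivAt _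
  exact integral_bilinear_hasLineDerivAt_right_eq_neg_left_of_integrable
    (B := ContinuousLinearMap.mul ℝ ℂ)
    ((goodKernel_heatKernel hz).integrable_schwartz_mul _ y)
    ((goodKernel_heatKernelDeriv j hz).integrable_schwartz_mul φ y)
    ((goodKernel_heatKernel hz).integrable_schwartz_mul φ y)
    (fun x _ ↦ h2 x) (fun x _ ↦ h1 x)

/-- The retarded integral of the differentiated kernel is the distributional derivative. -/
theorem duhamel_heatKernelDeriv_apply {ω : ℂ} (hω : 0 < ω.re) (hpr : p ≤ r) (hr : r ≠ ∞)
    (hF : Integrable F) (j : Fin 3) {t : ℝ}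
    (hint : IntegrableOn (fun τ ↦ convOp p r (heatKernelDeriv j (((t - τ : ℝ) : ℂ) * ω)) (F τ))
      (Set.Iio t)) (φ : 𝓢(R3, ℂ)) :
    (duhamel p r (fun t ↦ heatKernelDeriv j (t * ω)) F t : 𝓢'(R3, ℂ)) φ =
      (∂_{(EuclideanSpace.single j (1 : ℝ) : R3)}
        (duhamel p p (fun t ↦ heatKernel (t * ω)) F t : 𝓢'(R3, ℂ)) : 𝓢'(R3, ℂ)) φ := by
  have hp : p ≠ ∞ := ne_top_of_le_ne_top hr hpr
  rw [(heatFamily_heatKernelDeriv j hω).duhamel_apply hpr hr hint,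
    TemperedDistribution.lineDerivOp_apply_apply,
    (heatFamily_heatKernel hω).duhamel_apply le_rfl hp (integrableOn_convOp_heatKernel hω hp hF t)]
  refine setIntegral_congr_fun measurableSet_Iio fun τ hτ ↦ ?_
  refine integral_congr_ae (.of_forall fun y ↦ ?_)
  dsimp only
  rw [integral_mul_heatKernelDeriv (re_ofReal_mul_pos hω (sub_pos.2 hτ)), ← integral_neg]
  congr 1
  refine integral_congr_ae (.of_forall fun x ↦ ?_)
  simp

theorem norm_star_Lp (u : L2) : ‖star u‖ = ‖u‖ := by
  have h : ∀ᵐ x, ‖(star u : L2) x‖ = ‖u x‖ := by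
    filter_upwards [Lp.coeFn_star u] with x hx
    rw [hx, Pi.star_apply, norm_star]
  exact le_antisymm (Lp.norm_le_norm_of_ae_le (h.mono fun _ hx ↦ hx.le))
    (Lp.norm_le_norm_of_ae_le (h.mono fun _ hx ↦ hx.ge))

/-- Bounding an `L²` norm by testing against Schwartz functions. -/
theorem enorm_le_of_forall_schwartz {u : L2} {M : ℝ≥0}
    (h : ∀ φ : 𝓢(R3, ℂ), ‖(u : 𝓢'(R3, ℂ)) φ‖ₑ ≤ M * ‖φ.toLp 2 (volume : Measure R3)‖ₑ) :
    ‖u‖ₑ ≤ M := by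
  -- The distribution pairing is bilinear and the inner product is conjugate linear on the left,
  -- hence the conjugate of u.
  have hs : ∀ φ : 𝓢(R3, ℂ), inner ℂ (star u) (φ.toLp 2 (volume : Measure R3)) =
      (u : 𝓢'(R3, ℂ)) φ := by
    intro φ
    rw [Lp.toTemperedDistribution_apply, L2.inner_def]
    refine integral_congr_ae ?_
    filter_upwards [Lp.coeFn_star u, φ.coeFn_toLp 2 (volume : Measure R3)] with x h1 h2
    rw [h1, h2]
    simp
  have h2 : ∀ g : L2, ‖inner ℂ (star u) g‖ ≤ M * ‖g‖ := by
    intro g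
    refine (SchwartzMap.denseRange_toLpCLM (F := ℂ) (p := 2) (μ := (volume : Measure R3))
      (by norm_num)).induction_on g (isClosed_le (by fun_prop) (by fun_prop)) fun φ ↦ ?_
    have := h φ
    rw [← hs, ← ofReal_norm, ← ofReal_norm, ← ENNReal.ofReal_coe_nnreal,
      ← ENNReal.ofReal_mul (by positivity), ENNReal.ofReal_le_ofReal_iff (by positivity)] at this
    exact this
  have h3 := h2 (star u)
  rw [inner_self_eq_norm_sq_to_K] at h3
  have h4 : ‖u‖ ^ 2 ≤ M * ‖u‖ := by simpa [norm_star_Lp] using h3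
  rw [enorm_le_coe]
  by_contra hcon
  have h5 : (M : ℝ) < ‖u‖ := by
    rw [not_le] at hcon
    exact_mod_cast hcon
  have : (0 : ℝ) ≤ M := M.coe_nonneg
  nlinarith

end Pairing

/-! ### Estimates by Minkowski and by duality, and parabolic smoothing -/

section DualEstimates

variable {ω : ℂ} {p q r s p' s' : ℝ≥0∞} [Fact (1 ≤ p)] [Fact (1 ≤ r)] [Fact (1 ≤ p')]

theorem duhamelIntegrand_heatKernel (F : ℝ → L2) (t τ : ℝ) :
    duhamelIntegrand 2 r (fun t ↦ heatKernel (t * ω)) F (t, τ) = evol r ω (F τ) (t - τ) := by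
  rw [duhamelIntegrand_apply]
  by_cases h : τ < t
  · rw [Set.indicator_of_mem (by exact h), evol_of_pos (sub_pos.2 h)]
  · rw [Set.indicator_of_notMem (by exact h), evol, Set.indicator_of_notMem (by simpa using h)]

/-- The retarded estimate for sources in `L¹L²`. -/
theorem exists_eLpNorm_duhamel_one_le (hω : 0 < ω.re) (him : ω.im = 1) (h : Admissible q r) :
    ∃ C : ℝ≥0, ∀ F : ℝ → L2, AEStronglyMeasurable F →
      eLpNorm (duhamel 2 r (fun t ↦ heatKernel (t * ω)) F) q volume ≤ C * eLpNorm F 1 volume := by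
  obtain ⟨C, hC⟩ := exists_eLpNorm_evol_le
  -- The added 1 covers q = ∞, where plain contraction with constant one is used.
  refine ⟨C + 1, fun F hF ↦ ?_⟩
  have hE : ∀ τ, eLpNorm (fun t ↦ evol r ω (F τ) (t - τ)) q volume ≤
      ((C + 1 : ℝ≥0) : ℝ≥0∞) * ‖F τ‖ₑ := fun τ ↦ by
    refine le_trans (le_of_eq ?_) ((hC ω q r hω him h (F τ)).trans (by gcongr; simp))
    exact eLpNorm_comp_measurePreserving
      (stronglyMeasurable_evol hω h.2.1 h.ne_top_right _).aestronglyMeasurable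
      (measurePreserving_sub_right volume τ)
  have hm := (heatFamily_heatKernel hω).aestronglyMeasurable_duhamelIntegrand h.2.1
    h.ne_top_right hF
  rw [eLpNorm_one_eq_lintegral_enorm]
  by_cases hq : q = ∞
  · subst hq
    rw [eLpNorm_exponent_top]
    refine eLpNormEssSup_le_of_ae_enorm_bound (.of_forall fun t ↦ ?_)
    refine (enorm_duhamel_le t).trans ?_
    rw [← lintegral_const_mul'' _ hF.enorm]
    obtain rfl := h.right_eq_two
    refine lintegral_mono fun τ ↦ ?_
    rw [duhamelIntegrand_heatKernel]
    calc _ ≤ ‖F τ‖ₑ := by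
          rw [← ofReal_norm, ← ofReal_norm]
          exact ENNReal.ofReal_le_ofReal (norm_evol_two_le hω _ _)
      _ ≤ _ := le_mul_of_one_le_left (by positivity) (by simp)
  have hq0 := h.toReal_pos hq
  rw [eLpNorm_eq_lintegral_rpow_enorm_toReal h.ne_zero_left hq,
    ← lintegral_const_mul'' _ hF.enorm]
  refine le_trans ?_ (lintegral_rpow_lintegral_le hm.enorm
    (q := q.toReal) (by linarith [h.two_le_toReal_left hq]) (f := fun τ ↦ ((C + 1 : ℝ≥0) : ℝ≥0∞) * ‖F τ‖ₑ) fun τ ↦ ?_)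
  · gcongr with t
    exact enorm_duhamel_le t
  · simp_rw [duhamelIntegrand_heatKernel]
    have := hE τ
    rwa [eLpNorm_eq_lintegral_rpow_enorm_toReal h.ne_zero_left hq] at this

/-- The kernel is even, so transposing it in the bilinear pairing gives the forward evolution of ψ
itself, without conjugation of ω. -/
theorem coeFn_evol_schwartz (hω : 0 < ω.re) (h2 : 2 ≤ r) (hr : r ≠ ∞) (ψ : 𝓢(R3, ℂ)) {σ : ℝ}
    (hσ : 0 < σ) :
    evol r ω (ψ.toLp 2 (volume : Measure R3)) σ =ᵐ[volume]
      fun y ↦ ∫ x, ψ x * heatKernel (σ * ω) (x - y) := by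
  rw [evol_of_pos hσ]
  refine ((goodKernel_heatKernel (re_ofReal_mul_pos hω hσ)).coeFn_convOp h2 hr _).trans
    (.of_forall fun y ↦ ?_)
  dsimp only
  rw [convFun_congr_ae (ψ.coeFn_toLp 2 (volume : Measure R3)), convFun]
  simp_rw [heatKernel_sub_comm _ y]

/-- Testing the retarded integral against a Schwartz function. -/
theorem enorm_setIntegral_pairing_le (hω : 0 < ω.re) (hp : p.toReal.HolderConjugate p'.toReal)
    (hs : s.toReal.HolderConjugate s'.toReal) (h2 : 2 ≤ p')
    {F : ℝ → Lp ℂ p (volume : Measure R3)} (hF : AEStronglyMeasurable F) (ψ : 𝓢(R3, ℂ)) (t : ℝ) :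
    ‖∫ τ in Set.Iio t, ∫ y, F τ y * ∫ x, ψ x * heatKernel (((t - τ : ℝ) : ℂ) * ω) (x - y)‖ₑ ≤
      eLpNorm F s volume * eLpNorm (evol p' ω (ψ.toLp 2 (volume : Measure R3))) s' volume := by
  have hpos := hp.pos
  have hpos' := hp.symm.pos
  have hspos := hs.pos
  have hspos' := hs.symm.pos
  have ht : ∀ {e : ℝ≥0∞}, 0 < e.toReal → e ≠ 0 ∧ e ≠ ∞ := fun h ↦
    ⟨by rintro rfl; simp at h, by rintro rfl; simp at h⟩
  set U := evol p' ω (ψ.toLp 2 (volume : Measure R3))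
  have hU : StronglyMeasurable U := stronglyMeasurable_evol hω h2 (ht hpos').2 _
  have hinner : ∀ τ ∈ Set.Iio t,
      ‖∫ y, F τ y * ∫ x, ψ x * heatKernel (((t - τ : ℝ) : ℂ) * ω) (x - y)‖ₑ ≤
        ‖F τ‖ₑ * ‖U (t - τ)‖ₑ := by
    intro τ hτ
    have e : ∫ y, F τ y * ∫ x, ψ x * heatKernel (((t - τ : ℝ) : ℂ) * ω) (x - y) =
        ∫ y, F τ y * U (t - τ) y := by
      refine integral_congr_ae ?_
      filter_upwards [coeFn_evol_schwartz hω h2 (ht hpos').2 ψ (sub_pos.2 hτ)] with y hy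
      rw [hy]
    rw [e]
    refine (enorm_integral_le_lintegral_enorm _).trans ?_
    simp_rw [enorm_mul]
    refine (ENNReal.lintegral_mul_le_Lp_mul_Lq volume hp
      (Lp.stronglyMeasurable _).measurable.enorm.aemeasurable
      (Lp.stronglyMeasurable _).measurable.enorm.aemeasurable).trans (le_of_eq ?_)
    rw [Lp.enorm_def, Lp.enorm_def, eLpNorm_eq_lintegral_rpow_enorm_toReal (ht hpos).1 (ht hpos).2,
      eLpNorm_eq_lintegral_rpow_enorm_toReal (ht hpos').1 (ht hpos').2]
  have hUt : Measurable fun τ ↦ ‖U (t - τ)‖ₑ :=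
    (hU.comp_measurable (measurable_const.sub measurable_id)).enorm
  calc _ ≤ ∫⁻ τ in Set.Iio t,
        ‖∫ y, F τ y * ∫ x, ψ x * heatKernel (((t - τ : ℝ) : ℂ) * ω) (x - y)‖ₑ :=
        enorm_integral_le_lintegral_enorm _
    _ ≤ ∫⁻ τ in Set.Iio t, ‖F τ‖ₑ * ‖U (t - τ)‖ₑ := setLIntegral_mono' measurableSet_Iio hinner
    -- The restriction τ < t costs nothing, since absolute values have already been taken for this
    -- fixed t.
    _ ≤ ∫⁻ τ, ‖F τ‖ₑ * ‖U (t - τ)‖ₑ := setLIntegral_le_lintegral _ _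
    _ ≤ _ := ENNReal.lintegral_mul_le_Lp_mul_Lq volume hs hF.enorm hUt.aemeasurable
    _ = _ := by
        rw [eLpNorm_eq_lintegral_rpow_enorm_toReal (ht hspos).1 (ht hspos).2,
          eLpNorm_eq_lintegral_rpow_enorm_toReal (ht hspos').1 (ht hspos').2,
          lintegral_sub_left_eq_self (fun σ ↦ ‖U σ‖ₑ ^ s'.toReal) t]

/-- The retarded estimate in the energy space, dual to a homogeneous estimate. -/
theorem exists_enorm_duhamel_le_of_conj (hω : 0 < ω.re) (him : ω.im = 1)
    (hp : p.toReal.HolderConjugate p'.toReal) (hs : s.toReal.HolderConjugate s'.toReal)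
    (h : Admissible s' p') (hp2 : p ≤ 2) :
    ∃ C : ℝ≥0, ∀ F : ℝ → Lp ℂ p (volume : Measure R3), MemLp F s volume → ∀ t,
      IntegrableOn (fun τ ↦ convOp p 2 (heatKernel (((t - τ : ℝ) : ℂ) * ω)) (F τ)) (Set.Iio t) →
      ‖duhamel p 2 (fun t ↦ heatKernel (t * ω)) F t‖ₑ ≤ C * eLpNorm F s volume := by
  obtain ⟨C, hC⟩ := exists_eLpNorm_evol_le
  refine ⟨C, fun F hF t hint ↦ ?_⟩
  have hfin : (C : ℝ≥0∞) * eLpNorm F s volume ≠ ∞ := ENNReal.mul_ne_top (by simp) hF.2.ne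
  rw [← ENNReal.coe_toNNReal hfin]
  refine enorm_le_of_forall_schwartz fun φ ↦ ?_
  rw [ENNReal.coe_toNNReal hfin,
    (heatFamily_heatKernel hω).duhamel_apply hp2 (by norm_num) hint φ]
  refine (enorm_setIntegral_pairing_le hω hp hs h.2.1 hF.1 φ t).trans ?_
  calc _ ≤ eLpNorm F s volume * (C * ‖φ.toLp 2 (volume : Measure R3)‖ₑ) := by
        gcongr
        exact hC ω s' p' hω him h _
    _ = _ := by ring

open FourierTransform in
-- Plancherel: only the modulus of the symbol survives, and it depends on the real part of ω alone.
theorem enorm_evol_schwartz_sq (hω : 0 < ω.re) (ψ : 𝓢(R3, ℂ)) {σ : ℝ} (hσ : 0 < σ) :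
    ‖evol 2 ω (ψ.toLp 2 (volume : Measure R3)) σ‖ₑ ^ 2 =
      ∫⁻ ξ, ENNReal.ofReal (Real.exp (-(8 * Real.pi ^ 2 * ω.re * ‖ξ‖ ^ 2) * σ)) *
        ‖(𝓕⁻ ψ) ξ‖ₑ ^ 2 := by
  have hz := re_ofReal_mul_pos hω hσ
  set g := SchwartzMap.smulLeftCLM ℂ (fun ξ : R3 ↦ modGauss (σ * ω) 0 ξ) (𝓕⁻ ψ) with hg
  have e : evol 2 ω (ψ.toLp 2 (volume : Measure R3)) σ = (𝓕 g).toLp 2 (volume : Measure R3) := by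
    refine Lp.ext ?_
    filter_upwards [coeFn_evol_schwartz hω le_rfl (by norm_num) ψ hσ,
      (𝓕 g).coeFn_toLp 2 (volume : Measure R3)] with y h1 h2
    rw [h1, h2, hg, fourier_smulLeft_fourierInv hz]
  have htg : Function.HasTemperateGrowth (fun ξ : R3 ↦ modGauss (σ * ω) 0 ξ) := by
    have := hasTemperateGrowth_cexp_neg_mul_sq (re_four_pi_sq_mul hz).le
    convert this using 2 with ξ
    simp [modGauss]
  rw [e, ← ofReal_norm, SchwartzMap.norm_fourier_toL2_eq, ofReal_norm, enorm_sq_eq_lintegral]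
  refine lintegral_congr_ae ?_
  filter_upwards [g.coeFn_toLp 2 (volume : Measure R3)] with ξ h1
  rw [h1, hg, SchwartzMap.smulLeftCLM_apply_apply htg, enorm_smul, mul_pow]
  congr 1
  have e2 : -(4 * (Real.pi : ℂ) ^ 2 * (σ * ω)) * (‖ξ‖ : ℂ) ^ 2 +
      2 * Real.pi * Complex.I * ((inner ℝ (0 : R3) ξ : ℝ) : ℂ) =
      ((-(4 * Real.pi ^ 2 * σ * ‖ξ‖ ^ 2) : ℝ) : ℂ) * ω := by
    rw [inner_zero_left]; push_cast; ring
  rw [← ofReal_norm, ← ENNReal.ofReal_pow (norm_nonneg _), modGauss, e2, Complex.norm_exp,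
    ← Real.exp_nat_mul, Complex.re_ofReal_mul]
  congr 2
  push_cast
  ring

open FourierTransform in
/-- Parabolic smoothing. -/
theorem eLpNorm_evol_lineDeriv_le (hω : 0 < ω.re) (j : Fin 3) (φ : 𝓢(R3, ℂ)) :
    eLpNorm (evol 2 ω ((∂_{(EuclideanSpace.single j (1 : ℝ) : R3)} φ : 𝓢(R3, ℂ)).toLp 2
      (volume : Measure R3))) 2 volume ≤
      ENNReal.ofReal (1 / (2 * ω.re)) ^ (1 / 2 : ℝ) * ‖φ.toLp 2 (volume : Measure R3)‖ₑ := by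
  set ψ : 𝓢(R3, ℂ) := ∂_{(EuclideanSpace.single j (1 : ℝ) : R3)} φ with hψ
  have hφ : ‖φ.toLp 2 (volume : Measure R3)‖ₑ ^ 2 = ∫⁻ ξ, ‖(𝓕⁻ φ) ξ‖ₑ ^ 2 := by
    have : ‖(𝓕⁻ φ).toLp 2 (volume : Measure R3)‖ₑ = ‖φ.toLp 2 (volume : Measure R3)‖ₑ := by
      rw [← ofReal_norm, ← SchwartzMap.norm_fourier_toL2_eq, FourierTransform.fourier_fourierInv_eq,
        ofReal_norm]
    rw [← this, enorm_sq_eq_lintegral]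
    refine lintegral_congr_ae ?_
    filter_upwards [(𝓕⁻ φ).coeFn_toLp 2 (volume : Measure R3)] with ξ h1
    rw [h1]
  have hψξ : ∀ ξ, ‖(𝓕⁻ ψ) ξ‖ₑ ^ 2 ≤
      ENNReal.ofReal (4 * Real.pi ^ 2 * ‖ξ‖ ^ 2) * ‖(𝓕⁻ φ) ξ‖ₑ ^ 2 := by
    intro ξ
    have htg : (inner ℝ · (EuclideanSpace.single j (1 : ℝ) : R3)).HasTemperateGrowth := by fun_prop
    rw [hψ, SchwartzMap.fourierInv_lineDerivOp_eq, smul_apply,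
      SchwartzMap.smulLeftCLM_apply_apply htg, enorm_smul, enorm_smul, mul_pow, mul_pow, ← mul_assoc]
    gcongr
    rw [← ofReal_norm, ← ofReal_norm, ← ENNReal.ofReal_pow (norm_nonneg _),
      ← ENNReal.ofReal_pow (norm_nonneg _), ← ENNReal.ofReal_mul (by positivity)]
    refine ENNReal.ofReal_le_ofReal ?_
    have h1 : ‖inner ℝ ξ (EuclideanSpace.single j (1 : ℝ) : R3)‖ ≤ ‖ξ‖ := by
      simpa using norm_inner_le_norm (𝕜 := ℝ) ξ (EuclideanSpace.single j (1 : ℝ) : R3)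
    have h2 : ‖-(2 * (Real.pi : ℂ) * Complex.I)‖ = 2 * Real.pi := by
      simp [abs_of_pos Real.pi_pos]
    rw [h2]
    calc _ ≤ (2 * Real.pi) ^ 2 * ‖ξ‖ ^ 2 := by gcongr
      _ = _ := by ring
  have hsm : Measurable fun ξ ↦ ‖(𝓕⁻ φ) ξ‖ₑ ^ 2 := (𝓕⁻ φ).continuous.measurable.enorm.pow_const 2
  have hsm' : Measurable fun ξ ↦ ‖(𝓕⁻ ψ) ξ‖ₑ ^ 2 := (𝓕⁻ ψ).continuous.measurable.enorm.pow_const 2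
  have key : ∫⁻ σ, ‖evol 2 ω (ψ.toLp 2 (volume : Measure R3)) σ‖ₑ ^ (2 : ℝ) ≤
      ENNReal.ofReal (1 / (2 * ω.re)) * ‖φ.toLp 2 (volume : Measure R3)‖ₑ ^ 2 := by
    calc _ = ∫⁻ σ in Set.Ioi (0 : ℝ), ‖evol 2 ω (ψ.toLp 2 (volume : Measure R3)) σ‖ₑ ^ 2 := by
          rw [← lintegral_indicator measurableSet_Ioi]
          refine lintegral_congr fun σ ↦ ?_
          by_cases hσ : σ ∈ Set.Ioi (0 : ℝ)
          · rw [Set.indicator_of_mem hσ, ENNReal.rpow_two]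
          · rw [Set.indicator_of_notMem hσ, evol, Set.indicator_of_notMem hσ]; simp
      _ = ∫⁻ σ in Set.Ioi (0 : ℝ), ∫⁻ ξ,
            ENNReal.ofReal (Real.exp (-(8 * Real.pi ^ 2 * ω.re * ‖ξ‖ ^ 2) * σ)) *
              ‖(𝓕⁻ ψ) ξ‖ₑ ^ 2 :=
          setLIntegral_congr_fun measurableSet_Ioi fun σ hσ ↦ enorm_evol_schwartz_sq hω ψ hσ
      _ = ∫⁻ ξ, ∫⁻ σ in Set.Ioi (0 : ℝ),
            ENNReal.ofReal (Real.exp (-(8 * Real.pi ^ 2 * ω.re * ‖ξ‖ ^ 2) * σ)) *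
              ‖(𝓕⁻ ψ) ξ‖ₑ ^ 2 := by
          refine lintegral_lintegral_swap (Measurable.aemeasurable ?_)
          refine Measurable.mul (by fun_prop) (hsm'.comp measurable_snd)
      _ ≤ ∫⁻ ξ, ENNReal.ofReal (1 / (2 * ω.re)) * ‖(𝓕⁻ φ) ξ‖ₑ ^ 2 := by
          refine lintegral_mono fun ξ ↦ ?_
          dsimp only
          rw [lintegral_mul_const _ (by fun_prop)]
          -- At ξ = 0 the time integral of the exponential diverges, but the transform of the
          -- derivative vanishes there.
          by_cases hξ : ξ = 0
          · have : ‖(𝓕⁻ ψ) ξ‖ₑ ^ 2 = 0 := by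
              refine le_antisymm ((hψξ ξ).trans (by simp [hξ])) (by positivity)
            rw [this, mul_zero]
            positivity
          have hξ0 : 0 < ‖ξ‖ := norm_pos_iff.2 hξ
          set a := 8 * Real.pi ^ 2 * ω.re * ‖ξ‖ ^ 2
          have ha : 0 < a := by positivity
          have hI : ∫⁻ σ in Set.Ioi (0 : ℝ), ENNReal.ofReal (Real.exp (-a * σ)) =
              ENNReal.ofReal (1 / a) := by
            rw [← ofReal_integral_eq_lintegral_ofReal (integrableOn_exp_mul_Ioi (by linarith) 0)
              (.of_forall fun σ ↦ (Real.exp_pos _).le), integral_exp_mul_Ioi (by linarith)]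
            simp
          rw [hI]
          calc _ ≤ ENNReal.ofReal (1 / a) *
                (ENNReal.ofReal (4 * Real.pi ^ 2 * ‖ξ‖ ^ 2) * ‖(𝓕⁻ φ) ξ‖ₑ ^ 2) := by
                gcongr; exact hψξ ξ
            _ = _ := by
                -- The frequency cancels: 4π²|ξ|² / (8π² Re ω |ξ|²) = 1/(2 Re ω).
                rw [← mul_assoc, ← ENNReal.ofReal_mul (by positivity)]
                congr 2
                simp only [a]
                field_simp
                norm_num
      _ = _ := by rw [lintegral_const_mul _ hsm, ← hφ]
  rw [eLpNorm_eq_lintegral_rpow_enorm_toReal (by norm_num) (by norm_num), ENNReal.toReal_ofNat,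
    one_div (2 : ℝ), ENNReal.rpow_inv_le_iff (by norm_num), ENNReal.mul_rpow_of_nonneg _ _ (by norm_num),
    ← ENNReal.rpow_mul]
  simpa using key

end DualEstimates

/-! ### Assembling vector fields from components -/

section Gradient

variable {r : ℝ≥0∞} [Fact (1 ≤ r)]

/-- The `j`-th coordinate embedding. -/
noncomputable def coordEmb (j : Fin 3) : ℂ →L[ℂ] EuclideanSpace ℂ (Fin 3) :=
  ContinuousLinearMap.toSpanSingleton ℂ (EuclideanSpace.single j (1 : ℂ))

/-- The vector field with the given components. -/
noncomputable def vecLp (r : ℝ≥0∞) [Fact (1 ≤ r)] (u : Fin 3 → Lp ℂ r (volume : Measure R3)) :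
    Lp (EuclideanSpace ℂ (Fin 3)) r (volume : Measure R3) :=
  ∑ j, (coordEmb j).compLpL r volume (u j)

theorem norm_coordEmb_compLpL_le (j : Fin 3) (u : Lp ℂ r (volume : Measure R3)) :
    ‖(coordEmb j).compLpL r volume u‖ ≤ ‖u‖ := by
  have h1 : ‖coordEmb j‖ ≤ 1 := by
    simp [coordEmb, ContinuousLinearMap.norm_toSpanSingleton]
  exact (ContinuousLinearMap.norm_compLp_le (coordEmb j) u).trans
    (mul_le_of_le_one_left (norm_nonneg _) h1)

theorem vecLp_apply (u : Fin 3 → Lp ℂ r (volume : Measure R3)) (φ : 𝓢(R3, ℂ)) (j : Fin 3) :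
    ((vecLp r u : 𝓢'(R3, EuclideanSpace ℂ (Fin 3))) φ) j = (u j : 𝓢'(R3, ℂ)) φ := by
  have h1 : ∀ i, ((coordEmb i).compLpL r volume (u i) : 𝓢'(R3, EuclideanSpace ℂ (Fin 3))) φ =
      ((u i : 𝓢'(R3, ℂ)) φ) • EuclideanSpace.single i (1 : ℂ) := by
    intro i
    rw [Lp.toTemperedDistribution_apply, Lp.toTemperedDistribution_apply, ← integral_smul_const]
    refine integral_congr_ae ?_
    filter_upwards [ContinuousLinearMap.coeFn_compLpL (coordEmb i) (u i)] with x hx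
    rw [hx]
    simp [coordEmb, smul_smul]
  have h2 : (vecLp r u : 𝓢'(R3, EuclideanSpace ℂ (Fin 3))) φ =
      ∑ i, ((coordEmb i).compLpL r volume (u i) : 𝓢'(R3, EuclideanSpace ℂ (Fin 3))) φ := by
    exact map_sum ((PointwiseConvergenceCLM.evalCLM _ (EuclideanSpace ℂ (Fin 3)) φ).comp
      (Lp.toTemperedDistributionCLM (EuclideanSpace ℂ (Fin 3)) volume r)) _ _
  rw [h2]
  simp_rw [h1]
  simp [Fin.sum_univ_three]
  fin_cases j <;> simp

theorem eLpNorm_vecLp_le {μ : Measure ℝ} {u : Fin 3 → ℝ → Lp ℂ r (volume : Measure R3)} {q : ℝ≥0∞}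
    (hq : 1 ≤ q) (hu : ∀ j, AEStronglyMeasurable (u j) μ) {M : ℝ≥0∞}
    (hM : ∀ j, eLpNorm (u j) q μ ≤ M) :
    AEStronglyMeasurable (fun t ↦ vecLp r fun j ↦ u j t) μ ∧
      eLpNorm (fun t ↦ vecLp r fun j ↦ u j t) q μ ≤ 3 * M := by
  have hm : ∀ j ∈ Finset.univ, AEStronglyMeasurable
      (fun t ↦ (coordEmb j).compLpL r volume (u j t)) μ :=
    fun j _ ↦ ((coordEmb j).compLpL r volume).continuous.comp_aestronglyMeasurable (hu j)
  have e : (fun t ↦ vecLp r fun j ↦ u j t) =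
      ∑ j, fun t ↦ (coordEmb j).compLpL r volume (u j t) := by
    ext1 t; simp [vecLp]
  rw [e]
  refine ⟨Finset.aestronglyMeasurable_sum _ hm, (eLpNorm_sum_le hm hq).trans ?_⟩
  calc _ ≤ ∑ _j : Fin 3, M := by
        refine Finset.sum_le_sum fun j _ ↦ (eLpNorm_mono fun t ↦ ?_).trans (hM j)
        exact norm_coordEmb_compLpL_le j _
    _ = 3 * M := by simp

end Gradient

/-! ### Extending the source by zero -/

section Truncation

variable {p s : ℝ≥0∞} [Fact (1 ≤ p)]

theorem IsDuhamel.congr {ε t : ℝ} {F G : ℝ → 𝓢'(R3, ℂ)} {w : 𝓢'(R3, ℂ)} (ht : 0 ≤ t)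
    (h : IsDuhamel ε t F w) (hFG : ∀ τ ∈ Set.Icc 0 t, F τ = G τ) : IsDuhamel ε t G w := by
  intro φ
  obtain ⟨h1, h2⟩ := h φ
  have e : Set.EqOn (fun τ ↦ heatSchrodinger ε (t - τ) (F τ) φ)
      (fun τ ↦ heatSchrodinger ε (t - τ) (G τ) φ) (Set.uIcc 0 t) := fun τ hτ ↦ by
    dsimp only
    rw [hFG τ (by rwa [Set.uIcc_of_le ht] at hτ)]
  exact ⟨h1.congr (fun τ hτ ↦ e (Set.uIoc_subset_uIcc hτ)),
    h2.trans (intervalIntegral.integral_congr e)⟩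

/-- Extension of a source by zero outside the time interval. -/
noncomputable def truncSource (T : ℝ) (F : ℝ → Lp ℂ p (volume : Measure R3)) :
    ℝ → Lp ℂ p (volume : Measure R3) := (Set.Icc 0 T).indicator F

variable {T : ℝ} {F : ℝ → Lp ℂ p (volume : Measure R3)}

theorem memLp_truncSource (hF : MemLp F s (timeMeasure T)) : MemLp (truncSource T F) s volume :=
  (memLp_indicator_iff_restrict measurableSet_Icc).2 hF

theorem eLpNorm_truncSource : eLpNorm (truncSource T F) s volume = eLpNorm F s (timeMeasure T) :=
  eLpNorm_indicator_eq_eLpNorm_restrict measurableSet_Icc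

theorem integrable_truncSource (hs : 1 ≤ s) (hF : MemLp F s (timeMeasure T)) :
    Integrable (truncSource T F) :=
  (integrable_indicator_iff measurableSet_Icc).2 (hF.integrable hs)

theorem isDuhamel_truncSource {ε : ℝ} (hε : 0 < ε) (hp : p ≠ ∞) (hs : 1 ≤ s)
    (hF : MemLp F s (timeMeasure T)) {t : ℝ} (ht : t ∈ Set.Icc 0 T) :
    IsDuhamel ε t (fun τ ↦ (F τ : 𝓢'(R3, ℂ)))
      (duhamel p p (fun t ↦ heatKernel (t * (ε + Complex.I))) (truncSource T F) t :
        𝓢'(R3, ℂ)) := by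
  refine (isDuhamel_duhamel hε hp (integrable_truncSource hs hF) (fun τ hτ ↦ ?_) ht.1).congr ht.1
    fun τ hτ ↦ ?_
  · exact Set.indicator_of_notMem (fun h ↦ absurd h.1 (not_le.2 hτ)) _
  · rw [truncSource, Set.indicator_of_mem (Set.Icc_subset_Icc_right ht.2 hτ)]

end Truncation

/-! ### Exponent arithmetic and the retarded estimates on the line -/

section Retarded

variable {ω : ℂ} {q r s p : ℝ≥0∞}

theorem admissible_of_toReal {a b : ℝ≥0∞} (ha : a ≠ 0) (hb : b ≠ ∞) (hb2 : 2 ≤ b.toReal)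
    (hb6 : b.toReal ≤ 6) (h : 2 / a.toReal + 3 / b.toReal = 3 / 2) : Admissible a b := by
  have hb0 : b ≠ 0 := by rintro rfl; simp at hb2; linarith
  refine ⟨?_, ?_, ?_⟩
  · rw [← toReal_two_div_add_three_div ha hb0] at h
    refine (ENNReal.toReal_eq_toReal_iff' ?_ (ENNReal.div_ne_top (by simp) (by simp))).1
      (by rw [h]; simp)
    exact ENNReal.add_ne_top.2 ⟨ENNReal.div_ne_top (by simp) ha, ENNReal.div_ne_top (by simp) hb0⟩
  · rw [← ENNReal.ofReal_toReal hb]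
    simpa using ENNReal.ofReal_le_ofReal hb2
  · rw [← ENNReal.ofReal_toReal hb]
    simpa using ENNReal.ofReal_le_ofReal hb6

theorem le_two_of_half_le_inv (hp : 1 / 2 ≤ 1 / p) : p ≤ 2 := by
  rw [one_div, one_div, ENNReal.inv_le_inv] at hp
  exact hp

theorem scaling_toReal [Fact (1 ≤ p)] {c : ℝ≥0∞} (hc : c ≠ ∞) (h : 2 / s + 3 / p = c) :
    s ≠ 0 ∧ 2 / s.toReal + 3 / p.toReal = c.toReal := by
  have hp0 : p ≠ 0 := (lt_of_lt_of_le one_pos (Fact.out : 1 ≤ p)).ne'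
  have hs0 : s ≠ 0 := by
    rintro rfl
    rw [ENNReal.div_zero (by norm_num), top_add] at h
    exact hc h.symm
  exact ⟨hs0, by rw [← h, toReal_two_div_add_three_div hs0 hp0]⟩

theorem conj_ofReal_conjExponent {a : ℝ≥0∞} (ha : 1 < a.toReal) :
    a.toReal.HolderConjugate (ENNReal.ofReal a.toReal.conjExponent).toReal := by
  have h := Real.HolderConjugate.conjExponent ha
  rwa [ENNReal.toReal_ofReal h.symm.nonneg]

theorem one_div_toReal_lt {a b c : ℝ≥0∞} (ha : a ≠ 0) (hb : b ≠ 0) (hc : c ≠ ∞)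
    (h : 1 / a < 1 / b + c) : 1 / a.toReal < 1 / b.toReal + c.toReal := by
  have ha' : 1 / a ≠ ∞ := ENNReal.div_ne_top (by simp) ha
  have hb' : 1 / b ≠ ∞ := ENNReal.div_ne_top (by simp) hb
  have h2 := (ENNReal.toReal_lt_toReal ha' (ENNReal.add_ne_top.2 ⟨hb', hc⟩)).2 h
  rw [ENNReal.toReal_add hb' hc, ENNReal.toReal_div, ENNReal.toReal_div] at h2
  simpa using h2

theorem Admissible.one_le_left (h : Admissible q r) : 1 ≤ q := by
  by_cases hq : q = ∞
  · simp [hq]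
  rw [← ENNReal.ofReal_toReal hq]
  simpa using (h.two_le_toReal_left hq).trans' one_le_two

theorem toReal_le_two [Fact (1 ≤ p)] (hp : 1 / 2 ≤ 1 / p) :
    p ≠ ∞ ∧ 1 ≤ p.toReal ∧ p.toReal ≤ 2 := by
  have hp2 := le_two_of_half_le_inv hp
  have hpt : p ≠ ∞ := ne_top_of_le_ne_top (by simp) hp2
  exact ⟨hpt, one_le_toReal (Fact.out : 1 ≤ p) hpt, by simpa using ENNReal.toReal_mono (by simp) hp2⟩

/-- Both cases of the range lead to the same inequality: if r < 3, then 1/p ≤ 1 < 1/r + 2/3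
automatically. Multiplied by 3/2, it says that the singularity in time is integrable. -/
theorem DualRange.toReal_relations [Fact (1 ≤ p)] (h : Admissible q r) (hd : DualRange r s p) :
    s ≠ ∞ ∧ 1 ≤ s.toReal ∧ 2 * (1 / s.toReal) + 3 * (1 / p.toReal) = 7 / 2 ∧
      1 / p.toReal - 1 / r.toReal < 2 / 3 := by
  obtain ⟨hs0, hsc⟩ := scaling_toReal (ENNReal.div_ne_top (by simp) (by simp)) hd.1
  obtain ⟨hpt, hp1, hp2⟩ := toReal_le_two hd.2.1
  have hr2 := h.two_le_toReal
  have hip : 1 / 2 ≤ 1 / p.toReal := one_div_le_one_div_of_le (by linarith) hp2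
  have hip1 : 1 / p.toReal ≤ 1 := by rw [div_le_one (by linarith)]; exact hp1
  have e7 : (7 / 2 : ℝ≥0∞).toReal = 7 / 2 := by simp
  rw [e7, show 3 / p.toReal = 3 * (1 / p.toReal) by ring,
    show 2 / s.toReal = 2 * (1 / s.toReal) by ring] at hsc
  have hst : s ≠ ∞ := by
    rintro rfl
    simp only [ENNReal.toReal_top, div_zero, mul_zero, zero_add] at hsc
    linarith
  have hspos : 0 < s.toReal := ENNReal.toReal_pos hs0 hst
  refine ⟨hst, ?_, hsc, ?_⟩
  · have : 1 / s.toReal ≤ 1 := by linarith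
    rwa [div_le_one hspos] at this
  · rcases lt_or_ge r 3 with h3 | h3
    · have h4 : r.toReal < 3 := by
        simpa using (ENNReal.toReal_lt_toReal h.ne_top_right (by simp)).2 h3
      have : 1 / 3 < 1 / r.toReal := one_div_lt_one_div_of_lt (by linarith) h4
      linarith
    · have h4 := one_div_toReal_lt (by rintro rfl; simp at hp1; linarith)
        (by rintro rfl; simp at hr2; linarith) (ENNReal.div_ne_top (by simp) (by simp))
        (hd.2.2.2 h3)
      have e : (2 / 3 : ℝ≥0∞).toReal = 2 / 3 := by simp
      rw [e] at h4
      linarith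

theorem GradDualRange.toReal_relations [Fact (1 ≤ p)] (h : Admissible q r)
    (hd : GradDualRange r s p) :
    s ≠ ∞ ∧ 2 ≤ s.toReal ∧ 2 * (1 / s.toReal) + 3 * (1 / p.toReal) = 5 / 2 ∧
      1 / p.toReal - 1 / r.toReal < 1 / 3 := by
  obtain ⟨hs0, hsc⟩ := scaling_toReal (ENNReal.div_ne_top (by simp) (by simp)) hd.1
  obtain ⟨hpt, hp1, hp2⟩ := toReal_le_two hd.2.1
  have hr2 := h.two_le_toReal
  have hip : 1 / 2 ≤ 1 / p.toReal := one_div_le_one_div_of_le (by linarith) hp2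
  have hir : 1 / r.toReal ≤ 1 / 2 := one_div_le_one_div_of_le (by norm_num) hr2
  have e5 : (5 / 2 : ℝ≥0∞).toReal = 5 / 2 := by simp
  rw [e5, show 3 / p.toReal = 3 * (1 / p.toReal) by ring,
    show 2 / s.toReal = 2 * (1 / s.toReal) by ring] at hsc
  have hlt : 1 / p.toReal < 1 / r.toReal + 1 / 3 := by
    have h4 := one_div_toReal_lt (by rintro rfl; simp at hp1; linarith)
      (by rintro rfl; simp at hr2; linarith) (ENNReal.div_ne_top (by simp) (by simp)) hd.2.2
    have e : (1 / 3 : ℝ≥0∞).toReal = 1 / 3 := by simp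
    rwa [e] at h4
  have hst : s ≠ ∞ := by
    rintro rfl
    simp only [ENNReal.toReal_top, div_zero, mul_zero, zero_add] at hsc
    linarith
  have hspos : 0 < s.toReal := ENNReal.toReal_pos hs0 hst
  refine ⟨hst, ?_, hsc, by linarith⟩
  have : 1 / s.toReal ≤ 1 / 2 := by linarith
  rwa [one_div_le_one_div hspos (by norm_num)] at this

theorem one_le_of_one_le_toReal (hs : 1 ≤ s.toReal) : 1 ≤ s := by
  by_cases hst : s = ∞
  · simp [hst]
  rw [← ENNReal.ofReal_toReal hst]
  simpa using hs

/-- The inhomogeneous retarded estimate for sources defined on the whole line. -/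
theorem exists_eLpNorm_duhamel_heatKernel_le [Fact (1 ≤ p)] [Fact (1 ≤ r)] (hω : 0 < ω.re)
    (him : ω.im = 1) (h : Admissible q r) (hd : DualRange r s p) (hqs : q = ∞ → s ≤ 2) :
    ∃ C : ℝ≥0, ∀ (T : ℝ) (F : ℝ → Lp ℂ p (volume : Measure R3)), MemLp F s volume → Integrable F →
      eLpNorm (duhamel p r (fun t ↦ heatKernel (t * ω)) F) q (timeMeasure T) ≤
        C * eLpNorm F s volume := by
  obtain ⟨hst, hs1, hsc, hαr⟩ := hd.toReal_relations h
  obtain ⟨hpt, hp1, hp2'⟩ := toReal_le_two hd.2.1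
  have hp2 := le_two_of_half_le_inv hd.2.1
  have hpr : p ≤ r := hp2.trans h.2.1
  have hadm := h.toReal_eq
  have hip : 1 / 2 ≤ 1 / p.toReal := one_div_le_one_div_of_le (by linarith) hp2'
  have hspos : 0 < s.toReal := by linarith
  rw [show 3 / r.toReal = 3 * (1 / r.toReal) by ring,
    show 2 / q.toReal = 2 * (1 / q.toReal) by ring] at hadm
  -- For s = 1 scaling forces p = 2, and Minkowski with the homogeneous estimate replaces fractional
  -- integration.
  rcases hs1.eq_or_lt with hs1 | hs1
  · have hs1' : s = 1 := by rw [← ENNReal.ofReal_toReal hst, ← hs1]; simp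
    subst hs1'
    have hpe : p = 2 := by
      have h5 : 1 / p.toReal = 1 / 2 := by
        rw [ENNReal.toReal_one] at hsc
        linarith
      have h6 : p.toReal = 2 := by
        rw [div_eq_div_iff (by linarith) (by norm_num)] at h5; linarith
      rw [← ENNReal.ofReal_toReal hpt, h6]; simp
    subst hpe
    obtain ⟨C, hC⟩ := exists_eLpNorm_duhamel_one_le hω him h
    exact ⟨C, fun T F hF _ ↦ (eLpNorm_mono_measure _ Measure.restrict_le_self).trans (hC F hF.1)⟩
  -- For q = ∞ fractional integration fails. By scaling, the conjugate pair (s', p') is admissible,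
  -- and s ≤ 2 amounts to p' ≤ 6.
  by_cases hq : q = ∞
  · subst hq
    obtain rfl := h.right_eq_two
    have hs2 : s.toReal ≤ 2 := by simpa using ENNReal.toReal_mono (by simp) (hqs rfl)
    have his : 1 / 2 ≤ 1 / s.toReal := one_div_le_one_div_of_le (by linarith) hs2
    have his1 : 1 / s.toReal < 1 := by rw [div_lt_one hspos]; exact hs1
    have hp1' : 1 < p.toReal := by
      have : 1 / p.toReal < 1 := by linarith
      rwa [div_lt_one (by linarith)] at this
    have hcs := conj_ofReal_conjExponent hs1
    have hcp := conj_ofReal_conjExponent hp1'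
    set s' := ENNReal.ofReal s.toReal.conjExponent
    set p' := ENNReal.ofReal p.toReal.conjExponent
    have is' := hcs.inv_add_inv_eq_one
    have ip' := hcp.inv_add_inv_eq_one
    simp only [← one_div] at is' ip'
    have hp'pos := hcp.symm.pos
    have hp'1 : Fact (1 ≤ p') :=
      ⟨(ENNReal.toReal_le_toReal (by simp) ENNReal.ofReal_ne_top).1
        (by rw [ENNReal.toReal_one]; exact hcp.symm.lt.le)⟩
    have hadm' : Admissible s' p' := by
      refine admissible_of_toReal ?_ ENNReal.ofReal_ne_top ?_ ?_ ?_
      · have := hcs.symm.pos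
        rintro h0
        rw [h0] at this
        simp at this
      · have : 1 / p'.toReal ≤ 1 / 2 := by linarith
        rwa [one_div_le_one_div hp'pos (by norm_num)] at this
      · have : 1 / 6 ≤ 1 / p'.toReal := by linarith
        rwa [one_div_le_one_div (by norm_num) hp'pos] at this
      · rw [show 2 / s'.toReal = 2 * (1 / s'.toReal) by ring,
          show 3 / p'.toReal = 3 * (1 / p'.toReal) by ring]
        linarith
    obtain ⟨C, hC⟩ := exists_enorm_duhamel_le_of_conj hω him hcp hcs hadm' hp2
    refine ⟨C, fun T F hF hFi ↦ ?_⟩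
    rw [eLpNorm_exponent_top]
    refine eLpNormEssSup_le_of_ae_enorm_bound ?_
    have hα : (0 : ℝ) + 3 / 2 * expGap p 2 < 1 := by
      simp only [expGap, ENNReal.toReal_ofNat]; linarith
    filter_upwards [(heatFamily_heatKernel hω).ae_integrableOn_convOp hp2 (by norm_num) hα hFi T]
      with t ht
    exact hC F hF t ht
  -- Now p ≤ 2 < r makes the exponent positive, and the difference of the two scaling relations is
  -- the condition for fractional integration.
  · have hr2' := h.two_lt_toReal hq
    have hirp : 1 / r.toReal < 1 / 2 := one_div_lt_one_div_of_lt (by norm_num) hr2'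
    have hq2 := h.two_le_toReal_left hq
    obtain ⟨C, hC⟩ := (heatFamily_heatKernel hω).exists_eLpNorm_duhamel_le hpr h.ne_top_right
      (s := s) (q := q) (by simp only [expGap]; linarith) (by simp only [expGap]; linarith) hs1
      (by linarith) (by simp only [expGap]; linarith)
    exact ⟨C, fun T F hF _ ↦ (eLpNorm_mono_measure _ Measure.restrict_le_self).trans (hC F hF.1)⟩

/-- The retarded estimate with a gain of one derivative for sources defined on the whole line. -/
theorem exists_eLpNorm_duhamel_heatKernelDeriv_le [Fact (1 ≤ p)] [Fact (1 ≤ r)] (hω : 0 < ω.re)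
    (h : Admissible q r) (hd : GradDualRange r s p) (hqs : q = ∞ → s ≤ 2) (j : Fin 3) :
    ∃ C : ℝ≥0, ∀ (T : ℝ) (F : ℝ → Lp ℂ p (volume : Measure R3)), MemLp F s volume → Integrable F →
      eLpNorm (duhamel p r (fun t ↦ heatKernelDeriv j (t * ω)) F) q (timeMeasure T) ≤
        C * eLpNorm F s volume := by
  obtain ⟨hst, hs2, hsc, hαr⟩ := hd.toReal_relations h
  obtain ⟨hpt, hp1, hp2'⟩ := toReal_le_two hd.2.1
  have hp2 := le_two_of_half_le_inv hd.2.1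
  have hpr : p ≤ r := hp2.trans h.2.1
  have hadm := h.toReal_eq
  have hip : 1 / 2 ≤ 1 / p.toReal := one_div_le_one_div_of_le (by linarith) hp2'
  have hir : 1 / r.toReal ≤ 1 / 2 := one_div_le_one_div_of_le (by norm_num) h.two_le_toReal
  rw [show 3 / r.toReal = 3 * (1 / r.toReal) by ring,
    show 2 / q.toReal = 2 * (1 / q.toReal) by ring] at hadm
  -- For q = ∞ scaling and s ≤ 2 force s = p = 2; the derivative is moved to the test function,
  -- where parabolic smoothing applies.
  by_cases hq : q = ∞
  · subst hq
    obtain rfl := h.right_eq_two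
    have hs2' : s = 2 := by
      refine le_antisymm (hqs rfl) ?_
      rw [← ENNReal.ofReal_toReal hst]
      simpa using ENNReal.ofReal_le_ofReal hs2
    subst hs2'
    have hpe : p = 2 := by
      have h5 : 1 / p.toReal = 1 / 2 := by
        rw [ENNReal.toReal_ofNat] at hsc
        linarith
      have h6 : p.toReal = 2 := by
        rw [div_eq_div_iff (by linarith) (by norm_num)] at h5; linarith
      rw [← ENNReal.ofReal_toReal hpt, h6]; simp
    subst hpe
    refine ⟨(ENNReal.ofReal (1 / (2 * ω.re)) ^ (1 / 2 : ℝ)).toNNReal, fun T F hF hFi ↦ ?_⟩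
    rw [eLpNorm_exponent_top]
    refine eLpNormEssSup_le_of_ae_enorm_bound ?_
    have hα : (1 / 2 : ℝ) + 3 / 2 * expGap 2 2 < 1 := by
      simp only [expGap]; norm_num
    rw [ENNReal.coe_toNNReal (by finiteness)]
    filter_upwards [(heatFamily_heatKernelDeriv j hω).ae_integrableOn_convOp le_rfl (by norm_num)
      hα hFi T] with t ht
    set c := ENNReal.ofReal (1 / (2 * ω.re)) ^ (1 / 2 : ℝ) with hc
    have hfin : c * eLpNorm F 2 volume ≠ ∞ := ENNReal.mul_ne_top (by finiteness) hF.2.ne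
    rw [← ENNReal.coe_toNNReal hfin]
    refine enorm_le_of_forall_schwartz fun φ ↦ ?_
    rw [ENNReal.coe_toNNReal hfin, duhamel_heatKernelDeriv_apply hω le_rfl (by norm_num) hFi j ht,
      TemperedDistribution.lineDerivOp_apply_apply, map_neg, enorm_neg,
      (heatFamily_heatKernel hω).duhamel_apply le_rfl (by norm_num)
        (integrableOn_convOp_heatKernel hω (by norm_num) hFi t)]
    have h22 : ((2 : ℝ≥0∞).toReal).HolderConjugate (2 : ℝ≥0∞).toReal := by
      rw [ENNReal.toReal_ofNat]; exact Real.HolderConjugate.two_two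
    refine (enorm_setIntegral_pairing_le hω h22 h22 le_rfl hF.1 _ t).trans ?_
    calc _ ≤ eLpNorm F 2 volume * (c * ‖φ.toLp 2 (volume : Measure R3)‖ₑ) := by
          gcongr
          exact eLpNorm_evol_lineDeriv_le hω j φ
      _ = _ := by ring
  · have hq2 := h.two_le_toReal_left hq
    obtain ⟨C, hC⟩ := (heatFamily_heatKernelDeriv j hω).exists_eLpNorm_duhamel_le hpr h.ne_top_right
      (s := s) (q := q) (by simp only [expGap]; linarith) (by simp only [expGap]; linarith)
      (by linarith) (by linarith) (by simp only [expGap]; linarith)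
    exact ⟨C, fun T F hF _ ↦ (eLpNorm_mono_measure _ Measure.restrict_le_self).trans (hC F hF.1)⟩

end Retarded

/-! ### Assembly of the three estimates -/

theorem mainTheorem7 :
    -- homogeneous estimate
    (∃ C : ℝ≥0, ∀ (ε T : ℝ) (q r : ℝ≥0∞) [Fact (1 ≤ r)],
      0 < ε → 0 < T → Admissible q r →
      ∀ f : Lp ℂ 2 (volume : Measure R3),
        ∃ u : ℝ → Lp ℂ r (volume : Measure R3),
          MemLp u q (timeMeasure T) ∧
          (∀ᵐ t ∂(timeMeasure T), (u t : 𝓢'(R3, ℂ)) = heatSchrodinger ε t (f : 𝓢'(R3, ℂ))) ∧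
          eLpNorm u q (timeMeasure T) ≤ C * ‖f‖ₑ) ∧
    -- inhomogeneous retarded estimate
    (∀ (ε : ℝ) (q r s p : ℝ≥0∞) [Fact (1 ≤ r)] [Fact (1 ≤ p)],
      0 < ε → Admissible q r → DualRange r s p → (q = ∞ → s ≤ 2) →
      ∃ C : ℝ≥0, ∀ (T : ℝ), 0 < T →
        ∀ F : ℝ → Lp ℂ p (volume : Measure R3), MemLp F s (timeMeasure T) →
          ∃ w : ℝ → 𝓢'(R3, ℂ),
            (∀ t ∈ Set.Icc 0 T, IsDuhamel ε t (fun τ ↦ (F τ : 𝓢'(R3, ℂ))) (w t)) ∧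
            ∃ u : ℝ → Lp ℂ r (volume : Measure R3),
              MemLp u q (timeMeasure T) ∧
              (∀ᵐ t ∂(timeMeasure T), (u t : 𝓢'(R3, ℂ)) = w t) ∧
              eLpNorm u q (timeMeasure T) ≤ C * eLpNorm F s (timeMeasure T)) ∧
    -- inhomogeneous retarded estimate with a gain of one derivative
    (∀ (ε : ℝ) (q r s p : ℝ≥0∞) [Fact (1 ≤ r)] [Fact (1 ≤ p)],
      0 < ε → Admissible q r → (q, r) ≠ (2, 6) → GradDualRange r s p → (q = ∞ → s ≤ 2) →
      ∃ C : ℝ≥0, ∀ (T : ℝ), 0 < T →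
        ∀ F : ℝ → Lp ℂ p (volume : Measure R3), MemLp F s (timeMeasure T) →
          ∃ w : ℝ → 𝓢'(R3, ℂ),
            (∀ t ∈ Set.Icc 0 T, IsDuhamel ε t (fun τ ↦ (F τ : 𝓢'(R3, ℂ))) (w t)) ∧
            ∃ G : ℝ → Lp (EuclideanSpace ℂ (Fin 3)) r (volume : Measure R3),
              MemLp G q (timeMeasure T) ∧
              (∀ᵐ t ∂(timeMeasure T),
                IsGradient (G t : 𝓢'(R3, EuclideanSpace ℂ (Fin 3))) (w t)) ∧
              eLpNorm G q (timeMeasure T) ≤ C * eLpNorm F s (timeMeasure T)) := by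
  have hre : ∀ {ε : ℝ}, 0 < ε → 0 < ((ε : ℂ) + Complex.I).re := fun h ↦ by simpa using h
  have him : ∀ {ε : ℝ}, ((ε : ℂ) + Complex.I).im = 1 := by simp
  refine ⟨?_, ?_, ?_⟩
  · obtain ⟨C, hC⟩ := exists_eLpNorm_evol_le
    refine ⟨C, fun ε T q r _ hε hT h f ↦ ⟨evol r (ε + Complex.I) f, ?_⟩⟩
    have hle : eLpNorm (evol r (ε + Complex.I) f) q (timeMeasure T) ≤ C * ‖f‖ₑ :=
      (eLpNorm_mono_measure _ Measure.restrict_le_self).trans (hC _ q r (hre hε) him h f)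
    refine ⟨⟨(stronglyMeasurable_evol (hre hε) h.2.1 h.ne_top_right f).aestronglyMeasurable,
      hle.trans_lt (ENNReal.mul_lt_top (by simp) (by simp))⟩, ?_, hle⟩
    -- The evolution was set to zero at t = 0, so that single time is discarded.
    have h0 : ∀ᵐ t ∂(timeMeasure T), t ≠ 0 := ae_restrict_of_ae (Measure.ae_ne volume 0)
    filter_upwards [ae_restrict_mem measurableSet_Icc, h0] with t ht ht0
    have htpos : 0 < t := lt_of_le_of_ne ht.1 (Ne.symm ht0)
    rw [evol_of_pos htpos]
    exact convOp_heatKernel_eq_heatSchrodinger hε htpos h.2.1 h.ne_top_right f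
  · intro ε q r s p _ _ hε h hd hqs
    obtain ⟨C, hC⟩ := exists_eLpNorm_duhamel_heatKernel_le (hre hε) him h hd hqs
    have hp2 := le_two_of_half_le_inv hd.2.1
    have hpt : p ≠ ∞ := ne_top_of_le_ne_top (by simp) hp2
    have hpr := hp2.trans h.2.1
    have hs : 1 ≤ s := one_le_of_one_le_toReal (hd.toReal_relations h).2.1
    have hα : (0 : ℝ) + 3 / 2 * expGap p r < 1 := by
      have := (hd.toReal_relations h).2.2.2
      rw [expGap]; linarith
    refine ⟨C, fun T hT F hF ↦ ?_⟩
    set F₀ := truncSource T F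
    have hF₀ := memLp_truncSource hF
    have hFi := integrable_truncSource hs hF
    have hle := hC T F₀ hF₀ hFi
    rw [eLpNorm_truncSource] at hle
    refine ⟨_, fun t ht ↦ isDuhamel_truncSource hε hpt hs hF ht, _,
      ⟨((heatFamily_heatKernel (hre hε)).aestronglyMeasurable_duhamel hpr h.ne_top_right
        hF₀.1).restrict, hle.trans_lt (ENNReal.mul_lt_top (by simp) hF.2)⟩, ?_, hle⟩
    filter_upwards [(heatFamily_heatKernel (hre hε)).ae_integrableOn_convOp hpr h.ne_top_right
      hα hFi T] with t ht
    -- The L^r-valued and the L^p-valued integral pair with φ through the same kernel formula, hence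
    -- define the same distribution.
    ext φ
    rw [(heatFamily_heatKernel (hre hε)).duhamel_apply hpr h.ne_top_right ht,
      (heatFamily_heatKernel (hre hε)).duhamel_apply le_rfl hpt
        (integrableOn_convOp_heatKernel (hre hε) hpt hFi t)]
  · intro ε q r s p _ _ hε h _ hd hqs
    choose C hC using
      fun j ↦ exists_eLpNorm_duhamel_heatKernelDeriv_le (hre hε) h hd hqs j
    have hp2 := le_two_of_half_le_inv hd.2.1
    have hpt : p ≠ ∞ := ne_top_of_le_ne_top (by simp) hp2
    have hpr := hp2.trans h.2.1
    obtain ⟨_, hs2, _, hα⟩ := hd.toReal_relations h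
    have hs : 1 ≤ s := one_le_of_one_le_toReal (one_le_two.trans hs2)
    -- The sum of the constants bounds each component, and the triangle inequality over three
    -- components gives the factor 3.
    refine ⟨3 * ∑ j, C j, fun T hT F hF ↦ ?_⟩
    set F₀ := truncSource T F
    have hF₀ := memLp_truncSource hF
    have hFi := integrable_truncSource hs hF
    set u := fun (j : Fin 3) ↦ duhamel p r (fun t ↦ heatKernelDeriv j (t * (ε + Complex.I))) F₀
    have hu : ∀ j, AEStronglyMeasurable (u j) (timeMeasure T) := fun j ↦
      ((heatFamily_heatKernelDeriv j (hre hε)).aestronglyMeasurable_duhamel hpr h.ne_top_right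
        hF₀.1).restrict
    have hM : ∀ j, eLpNorm (u j) q (timeMeasure T) ≤
        ((∑ j, C j : ℝ≥0) : ℝ≥0∞) * eLpNorm F s (timeMeasure T) := by
      intro j
      have hle := hC j T F₀ hF₀ hFi
      rw [eLpNorm_truncSource] at hle
      refine hle.trans ?_
      gcongr
      exact Finset.single_le_sum (f := C) (fun _ _ ↦ zero_le) (Finset.mem_univ j)
    obtain ⟨hG1, hG2⟩ := eLpNorm_vecLp_le h.one_le_left hu hM
    have hle : eLpNorm (fun t ↦ vecLp r fun j ↦ u j t) q (timeMeasure T) ≤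
        ((3 * ∑ j, C j : ℝ≥0) : ℝ≥0∞) * eLpNorm F s (timeMeasure T) := by
      refine hG2.trans (le_of_eq ?_)
      push_cast
      rw [mul_assoc]
    refine ⟨_, fun t ht ↦ isDuhamel_truncSource hε hpt hs hF ht, _,
      ⟨hG1, hle.trans_lt (ENNReal.mul_lt_top ENNReal.coe_lt_top hF.2)⟩, ?_, hle⟩
    have hint : ∀ᵐ t ∂(timeMeasure T), ∀ j, IntegrableOn (fun τ ↦ convOp p r
        (heatKernelDeriv j (((t - τ : ℝ) : ℂ) * (ε + Complex.I))) (F₀ τ)) (Set.Iio t) :=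
      ae_all_iff.2 fun j ↦ (heatFamily_heatKernelDeriv j (hre hε)).ae_integrableOn_convOp hpr
        h.ne_top_right (by rw [expGap]; linarith) hFi T
    filter_upwards [hint] with t ht φ j
    rw [vecLp_apply]
    exact duhamel_heatKernelDeriv_apply (hre hε) hpr h.ne_top_right hFi j (ht j) φ
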